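/- Let $d\ge1$. Let $\chi:\mathbb R^d\to\mathbb R$ be smooth and radial, supported in $\{|\xi|\le 4/3\}$, with $\chi=1$ on $\{|\xi|\le 3/4\}$; put $\varphi(\xi)=\chi(\xi/2)-\chi(\xi)$, $\dot S_j=\chi(2^{-j}D)$ and $\dot\Delta_j=\varphi(2^{-j}D)$ for $j\in\mathbb Z$, and let $\mathcal S'_h$ be the set of tempered distributions $u$ on $\mathbb R^d$ with $\|\dot S_ju\|_{L^\infty}\to0$ as $j\to-\infty$. For $0<T\le\infty$, $\sigma\in\mathbb R$ and $Z:(0,T)\to\mathcal S'_h$ measurable put $$\|Z\|_{\widetilde L^\infty_T(\dot B^\sigma_{p,1})}=\sum_{j\in\mathbb Z}2^{j\sigma}\|\dot\Delta_jZ\|_{L^\infty(0,T;L^p(\mathbb R^d))}.$$ Let $\Lambda_1$ be the Fourier multiplier with symbol $|\xi|_1=\sum_{i=1}^d|\xi_i|$. For $a>0$ and $u,U\in\mathcal S'_h$, $U=e^{a\Lambda_1}u$ means that $u=e^{-a\Lambda_1}U$, where $e^{-a\Lambda_1}$ is the convolution with $h_a=\mathcal F^{-1}(e^{-a|\cdot|_1})$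 (applied to each $\dot\Delta_jU$). For $c_0>0$, $e^{\sqrt{c_0t}\Lambda_1}z$ denotes the function $t\mapsto e^{\sqrt{c_0t}\Lambda_1}z(t)$ on $(0,T)$. Let $1<p<\infty$, $\frac1{p'}=1-\frac1p$, and let $F:\mathbb R\to\mathbb R$ be real analytic in a neighborhood of $0$. (i) Assume $F(0)=0$. There is a constant $R_0>0$ depending only on $p$, $d$, $F$ (and $\chi$), and for every $s$ with $-\min\bigl(\frac dp,\frac d{p'}\bigr)<s\le\frac dp$ there is a constant $D>0$ depending only on $s$, $p$, $d$, $F$ (and $\chi$), such that for all $c_0>0$, all $0<T\le\infty$ and all real-valued $z$ on $(0,T)\times\mathbb R^d$: if $e^{\sqrt{c_0t}\Lambda_1}z$ exists and $$\|e^{\sqrt{c_0t}\Lambda_1}z\|_{\widetilde L^\infty_T(\dot B^{d/p}_{p,1})}\le R_0,$$ then $e^{\sqrt{c_0t}\Lambda_1}F(z)$ exists and $$\|e^{\sqrt{c_0t}\Lambda_1}F(z)\|_{\widetilde L^\infty_T(\dot B^s_{p,1})}\le D\,\|e^{\sqrt{c_0t}\Lambda_1}z\|_{\widetilde L^\infty_T(\dot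 B^s_{p,1})}$$ (which is no restriction if the right-hand side is infinite). (ii) Without assuming $F(0)=0$: there are constants $R_0$, and $D$ for every such $s$, with the same dependence, such that for all $c_0>0$, all $0<T\le\infty$ and all real-valued $z_1,z_2$ on $(0,T)\times\mathbb R^d$: if $e^{\sqrt{c_0t}\Lambda_1}z_1$ and $e^{\sqrt{c_0t}\Lambda_1}z_2$ exist and $$\max_{i=1,2}\|e^{\sqrt{c_0t}\Lambda_1}z_i\|_{\widetilde L^\infty_T(\dot B^{d/p}_{p,1})}\le R_0,$$ then $e^{\sqrt{c_0t}\Lambda_1}\bigl(F(z_2)-F(z_1)\bigr)$ exists and $$\|e^{\sqrt{c_0t}\Lambda_1}\bigl(F(z_2)-F(z_1)\bigr)\|_{\widetilde L^\infty_T(\dot B^s_{p,1})}\le D\,\|e^{\sqrt{c_0t}\Lambda_1}(z_2-z_1)\|_{\widetilde L^\infty_T(\dot B^s_{p,1})}.$$ -/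

import Mathlib

open MeasureTheory Filter Topology
open scoped SchwartzMap FourierTransform ENNReal ContDiff

noncomputable section

namespace GevreyBesov

/-- The Euclidean space `ℝ^d`. -/
abbrev Space (d : ℕ) := EuclideanSpace ℝ (Fin d)

/-- A Littlewood-Paley cut-off: a smooth radial function supported in the ball of radius `4/3` and
equal to `1` on the ball of radius `3/4`. -/
structure IsCutoff {d : ℕ} (χ : Space d → ℝ) : Prop where
  smooth : ContDiff ℝ ∞ χ
  radial : ∀ ξ η : Space d, ‖ξ‖ = ‖η‖ → χ ξ = χ η
  support_subset : tsupport χ ⊆ Metric.closedBall 0 (4 / 3)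
  eq_one : ∀ ξ ∈ Metric.closedBall (0 : Space d) (3 / 4), χ ξ = 1

/-- `φ(ξ) = χ(ξ/2) - χ(ξ)`. -/
def annulus {d : ℕ} (χ : Space d → ℝ) (ξ : Space d) : ℝ :=
  χ ((1 / 2 : ℝ) • ξ) - χ ξ

/-- The Fourier multiplier `m(D)` on tempered distributions, for a smooth symbol `m` of temperate
growth. The symbol is a function of the angular frequency (`𝓕 f(ξ) = ∫ e^{-i x·ξ} f(x) dx`), while
Mathlib's Fourier transform is `∫ e^{-2π i x·ξ} f(x) dx`, hence the factor `2π`. -/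
def multiplier {d : ℕ} (m : Space d → ℝ) : 𝓢'(Space d, ℂ) →L[ℂ] 𝓢'(Space d, ℂ) :=
  TemperedDistribution.fourierMultiplierCLM ℂ
    (fun ξ : Space d => ((m ((2 * Real.pi) • ξ) : ℝ) : ℂ))

/-- The low frequency cut-off `Ṡ_j = χ(2^{-j} D)`. -/
def lowFreq {d : ℕ} (χ : Space d → ℝ) (j : ℤ) : 𝓢'(Space d, ℂ) →L[ℂ] 𝓢'(Space d, ℂ) :=
  multiplier (fun ξ => χ ((2 : ℝ) ^ (-j) • ξ))

/-- The dyadic block `Δ̇_j = φ(2^{-j} D)`. -/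
def block {d : ℕ} (χ : Space d → ℝ) (j : ℤ) : 𝓢'(Space d, ℂ) →L[ℂ] 𝓢'(Space d, ℂ) :=
  multiplier (fun ξ => annulus χ ((2 : ℝ) ^ (-j) • ξ))

/-- The tempered distribution `u` is (integration against) the function `f`. -/
def Represents {d : ℕ} (f : Space d → ℂ) (u : 𝓢'(Space d, ℂ)) : Prop :=
  ∀ ψ : 𝓢(Space d, ℂ), Integrable (fun x => ψ x * f x) ∧ u ψ = ∫ x, ψ x * f x

/-- The `L^p(ℝ^d)` norm of a tempered distribution: the `L^p` norm of the function, unique almost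
everywhere, that represents it, and `∞` if it is not represented by a function. -/
def lpNorm {d : ℕ} (p : ℝ≥0∞) (u : 𝓢'(Space d, ℂ)) : ℝ≥0∞ :=
  ⨅ (f : Space d → ℂ) (_ : Represents f u), eLpNorm f p volume

/-- The space `𝓢'_h` of the tempered distributions `u` such that `‖Ṡ_j u‖_{L^∞} → 0` as
`j → -∞`. -/
def HomogeneousDist {d : ℕ} (χ : Space d → ℝ) (u : 𝓢'(Space d, ℂ)) : Prop :=
  Tendsto (fun j : ℤ => lpNorm ∞ (lowFreq χ j u)) atBot (𝓝 0)

/-- The interval `(0, T)`, where `T = ∞` is allowed. -/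
def timeInterval (T : ℝ≥0∞) : Set ℝ := {t : ℝ | 0 < t ∧ ENNReal.ofReal t < T}

/-- The Chemin-Lerner norm
`‖Z‖_{L̃^∞_T(Ḃ^s_{p,1})} = ∑_j 2^{js} ‖Δ̇_j Z‖_{L^∞(0,T; L^p)}`. -/
def cheminLernerNorm {d : ℕ} (χ : Space d → ℝ) (T : ℝ≥0∞) (p s : ℝ)
    (Z : ℝ → 𝓢'(Space d, ℂ)) : ℝ≥0∞ :=
  ∑' j : ℤ, (2 : ℝ≥0∞) ^ ((j : ℝ) * s) *
    essSup (fun t => lpNorm (ENNReal.ofReal p) (block χ j (Z t)))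
      (volume.restrict (timeInterval T))

/-- The kernel `h_a = 𝓕⁻¹(e^{-a|·|₁})` of `e^{-aΛ₁}`, for `a > 0`, that is
`h_a(x) = (2π)^{-d} ∫ e^{i x·ξ} e^{-a|ξ|₁} dξ`, where `|ξ|₁ = ∑ |ξ_i|`. The factor `2π` accounts for
Mathlib's normalization as in `multiplier`. -/
def kernel {d : ℕ} (a : ℝ) : Space d → ℂ :=
  𝓕⁻ (fun ξ : Space d => ((Real.exp (-(a * ∑ i, |2 * Real.pi * ξ i|)) : ℝ) : ℂ))

/-- `e^{-aΛ₁} f = h_a ⋆ f`, for `a > 0` and `f ∈ L^q(ℝ^d)`. -/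
def expNeg {d : ℕ} (a : ℝ) (f : Space d → ℂ) (x : Space d) : ℂ :=
  ∫ y, kernel a (x - y) * f y

/-- For `a > 0` and `u, U ∈ 𝓢'_h`: `U = e^{aΛ₁} u`, that is `u = e^{-aΛ₁} U`. Since the symbol
`e^{-a|ξ|₁}` is not smooth, this is expressed on the dyadic blocks, which determine an element of
`𝓢'_h`: each block of `U` is a function `f` in some Lebesgue space (as for every element of a
homogeneous Besov space), and the block of `u` is `h_a ⋆ f`. For given `u` there is at most one
such `U`. -/
structure IsExp {d : ℕ} (χ : Space d → ℝ) (a : ℝ) (u U : 𝓢'(Space d, ℂ)) : Prop where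
  source : HomogeneousDist χ u
  target : HomogeneousDist χ U
  blocks : ∀ j : ℤ, ∃ (f : Space d → ℂ) (q : ℝ≥0∞), 1 ≤ q ∧ MemLp f q volume ∧
    Represents f (block χ j U) ∧ Represents (expNeg a f) (block χ j u)

/-- `Z(t) = e^{√(c₀ t) Λ₁} z(t)` for almost every `t ∈ (0, T)`, where `z(t)` is a real function on
`ℝ^d`, `Z(t)` is a tempered distribution, and `Z` is measurable in time. -/
structure IsGevrey {d : ℕ} (χ : Space d → ℝ) (c₀ : ℝ) (T : ℝ≥0∞) (z : ℝ → Space d → ℝ)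
    (Z : ℝ → 𝓢'(Space d, ℂ)) : Prop where
  measurable : ∀ ψ : 𝓢(Space d, ℂ),
    AEStronglyMeasurable (fun t => Z t ψ) (volume.restrict (timeInterval T))
  isExp : ∀ᵐ t ∂(volume.restrict (timeInterval T)), ∃ u : 𝓢'(Space d, ℂ),
    Represents (fun x => (z t x : ℂ)) u ∧ IsExp χ (Real.sqrt (c₀ * t)) u (Z t)

end GevreyBesov

end

open MeasureTheory Filter Topology
open scoped SchwartzMap FourierTransform ENNReal ContDiff

noncomputable section

namespace GevreyBesov

/-! ### Convolution and Young's inequality. -/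

section Convolution

variable {E : Type*} [NormedAddCommGroup E] [InnerProductSpace ℝ E] [FiniteDimensional ℝ E]
  [MeasurableSpace E] [BorelSpace E]

/-! Everything rests on one fact: the map (U, V) ↦ e^{aΛ₁}(e^{-aΛ₁}U · e^{-aΛ₁}V) obeys the same
Besov estimates as the plain product, with constants independent of a. On the orthant of frequencies
with signs ε the weight e^{a|ξ|₁} equals e^{a ε·ξ}, which is a character. The multiplier with that
symbol is a translation by an imaginary vector, so it distributes over products (`growth_add`,
`cv_shiftSym`). With P_ε the projection on the orthant and T_ε the multiplier e^{a(ε·ξ − |ξ|₁)}, the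
map is Σ_ε P_ε(T_ε U · T_ε V). Its frequency localized form is `piece`, justified by
`cv_kernel_piece`.

In each variable P_ε and T_ε are built from the sign function and a decaying exponential
(`exists_isMult_proj`, `exists_isMult_shift`). They are bounded on L^p, 1 < p < ∞, uniformly in a,
by M. Riesz' theorem (`exists_eLpNorm_hilbertKernel_le`) and because Poisson kernels have mass one.
Riesz' theorem comes from a contour argument for p ≤ 2: the p-th power of the Cauchy integral of a
nonnegative function integrates to zero along horizontal lines, and a pointwise inequality then
bounds the imaginary part by the real part. Duality gives p > 2.

Product law. Let the factors live at frequencies 2^j, 2^k and the output at 2^i. If j and k are far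
apart, the lower frequency factor is put in L^∞ by Bernstein's inequality. If they are comparable,
the product is put in L^m with 1/m = 1/p + 1/r, r = max(p, p'), and Young's inequality returns to
L^p with a factor 2^{i d/r} (`exists_eLpNorm_piece_le`). As d/r = min(d/p, d/p'), the sum over i of
the comparable case converges for s > −min(d/p, d/p'), while s ≤ d/p absorbs a second factor of
higher frequency (`exists_tsum_weight_le`). So the s-norm of a product is bounded by the s-norm of
one factor times the critical norm (s = d/p) of the other (`exists_besovSum_paraprod_le`).

Composition. Write F(z₂) − F(z₁) = (z₂ − z₁)(b₁ + G), where G is a double series of monomials in z₁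
and z₂. For small critical norms this series converges in the critical space, and the product law,
with z₂ − z₁ as the factor measured in the s-norm, gives the estimate (`exists_isTimeDecomp_comp`).
The radius depends on critical constants only, hence not on s. Part (i) is the case z₁ = 0 of part
(ii).

The bookkeeping uses decompositions z = Σ_j e^{-aΛ₁}U_j into localized pieces (`IsDecomp`) that need
not be the dyadic blocks of anything, which makes them stable under sums and products. A
distribution in the domain of e^{aΛ₁} with finite critical norm yields one through its blocks
(`IsExp.isDecomp`). Conversely a decomposition defines such a distribution, its blocks involving
only a bounded window of indices (`exists_isExp_of_isDecomp`). The majorants c_j do not depend on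
time, so the supremum in time inside the sum over j costs nothing; joint measurability in (t, x) is
carried along to make the result measurable in time. -/

/-- The convolution `k ⋆ f`. -/
def cv (k f : E → ℂ) (x : E) : ℂ := ∫ y, k (x - y) * f y

theorem aestronglyMeasurable_sub_prod {k : E → ℂ} (hk : AEStronglyMeasurable k volume) :
    AEStronglyMeasurable (fun z : E × E => k (z.1 - z.2)) (volume.prod volume) :=
  hk.comp_quasiMeasurePreserving (quasiMeasurePreserving_sub_of_right_invariant volume volume)

theorem aestronglyMeasurable_sub_left {k : E → ℂ} (hk : AEStronglyMeasurable k volume) (x : E) :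
    AEStronglyMeasurable (fun y : E => k (x - y)) volume :=
  hk.comp_measurePreserving (Measure.measurePreserving_sub_left volume x)

theorem eLpNorm_sub_left {k : E → ℂ} (hk : AEStronglyMeasurable k volume) (x : E) (p : ℝ≥0∞) :
    eLpNorm (fun y : E => k (x - y)) p volume = eLpNorm k p volume :=
  eLpNorm_comp_measurePreserving hk (Measure.measurePreserving_sub_left volume x)

theorem aestronglyMeasurable_cv {k f : E → ℂ} (hk : AEStronglyMeasurable k volume)
    (hf : AEStronglyMeasurable f volume) : AEStronglyMeasurable (cv k f) volume :=
  AEStronglyMeasurable.integral_prod_right' (f := fun z : E × E => k (z.1 - z.2) * f z.2)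
    ((aestronglyMeasurable_sub_prod hk).mul hf.comp_snd)

/-- Hölder for the factors K^q F^m, K^q, F^m with exponents 1/p, 1/q − 1/p, 1/m − 1/p, which add up
to 1 by `h`. In a convolution the last two integrals do not depend on the point, so only the first
remains to be integrated by Tonelli: this is Young's inequality. -/
theorem lintegral_mul_le_three {α : Type*} [MeasurableSpace α] {μ : Measure α}
    {K F : α → ℝ≥0∞} (hK : AEMeasurable K μ) (hF : AEMeasurable F μ) {p q m : ℝ} (hq : 0 < q)
    (hm : 0 < m) (hp : 0 < p) (hqp : q ≤ p) (hmp : m ≤ p) (h : 1 / q + 1 / m = 1 + 1 / p) :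
    ∫⁻ y, K y * F y ∂μ ≤ (∫⁻ y, K y ^ q * F y ^ m ∂μ) ^ (1 / p) *
      (∫⁻ y, K y ^ q ∂μ) ^ (1 / q - 1 / p) * (∫⁻ y, F y ^ m ∂μ) ^ (1 / m - 1 / p) := by
  have h1 : 0 ≤ 1 / q - 1 / p := sub_nonneg.2 (one_div_le_one_div_of_le hq hqp)
  have h2 : 0 ≤ 1 / m - 1 / p := sub_nonneg.2 (one_div_le_one_div_of_le hm hmp)
  have h3 : 0 ≤ 1 / p := by positivity
  have := ENNReal.lintegral_prod_norm_pow_le (μ := μ) (Finset.univ : Finset (Fin 3))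
    (f := ![fun y => K y ^ q * F y ^ m, fun y => K y ^ q, fun y => F y ^ m])
    (by
      intro i _
      fin_cases i
      · exact (hK.pow_const q).mul (hF.pow_const m)
      · exact hK.pow_const q
      · exact hF.pow_const m)
    (p := ![1 / p, 1 / q - 1 / p, 1 / m - 1 / p])
    (by simp only [Fin.sum_univ_three]; simp; simp at h; linarith)
    (by
      intro i _
      fin_cases i
      · exact h3
      · exact h1
      · exact h2)
  simp only [Fin.prod_univ_three] at this
  refine le_trans (le_of_eq (lintegral_congr fun y => ?_)) this
  simp only [Matrix.cons_val_zero, Matrix.cons_val_one, Matrix.cons_val]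
  rw [ENNReal.mul_rpow_of_nonneg _ _ h3, ← ENNReal.rpow_mul, ← ENNReal.rpow_mul,
    ← ENNReal.rpow_mul, ← ENNReal.rpow_mul]
  have e1 : K y ^ (q * (1 / p)) * K y ^ (q * (1 / q - 1 / p)) = K y := by
    rw [← ENNReal.rpow_add_of_nonneg _ _ (by positivity) (by positivity)]
    rw [← mul_add, add_sub_cancel, mul_one_div_cancel hq.ne', ENNReal.rpow_one]
  have e2 : F y ^ (m * (1 / p)) * F y ^ (m * (1 / m - 1 / p)) = F y := by
    rw [← ENNReal.rpow_add_of_nonneg _ _ (by positivity) (by positivity)]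
    rw [← mul_add, add_sub_cancel, mul_one_div_cancel hm.ne', ENNReal.rpow_one]
  calc K y * F y = (K y ^ (q * (1 / p)) * K y ^ (q * (1 / q - 1 / p))) *
      (F y ^ (m * (1 / p)) * F y ^ (m * (1 / m - 1 / p))) := by rw [e1, e2]
    _ = _ := by ring

theorem eLpNorm_ofReal {α : Type*} [MeasurableSpace α] {μ : Measure α} {p : ℝ} (hp : 0 < p)
    (f : α → ℂ) : eLpNorm f (ENNReal.ofReal p) μ = (∫⁻ x, ‖f x‖ₑ ^ p ∂μ) ^ (1 / p) := by
  rw [eLpNorm_eq_lintegral_rpow_enorm_toReal (by simpa using hp) ENNReal.ofReal_ne_top,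
    ENNReal.toReal_ofReal hp.le]

theorem enorm_cv_le_lintegral (k f : E → ℂ) (x : E) :
    ‖cv k f x‖ₑ ≤ ∫⁻ y, ‖k (x - y)‖ₑ * ‖f y‖ₑ := by
  refine (enorm_integral_le_lintegral_enorm _).trans (le_of_eq ?_)
  simp

/-- **Young's convolution inequality** for finite exponents. -/
theorem eLpNorm_cv_le_young {k f : E → ℂ} (hk : AEStronglyMeasurable k volume)
    (hf : AEStronglyMeasurable f volume) {p q m : ℝ} (hq : 1 ≤ q)
    (hm : 1 ≤ m) (hp : 0 < p) (h : 1 / q + 1 / m = 1 + 1 / p) :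
    eLpNorm (cv k f) (ENNReal.ofReal p) volume ≤
      eLpNorm k (ENNReal.ofReal q) volume * eLpNorm f (ENNReal.ofReal m) volume := by
  have hq0 : 0 < q := by linarith
  have hm0 : 0 < m := by linarith
  have hqp : q ≤ p := by
    have : 1 / m ≤ 1 := by rw [div_le_one hm0]; exact hm
    exact le_of_one_div_le_one_div hp (by linarith)
  have hmp : m ≤ p := by
    have : 1 / q ≤ 1 := by rw [div_le_one hq0]; exact hq
    exact le_of_one_div_le_one_div hp (by linarith)
  rw [eLpNorm_ofReal hp, eLpNorm_ofReal hq0, eLpNorm_ofReal hm0]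
  set A := ∫⁻ x, ‖k x‖ₑ ^ q with hA
  set B := ∫⁻ x, ‖f x‖ₑ ^ m with hB
  have key : ∀ x, ‖cv k f x‖ₑ ^ p ≤ (∫⁻ y, ‖k (x - y)‖ₑ ^ q * ‖f y‖ₑ ^ m) *
      (A ^ (p / q - 1) * B ^ (p / m - 1)) := by
    intro x
    have h1 := (enorm_cv_le_lintegral k f x).trans
      (lintegral_mul_le_three (aestronglyMeasurable_sub_left hk x).enorm hf.enorm hq0 hm0 hp hqp
        hmp h)
    have h2 : ∫⁻ y, ‖k (x - y)‖ₑ ^ q = A :=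
      lintegral_sub_left_eq_self (fun y => ‖k y‖ₑ ^ q) x
    rw [h2] at h1
    refine (ENNReal.rpow_le_rpow h1 hp.le).trans (le_of_eq ?_)
    rw [ENNReal.mul_rpow_of_nonneg _ _ hp.le, ENNReal.mul_rpow_of_nonneg _ _ hp.le,
      ← ENNReal.rpow_mul, ← ENNReal.rpow_mul, ← ENNReal.rpow_mul, one_div_mul_cancel hp.ne',
      ENNReal.rpow_one, mul_assoc]
    congr 3 <;> field_simp
  have tonelli : ∫⁻ x, ∫⁻ y, ‖k (x - y)‖ₑ ^ q * ‖f y‖ₑ ^ m = A * B := by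
    rw [lintegral_lintegral_swap]
    · have : ∀ y, ∫⁻ x, ‖k (x - y)‖ₑ ^ q * ‖f y‖ₑ ^ m = A * ‖f y‖ₑ ^ m := by
        intro y
        have hm : AEMeasurable (fun x => ‖k (x - y)‖ₑ ^ q) volume :=
          ((hk.comp_measurePreserving (measurePreserving_sub_right volume y)).enorm).pow_const q
        rw [lintegral_mul_const'' _ hm]
        rw [lintegral_sub_right_eq_self (fun x => ‖k x‖ₑ ^ q) y]
      simp_rw [this]
      rw [lintegral_const_mul'' _ (hf.enorm.pow_const m)]
    · exact ((aestronglyMeasurable_sub_prod hk).enorm.pow_const q).mul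
        ((hf.comp_snd).enorm.pow_const m)
  have e1 : A ^ (1 / q) = A ^ (1 / p) * A ^ ((p / q - 1) * (1 / p)) := by
    rw [← ENNReal.rpow_add_of_nonneg _ _ (by positivity)
      (mul_nonneg (sub_nonneg.2 ((one_le_div hq0).2 hqp)) (by positivity))]
    congr 1; field_simp; ring
  have e2 : B ^ (1 / m) = B ^ (1 / p) * B ^ ((p / m - 1) * (1 / p)) := by
    rw [← ENNReal.rpow_add_of_nonneg _ _ (by positivity)
      (mul_nonneg (sub_nonneg.2 ((one_le_div hm0).2 hmp)) (by positivity))]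
    congr 1; field_simp; ring
  calc (∫⁻ x, ‖cv k f x‖ₑ ^ p) ^ (1 / p)
      ≤ (∫⁻ x, (∫⁻ y, ‖k (x - y)‖ₑ ^ q * ‖f y‖ₑ ^ m) *
          (A ^ (p / q - 1) * B ^ (p / m - 1))) ^ (1 / p) :=
        ENNReal.rpow_le_rpow (lintegral_mono key) (by positivity)
    _ = (A * B * (A ^ (p / q - 1) * B ^ (p / m - 1))) ^ (1 / p) := by
        rw [lintegral_mul_const'', tonelli]
        exact AEMeasurable.lintegral_prod_right
          (((aestronglyMeasurable_sub_prod hk).enorm.pow_const q).mul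
          ((hf.comp_snd).enorm.pow_const m))
    _ = A ^ (1 / q) * B ^ (1 / m) := by
        have h3 : 0 ≤ 1 / p := by positivity
        rw [ENNReal.mul_rpow_of_nonneg _ _ h3, ENNReal.mul_rpow_of_nonneg _ _ h3,
          ENNReal.mul_rpow_of_nonneg _ _ h3, ← ENNReal.rpow_mul, ← ENNReal.rpow_mul, e1, e2]
        ring

theorem eLpNorm_cv_le_one {k f : E → ℂ} (hk : AEStronglyMeasurable k volume)
    (hf : AEStronglyMeasurable f volume) {p : ℝ} (hp : 1 ≤ p) :
    eLpNorm (cv k f) (ENNReal.ofReal p) volume ≤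
      eLpNorm k 1 volume * eLpNorm f (ENNReal.ofReal p) volume := by
  have := eLpNorm_cv_le_young hk hf (p := p) (q := 1) (m := p) le_rfl hp (by linarith) (by norm_num)
  simpa using this

theorem memLp_cv_one {k f : E → ℂ} (hk : MemLp k 1 volume) {p : ℝ} (hp : 1 ≤ p)
    (hf : MemLp f (ENNReal.ofReal p) volume) : MemLp (cv k f) (ENNReal.ofReal p) volume :=
  ⟨aestronglyMeasurable_cv hk.1 hf.1, (eLpNorm_cv_le_one hk.1 hf.1 hp).trans_lt
    (ENNReal.mul_lt_top hk.2 hf.2)⟩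

theorem enorm_cv_le {k f : E → ℂ} (hk : AEStronglyMeasurable k volume)
    (hf : AEStronglyMeasurable f volume) (p q : ℝ≥0∞) [hpq : ENNReal.HolderConjugate q p] (x : E) :
    ‖cv k f x‖ₑ ≤ eLpNorm k q volume * eLpNorm f p volume := by
  refine (enorm_cv_le_lintegral k f x).trans ?_
  have h := eLpNorm_smul_le_mul_eLpNorm (p := q) (q := p) (r := 1) hf
    (aestronglyMeasurable_sub_left hk x)
  rw [eLpNorm_sub_left hk, eLpNorm_one_eq_lintegral_enorm] at h
  simpa using h

theorem integrable_cv {k f : E → ℂ} {p q : ℝ≥0∞} [hpq : ENNReal.HolderConjugate q p]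
    (hk : MemLp k q volume) (hf : MemLp f p volume) (x : E) :
    Integrable (fun y => k (x - y) * f y) :=
  MemLp.integrable_mul (p := q) (q := p)
    (hk.comp_measurePreserving (Measure.measurePreserving_sub_left volume x)) hf

theorem cv_sub_right {k f g : E → ℂ} {p q : ℝ≥0∞} [hpq : ENNReal.HolderConjugate q p]
    (hk : MemLp k q volume) (hf : MemLp f p volume) (hg : MemLp g p volume) (x : E) :
    cv k (f - g) x = cv k f x - cv k g x := by
  unfold cv
  rw [← integral_sub (integrable_cv hk hf x) (integrable_cv hk hg x)]
  simp [mul_sub]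

theorem cv_congr_ae {k f g : E → ℂ} (h : f =ᵐ[volume] g) : cv k f = cv k g := by
  funext x
  refine integral_congr_ae ?_
  filter_upwards [h] with y hy
  rw [hy]

theorem continuous_fourierInv {g : E → ℂ} (hg : Integrable g) : Continuous (𝓕⁻ g) := by
  have : 𝓕⁻ g = fun x => 𝓕 g (-x) := by
    funext x; rw [Real.fourierInv_eq_fourier_neg]
  rw [this]
  exact (VectorFourier.fourierIntegral_continuous Real.continuous_fourierChar
    continuous_inner hg).comp continuous_neg

theorem integrable_smul_char_prod {f g : E → ℂ} (hf : Integrable f) (hg : Integrable g) (x : E) :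
    Integrable (fun z : E × E => Complex.exp (↑(2 * Real.pi * inner ℝ z.2 (x - z.1)) * Complex.I)
      * (f z.1 * g z.2)) (volume.prod volume) := by
  refine Integrable.bdd_mul (c := 1) (hf.mul_prod hg) (Continuous.aestronglyMeasurable
    (by fun_prop)) ?_
  filter_upwards with z
  rw [Complex.norm_exp_ofReal_mul_I]

theorem fourierChar_exp_sub {V : Type*} [NormedAddCommGroup V] [InnerProductSpace ℝ V]
    (x y v : V) :
    Complex.exp (↑(2 * Real.pi * inner ℝ v (x - y)) * Complex.I) =
      Complex.exp (↑(2 * Real.pi * inner ℝ v x) * Complex.I) *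
      Complex.exp (↑(-2 * Real.pi * inner ℝ y v) * Complex.I) := by
  rw [← Complex.exp_add, ← add_mul, ← Complex.ofReal_add]
  congr 3
  rw [inner_sub_right, real_inner_comm y v]; ring

theorem cv_fourierInv_left {m f : E → ℂ} (hm : Integrable m) (hf : Integrable f) :
    cv (𝓕⁻ m) f = 𝓕⁻ (fun ξ => m ξ * 𝓕 f ξ) := by
  funext x
  have hint := integrable_smul_char_prod hf hm x
  have h1 : cv (𝓕⁻ m) f x = ∫ y, ∫ v, Complex.exp (↑(2 * Real.pi * inner ℝ v (x - y)) * Complex.I)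
      * (f y * m v) := by
    unfold cv
    refine integral_congr_ae (Eventually.of_forall fun y => ?_)
    simp only
    rw [Real.fourierInv_eq', ← integral_mul_const]
    refine integral_congr_ae (Eventually.of_forall fun v => ?_)
    simp only [smul_eq_mul]; ring
  rw [h1, integral_integral_swap hint, Real.fourierInv_eq']
  refine integral_congr_ae (Eventually.of_forall fun v => ?_)
  simp only [smul_eq_mul]
  rw [Real.fourier_eq', ← integral_const_mul, ← integral_const_mul]
  refine integral_congr_ae (Eventually.of_forall fun y => ?_)
  simp only [smul_eq_mul]
  rw [fourierChar_exp_sub]; ring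

theorem cv_fourierInv_right {k g : E → ℂ} (hk : Integrable k) (hg : Integrable g) :
    cv k (𝓕⁻ g) = 𝓕⁻ (fun ξ => 𝓕 k ξ * g ξ) := by
  have h : cv k (𝓕⁻ g) = cv (𝓕⁻ g) k := by
    funext x
    unfold cv
    rw [← integral_sub_left_eq_self _ volume x]
    refine integral_congr_ae (Eventually.of_forall fun v => ?_)
    simp only [sub_sub_cancel]; ring
  rw [h, cv_fourierInv_left hg hk]
  simp_rw [mul_comm]

end Convolution

/-! ### Conjugate Poisson integrals on L^p for 1 < p ≤ 2, by contour integration. -/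

section HilbertTransform

/-- By homogeneity and |Im z| ≤ |z| it suffices that 1 ≤ A cos^p θ − B cos(pθ) for |θ| < π/2. Near
the imaginary axis pθ lies beyond π/2 but not beyond π, since p ≤ 2, so the term in B suffices;
elsewhere cos θ is bounded below. The term Re z^p is harmless because it will integrate to zero. -/
theorem exists_abs_im_rpow_le {p : ℝ} (hp : 1 < p) (hp2 : p ≤ 2) :
    ∃ A B : ℝ, 0 ≤ A ∧ 0 ≤ B ∧ ∀ z : ℂ, 0 < z.re →
      |z.im| ^ p ≤ A * z.re ^ p - B * (z ^ (p : ℂ)).re := by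
  have hπ := Real.pi_pos
  -- An angle strictly between π/(2p) and π/2: pθ₀ exceeds π/2 by π(p − 1)/4.
  set θ₀ := Real.pi * (p + 1) / (4 * p) with hθ₀
  have hθlt : θ₀ < Real.pi / 2 := by
    rw [hθ₀, div_lt_div_iff₀ (by linarith) (by norm_num)]; nlinarith
  have hθpos : 0 < θ₀ := by positivity
  have hpθ : p * θ₀ = Real.pi * (p + 1) / 4 := by rw [hθ₀]; field_simp
  have hc1 : Real.cos (p * θ₀) < 0 := by
    apply Real.cos_neg_of_pi_div_two_lt_of_lt <;> rw [hpθ] <;> nlinarith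
  have hc0 : 0 < Real.cos θ₀ := Real.cos_pos_of_mem_Ioo ⟨by linarith, hθlt⟩
  set B := (-Real.cos (p * θ₀))⁻¹ with hB
  have hBpos : 0 < B := inv_pos.2 (by linarith)
  set A := (1 + B) / Real.cos θ₀ ^ p with hA
  have hApos : 0 < A := by positivity
  have trig : ∀ θ : ℝ, |θ| < Real.pi / 2 → 1 ≤ A * Real.cos θ ^ p - B * Real.cos (p * θ) := by
    intro θ hθ
    rw [← Real.cos_abs θ, ← Real.cos_abs (p * θ), abs_mul, abs_of_pos (by linarith : 0 < p)]
    set t := |θ|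
    have ht : 0 ≤ t := abs_nonneg θ
    have hct : 0 < Real.cos t := Real.cos_pos_of_mem_Ioo ⟨by linarith, hθ⟩
    rcases le_total t θ₀ with h | h
    · have h1 : Real.cos θ₀ ^ p ≤ Real.cos t ^ p :=
        Real.rpow_le_rpow hc0.le (Real.cos_le_cos_of_nonneg_of_le_pi ht (by linarith) h)
          (by linarith)
      have h2 : 1 + B ≤ A * Real.cos t ^ p := by
        rw [hA, div_mul_eq_mul_div, le_div_iff₀ (by positivity)]
        exact mul_le_mul_of_nonneg_left h1 (by positivity)
      have h3 : B * Real.cos (p * t) ≤ B * 1 :=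
        mul_le_mul_of_nonneg_left (Real.cos_le_one _) hBpos.le
      linarith
    · have h1 : Real.cos (p * t) ≤ Real.cos (p * θ₀) :=
        Real.cos_le_cos_of_nonneg_of_le_pi (by positivity) (by nlinarith)
          (mul_le_mul_of_nonneg_left h (by linarith))
      have h2 : B * Real.cos (p * t) ≤ B * Real.cos (p * θ₀) :=
        mul_le_mul_of_nonneg_left h1 hBpos.le
      have h3 : B * Real.cos (p * θ₀) = -1 := by
        rw [hB, inv_neg, neg_mul, inv_mul_cancel₀ hc1.ne]
      have h4 : 0 ≤ A * Real.cos t ^ p := by positivity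
      linarith
  refine ⟨A, B, hApos.le, hBpos.le, fun z hz => ?_⟩
  have h1 : |z.im| ^ p ≤ ‖z‖ ^ p :=
    Real.rpow_le_rpow (abs_nonneg _) (Complex.abs_im_le_norm z) (by linarith)
  have harg : |z.arg| < Real.pi / 2 := Complex.abs_arg_lt_pi_div_two_iff.2 (Or.inl hz)
  have h2 := trig z.arg harg
  rw [Complex.cpow_ofReal_re]
  have hcos : 0 < Real.cos z.arg := Real.cos_pos_of_mem_Ioo (abs_lt.1 harg)
  have h3 : z.re ^ p = ‖z‖ ^ p * Real.cos z.arg ^ p := by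
    rw [← Complex.norm_mul_cos_arg, Real.mul_rpow (norm_nonneg _) hcos.le]
  have h4 : 0 ≤ ‖z‖ ^ p := by positivity
  rw [h3, mul_comm z.arg p]
  nlinarith

/-- The Cauchy integral of `f`, analytic in the upper half plane; its real part is the Poisson
integral of `f` and its imaginary part the conjugate Poisson integral. -/
def cauchyInt (f : ℝ → ℝ) (z : ℂ) : ℂ := ∫ t : ℝ, (Complex.I / Real.pi) * ((f t : ℂ) / (z - t))

/-- The Poisson kernel of the upper half plane. -/
def poisson (y s : ℝ) : ℝ := (1 / Real.pi) * (y / (s ^ 2 + y ^ 2))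

/-- The conjugate Poisson kernel of the upper half plane. -/
def conjPoisson (y s : ℝ) : ℝ := (1 / Real.pi) * (s / (s ^ 2 + y ^ 2))

theorem sub_ofReal_ne_zero {z : ℂ} (hz : 0 < z.im) (t : ℝ) : z - t ≠ 0 := by
  intro h
  have := congrArg Complex.im h
  simp at this
  linarith

theorem im_le_norm_sub {z : ℂ} (t : ℝ) : z.im ≤ ‖z - t‖ := by
  have := Complex.abs_im_le_norm (z - t)
  simp at this
  exact (le_abs_self _).trans this

theorem integrable_cauchyInt {f : ℝ → ℝ} (hf : Integrable f) {z : ℂ} (hz : 0 < z.im) :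
    Integrable (fun t : ℝ => (Complex.I / Real.pi) * ((f t : ℂ) / (z - t))) := by
  refine Integrable.const_mul ?_ _
  simp_rw [div_eq_mul_inv]
  refine Integrable.mul_bdd (c := z.im⁻¹) hf.ofReal ?_ ?_
  · exact ((measurable_const.sub Complex.measurable_ofReal).inv).aestronglyMeasurable
  · filter_upwards with t
    rw [norm_inv]
    exact inv_anti₀ hz (im_le_norm_sub t)

theorem differentiableAt_cauchyInt {f : ℝ → ℝ} (hf : Integrable f) {z : ℂ} (hz : 0 < z.im) :
    DifferentiableAt ℂ (cauchyInt f) z := by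
  have hs : {w : ℂ | z.im / 2 < w.im} ∈ 𝓝 z :=
    (isOpen_lt continuous_const Complex.continuous_im).mem_nhds (by simp; linarith)
  have hm : ∀ w : ℂ, Measurable fun t : ℝ => w - (t : ℂ) := fun w =>
    measurable_const.sub Complex.measurable_ofReal
  have := hasDerivAt_integral_of_dominated_loc_of_deriv_le (μ := volume) (𝕜 := ℂ)
    (F := fun (w : ℂ) (t : ℝ) => (Complex.I / Real.pi) * ((f t : ℂ) / (w - t)))
    (F' := fun (w : ℂ) (t : ℝ) => (Complex.I / Real.pi) * (-(f t : ℂ) / (w - t) ^ 2))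
    (bound := fun t => (1 / Real.pi) * (|f t| * ((z.im / 2) ^ 2)⁻¹))
    (x₀ := z) hs ?_ (integrable_cauchyInt hf hz) ?_ ?_ ?_ ?_
  · exact this.2.differentiableAt
  · filter_upwards [hs] with w hw
    have hw : z.im / 2 < w.im := hw
    exact (integrable_cauchyInt hf (by linarith)).1
  · simp_rw [div_eq_mul_inv]
    exact (hf.ofReal.1.neg.mul ((hm z).pow_const 2).inv.aestronglyMeasurable).const_mul _
  · filter_upwards with t w hw
    have hw : z.im / 2 < w.im := hw
    have h1 : z.im / 2 ≤ ‖w - t‖ := hw.le.trans (im_le_norm_sub t)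
    rw [norm_mul, norm_div, norm_div, norm_neg, Complex.norm_I, Complex.norm_real,
      Complex.norm_real, norm_pow, Real.norm_of_nonneg Real.pi_pos.le, Real.norm_eq_abs,
      div_eq_mul_inv |f t|]
    gcongr
  · exact (hf.abs.mul_const _).const_mul _
  · filter_upwards with t w hw
    have hw : z.im / 2 < w.im := hw
    have hw0 : w - t ≠ 0 := sub_ofReal_ne_zero (by linarith) t
    have := ((hasDerivAt_const w (f t : ℂ)).div ((hasDerivAt_id w).sub_const (t : ℂ)) hw0).const_mul
      (Complex.I / Real.pi)
    have e : (0 * (id w - (t : ℂ)) - (f t : ℂ) * 1) / (id w - t) ^ 2 = -(f t : ℂ) / (w - t) ^ 2 := by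
      simp
    rw [e] at this
    exact this

/-- On the support of f one has |z − t| ≥ |z|/2. The resulting decay 1/|z|, raised to the power p >
1, beats the length of a contour of size |z|. -/
theorem norm_cauchyInt_le {f : ℝ → ℝ} (hi : Integrable f) {L : ℝ} (hL : ∀ t, L < |t| → f t = 0)
    {z : ℂ} (hz : 2 * L ≤ ‖z‖) (hz0 : 0 < ‖z‖) :
    ‖cauchyInt f z‖ ≤ (2 / Real.pi * ∫ t, |f t|) / ‖z‖ := by
  have h : (2 / Real.pi * ∫ t, |f t|) / ‖z‖ = ∫ t, (2 / Real.pi / ‖z‖) * |f t| := by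
    rw [integral_const_mul]; ring
  rw [h]
  refine norm_integral_le_of_norm_le (hi.abs.const_mul _) (Eventually.of_forall fun t => ?_)
  rw [norm_mul, norm_div, norm_div, Complex.norm_I, Complex.norm_real,
    Complex.norm_real, Real.norm_of_nonneg Real.pi_pos.le, Real.norm_eq_abs]
  by_cases ht : L < |t|
  · simp [hL t ht]
  · have h1 : ‖z‖ / 2 ≤ ‖z - t‖ := by
      have := norm_sub_norm_le z (t : ℂ)
      rw [Complex.norm_real, Real.norm_eq_abs] at this
      linarith
    have h2 : |f t| / ‖z - t‖ ≤ |f t| / (‖z‖ / 2) := by gcongr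
    calc 1 / Real.pi * (|f t| / ‖z - t‖) ≤ 1 / Real.pi * (|f t| / (‖z‖ / 2)) := by gcongr
      _ = _ := by field_simp

theorem cauchy_kernel_eq (x y t : ℝ) (hy : 0 < y) (c : ℝ) :
    (Complex.I / Real.pi) * ((c : ℂ) / ((x + y * Complex.I : ℂ) - t)) =
      ((poisson y (x - t) * c : ℝ) : ℂ) + ((conjPoisson y (x - t) * c : ℝ) : ℂ) * Complex.I := by
  have h0 : (x + y * Complex.I : ℂ) - t ≠ 0 := sub_ofReal_ne_zero (by simpa using hy) t
  have h1 : (((x - t) ^ 2 + y ^ 2 : ℝ) : ℂ) ≠ 0 := by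
    have : (x - t) ^ 2 + y ^ 2 ≠ 0 := by positivity
    exact_mod_cast this
  have hπ : (Real.pi : ℂ) ≠ 0 := by exact_mod_cast Real.pi_ne_zero
  rw [← mul_div_assoc, div_eq_iff h0]
  unfold poisson conjPoisson
  push_cast at h1 ⊢
  field_simp
  linear_combination (-(c : ℂ) * y * (x - t)) * Complex.I_sq

theorem integrable_poisson_mul {f : ℝ → ℝ} (hf : Integrable f) (x : ℝ) {y : ℝ} (hy : 0 < y) :
    Integrable (fun t => poisson y (x - t) * f t) := by
  have := (integrable_cauchyInt hf (z := x + y * Complex.I) (by simpa using hy)).re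
  refine this.congr (Eventually.of_forall fun t => ?_)
  beta_reduce
  rw [cauchy_kernel_eq x y t hy]
  simp

theorem integrable_conjPoisson_mul {f : ℝ → ℝ} (hf : Integrable f) (x : ℝ) {y : ℝ} (hy : 0 < y) :
    Integrable (fun t => conjPoisson y (x - t) * f t) := by
  have := (integrable_cauchyInt hf (z := x + y * Complex.I) (by simpa using hy)).im
  refine this.congr (Eventually.of_forall fun t => ?_)
  beta_reduce
  rw [cauchy_kernel_eq x y t hy]
  simp

theorem cauchyInt_eq {f : ℝ → ℝ} (hf : Integrable f) (x : ℝ) {y : ℝ} (hy : 0 < y) :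
    cauchyInt f (x + y * Complex.I) = ((∫ t, poisson y (x - t) * f t : ℝ) : ℂ) +
      ((∫ t, conjPoisson y (x - t) * f t : ℝ) : ℂ) * Complex.I := by
  unfold cauchyInt
  simp_rw [cauchy_kernel_eq x y _ hy]
  rw [integral_add (integrable_poisson_mul hf x hy).ofReal
    ((integrable_conjPoisson_mul hf x hy).ofReal.mul_const _), integral_mul_const,
    integral_complex_ofReal, integral_complex_ofReal]

theorem poisson_pos {y : ℝ} (hy : 0 < y) (s : ℝ) : 0 < poisson y s := by
  unfold poisson
  have := Real.pi_pos
  positivity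

/-- The Cauchy integral of a nonnegative function takes values in the right half plane, where the
principal branch of w ↦ w^p is analytic. This is why the argument starts from nonnegative functions.
-/
theorem re_cauchyInt_pos {f : ℝ → ℝ} (hf : Integrable f) (h0 : 0 ≤ f) (hpos : 0 < ∫ t, f t)
    {z : ℂ} (hz : 0 < z.im) : 0 < (cauchyInt f z).re := by
  rw [← Complex.re_add_im z, cauchyInt_eq hf _ hz]
  simp only [Complex.add_re, Complex.ofReal_re, Complex.mul_re, Complex.I_re, mul_zero,
    Complex.ofReal_im, Complex.I_im, mul_one, sub_self, add_zero]
  rw [integral_pos_iff_support_of_nonneg (fun t => mul_nonneg (poisson_pos hz _).le (h0 t))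
    (integrable_poisson_mul hf _ hz)]
  rw [integral_pos_iff_support_of_nonneg h0 hf] at hpos
  have : (Function.support fun t => poisson z.im (z.re - t) * f t) = Function.support f := by
    ext t
    simp [(poisson_pos hz _).ne']
  rwa [this]

/-- Cauchy's theorem on the rectangle with opposite corners −R + iy and R + i(y + R). The other
three sides have total length 4R and lie in |z| ≥ R, where the p-th power is at most (M/R)^p. -/
theorem norm_intervalIntegral_cauchyInt_rpow_le {f : ℝ → ℝ} (hf : Integrable f) (h0 : 0 ≤ f)
    (hpos : 0 < ∫ t, f t) {L : ℝ} (hL : ∀ t, L < |t| → f t = 0) {p : ℝ} (hp : 1 < p)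
    {y : ℝ} (hy : 0 < y) {R : ℝ} (hR : 2 * L ≤ R) (hR0 : 0 < R) :
    ‖∫ x in (-R)..R, cauchyInt f (x + y * Complex.I) ^ (p : ℂ)‖ ≤
      4 * (2 / Real.pi * ∫ t, |f t|) ^ p * R ^ (1 - p) := by
  set M := 2 / Real.pi * ∫ t, |f t| with hM
  have hM0 : 0 ≤ M := by
    have : 0 ≤ ∫ t, |f t| := integral_nonneg fun t => abs_nonneg _
    have := Real.pi_pos
    positivity
  have bound : ∀ z : ℂ, 0 < z.im → R ≤ ‖z‖ → ‖cauchyInt f z ^ (p : ℂ)‖ ≤ M ^ p * R ^ (-p) := by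
    intro z hz hRz
    have h1 : ‖cauchyInt f z‖ ≤ M / R := by
      refine (norm_cauchyInt_le hf hL (by linarith) (by linarith)).trans ?_
      gcongr
    rw [Complex.norm_cpow_real, Real.rpow_neg hR0.le, ← div_eq_mul_inv, ← Real.div_rpow hM0 hR0.le]
    exact Real.rpow_le_rpow (norm_nonneg _) h1 (by linarith)
  have hrect := Complex.integral_boundary_rect_eq_zero_of_differentiableOn
    (fun z => cauchyInt f z ^ (p : ℂ)) (⟨-R, y⟩ : ℂ) (⟨R, y + R⟩ : ℂ) (by
      intro z hz
      have hz2 : 0 < z.im := by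
        have := (Complex.mem_reProdIm.1 hz).2
        rw [Set.uIcc_of_le (by simp; linarith)] at this
        have := this.1
        simp at this
        linarith
      exact ((differentiableAt_cauchyInt hf hz2).cpow_const
        (Or.inl (re_cauchyInt_pos hf h0 hpos hz2))).differentiableWithinAt)
  simp only at hrect
  set I1 := ∫ x in (-R)..R, cauchyInt f (x + y * Complex.I) ^ (p : ℂ)
  set I2 := ∫ x in (-R)..R, cauchyInt f (x + ((y + R : ℝ) : ℂ) * Complex.I) ^ (p : ℂ) with hI2
  set I3 := ∫ v in y..(y + R), cauchyInt f ((R : ℂ) + v * Complex.I) ^ (p : ℂ) with hI3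
  set I4 := ∫ v in y..(y + R), cauchyInt f (((-R : ℝ) : ℂ) + v * Complex.I) ^ (p : ℂ) with hI4
  have b2 : ‖I2‖ ≤ M ^ p * R ^ (-p) * |R - (-R)| := by
    refine intervalIntegral.norm_integral_le_of_norm_le_const fun x hx => bound _ ?_ ?_
    · simp; linarith
    · refine le_trans ?_ (Complex.abs_im_le_norm _)
      refine le_trans ?_ (le_abs_self _)
      simp; linarith
  have b3 : ‖I3‖ ≤ M ^ p * R ^ (-p) * |y + R - y| := by
    refine intervalIntegral.norm_integral_le_of_norm_le_const fun v hv => bound _ ?_ ?_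
    · rw [Set.uIoc_of_le (by linarith)] at hv
      simp; linarith [hv.1]
    · refine le_trans ?_ (Complex.abs_re_le_norm _)
      refine le_trans ?_ (le_abs_self _)
      simp
  have b4 : ‖I4‖ ≤ M ^ p * R ^ (-p) * |y + R - y| := by
    refine intervalIntegral.norm_integral_le_of_norm_le_const fun v hv => bound _ ?_ ?_
    · rw [Set.uIoc_of_le (by linarith)] at hv
      simp; linarith [hv.1]
    · refine le_trans ?_ (Complex.abs_re_le_norm _)
      refine le_trans ?_ (neg_le_abs _)
      simp
  have hI1 : I1 = I2 - Complex.I * I3 + Complex.I * I4 := by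
    simp only [smul_eq_mul] at hrect
    linear_combination hrect
  have e : R ^ (1 - p) = R * R ^ (-p) := by
    rw [sub_eq_add_neg, Real.rpow_add hR0, Real.rpow_one]
  have n3 : ‖Complex.I * I3‖ = ‖I3‖ := by simp
  have n4 : ‖Complex.I * I4‖ = ‖I4‖ := by simp
  rw [hI1, e]
  have habs : |R - (-R)| = 2 * R := by rw [abs_of_pos] <;> linarith
  have habs2 : |y + R - y| = R := by rw [abs_of_pos] <;> linarith
  rw [habs] at b2
  rw [habs2] at b3 b4
  calc ‖I2 - Complex.I * I3 + Complex.I * I4‖ ≤ ‖I2‖ + ‖I3‖ + ‖I4‖ := by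
        refine (norm_add_le _ _).trans ?_
        rw [n4]
        gcongr
        refine (norm_sub_le _ _).trans ?_
        rw [n3]
    _ ≤ M ^ p * R ^ (-p) * (2 * R) + M ^ p * R ^ (-p) * R + M ^ p * R ^ (-p) * R := by gcongr
    _ = _ := by ring

/-- Integrate the pointwise inequality over [−R, R] at height y. The integral of Re G^p is
O(R^{1−p}) and disappears as R → ∞, leaving the p-th power integral of the imaginary part controlled
by that of the real part. -/
theorem exists_lintegral_im_cauchyInt_le {p : ℝ} (hp : 1 < p) (hp2 : p ≤ 2) :
    ∃ A : ℝ, 0 ≤ A ∧ ∀ f : ℝ → ℝ, Integrable f → 0 ≤ f → (∃ L, ∀ t, L < |t| → f t = 0) →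
      ∀ y : ℝ, 0 < y → ∫⁻ x : ℝ, ENNReal.ofReal (|(cauchyInt f (x + y * Complex.I)).im| ^ p) ≤
        ENNReal.ofReal A * ∫⁻ x : ℝ, ENNReal.ofReal (|(cauchyInt f (x + y * Complex.I)).re| ^ p) := by
  obtain ⟨A, B, hA, hB, hAB⟩ := exists_abs_im_rpow_le hp hp2
  refine ⟨A, hA, fun f hf h0 ⟨L, hL⟩ y hy => ?_⟩
  -- If f vanishes almost everywhere the real part is not positive, so this trivial case is set
  -- apart.
  rcases (integral_nonneg h0).eq_or_lt' with hz | hpos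
  · have hae : f =ᵐ[volume] 0 := (integral_eq_zero_iff_of_nonneg h0 hf).1 hz
    have : ∀ z, cauchyInt f z = 0 := by
      intro z
      unfold cauchyInt
      rw [integral_eq_zero_of_ae]
      filter_upwards [hae] with t ht
      simp [ht]
    simp [this, Real.zero_rpow (by linarith : p ≠ 0)]
  set G : ℝ → ℂ := fun x => cauchyInt f (x + y * Complex.I) with hG
  have him : ∀ x : ℝ, 0 < ((x : ℂ) + y * Complex.I).im := fun x => by simpa using hy
  have hre : ∀ x, 0 < (G x).re := fun x => re_cauchyInt_pos hf h0 hpos (him x)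
  have hGc : Continuous G := by
    rw [continuous_iff_continuousAt]
    intro x
    exact ContinuousAt.comp (f := fun x : ℝ => (x : ℂ) + y * Complex.I)
      (differentiableAt_cauchyInt hf (him x)).continuousAt (by fun_prop)
  have hGp : Continuous fun x => G x ^ (p : ℂ) :=
    hGc.cpow continuous_const fun x => Or.inl (hre x)
  have hp0 : 0 ≤ p := by linarith
  have hu : Continuous fun x => |(G x).re| ^ p :=
    (Complex.continuous_re.comp hGc).abs.rpow_const fun _ => Or.inr hp0
  have hv : Continuous fun x => |(G x).im| ^ p :=
    (Complex.continuous_im.comp hGc).abs.rpow_const fun _ => Or.inr hp0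
  set M := 2 / Real.pi * ∫ t, |f t| with hM
  set S := ∫⁻ x : ℝ, ENNReal.ofReal (|(G x).re| ^ p)
  have step : ∀ R : ℝ, 2 * L ≤ R → 0 < R →
      ∫⁻ x in Set.Ioc (-R) R, ENNReal.ofReal (|(G x).im| ^ p) ≤
        ENNReal.ofReal A * S + ENNReal.ofReal (B * (4 * M ^ p * R ^ (1 - p))) := by
    intro R hR hR0
    have hle : -R ≤ R := by linarith
    have h1 : ∫ x in (-R)..R, |(G x).im| ^ p ≤
        A * (∫ x in (-R)..R, |(G x).re| ^ p) - B * ∫ x in (-R)..R, (G x ^ (p : ℂ)).re := by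
      rw [← intervalIntegral.integral_const_mul, ← intervalIntegral.integral_const_mul,
        ← intervalIntegral.integral_sub]
      · refine intervalIntegral.integral_mono_on hle (hv.intervalIntegrable _ _) ?_ fun x _ => ?_
        · exact ((hu.const_mul A).sub
            ((Complex.continuous_re.comp hGp).const_mul B)).intervalIntegrable _ _
        · have := hAB (G x) (hre x)
          rwa [abs_of_pos (hre x)]
      · exact (hu.const_mul A).intervalIntegrable _ _
      · exact ((Complex.continuous_re.comp hGp).const_mul B).intervalIntegrable _ _
    have h2 : ∫ x in (-R)..R, (G x ^ (p : ℂ)).re = (∫ x in (-R)..R, G x ^ (p : ℂ)).re := by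
      rw [intervalIntegral.integral_of_le hle, intervalIntegral.integral_of_le hle]
      exact integral_re (𝕜 := ℂ) ((intervalIntegrable_iff_integrableOn_Ioc_of_le hle).1
        (hGp.intervalIntegrable _ _))
    have h3 : -(∫ x in (-R)..R, (G x ^ (p : ℂ)).re) ≤ 4 * M ^ p * R ^ (1 - p) := by
      rw [h2]
      exact ((neg_le_abs _).trans (Complex.abs_re_le_norm _)).trans
        (norm_intervalIntegral_cauchyInt_rpow_le hf h0 hpos hL hp hy hR hR0)
    have h4 : ∫ x in (-R)..R, |(G x).im| ^ p ≤
        A * (∫ x in (-R)..R, |(G x).re| ^ p) + B * (4 * M ^ p * R ^ (1 - p)) := by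
      nlinarith [mul_le_mul_of_nonneg_left h3 hB]
    rw [intervalIntegral.integral_of_le hle, intervalIntegral.integral_of_le hle] at h4
    rw [← ofReal_integral_eq_lintegral_ofReal
      ((intervalIntegrable_iff_integrableOn_Ioc_of_le hle).1 (hv.intervalIntegrable _ _))
      (Eventually.of_forall fun x => by positivity)]
    refine (ENNReal.ofReal_le_ofReal h4).trans (ENNReal.ofReal_add_le.trans ?_)
    gcongr
    rw [ENNReal.ofReal_mul hA]
    gcongr
    rw [ofReal_integral_eq_lintegral_ofReal
      ((intervalIntegrable_iff_integrableOn_Ioc_of_le hle).1 (hu.intervalIntegrable _ _))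
      (Eventually.of_forall fun x => by positivity)]
    exact setLIntegral_le_lintegral _ _
  have hlim1 : Tendsto (fun R : ℝ => ∫⁻ x in Set.Ioc (-R) R, ENNReal.ofReal (|(G x).im| ^ p)) atTop
      (𝓝 (∫⁻ x, ENNReal.ofReal (|(G x).im| ^ p))) :=
    (aecover_Ioc tendsto_neg_atTop_atBot tendsto_id).lintegral_tendsto_of_countably_generated
      hv.measurable.ennreal_ofReal.aemeasurable
  have hlim2 : Tendsto (fun R : ℝ => ENNReal.ofReal A * S +
      ENNReal.ofReal (B * (4 * M ^ p * R ^ (1 - p)))) atTop (𝓝 (ENNReal.ofReal A * S + 0)) := by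
    refine tendsto_const_nhds.add ?_
    rw [← ENNReal.ofReal_zero]
    refine ENNReal.tendsto_ofReal ?_
    have : Tendsto (fun R : ℝ => R ^ (1 - p)) atTop (𝓝 0) := by
      have := tendsto_rpow_neg_atTop (y := p - 1) (by linarith)
      simpa using this
    simpa using (this.const_mul (4 * M ^ p)).const_mul B
  rw [add_zero] at hlim2
  refine le_of_tendsto_of_tendsto hlim1 hlim2 ?_
  filter_upwards [eventually_ge_atTop (2 * L), eventually_gt_atTop 0] with R h1 h2
  exact step R h1 h2

end HilbertTransform

/-! ### Interpolation between L^p and L^∞. -/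

section Interpolation

theorem eLpNorm_le_of_enorm_le {α : Type*} [MeasurableSpace α] {μ : Measure α} {f : α → ℂ}
    {p r : ℝ} (hp : 0 < p) (hpr : p ≤ r) {M : ℝ≥0∞} (hMt : M ≠ ⊤) (hM : ∀ x, ‖f x‖ₑ ≤ M) :
    eLpNorm f (ENNReal.ofReal r) μ ≤
      eLpNorm f (ENNReal.ofReal p) μ ^ (p / r) * M ^ (1 - p / r) := by
  have hr : 0 < r := hp.trans_le hpr
  have h0 : 0 ≤ r - p := by linarith
  rw [eLpNorm_ofReal hp, eLpNorm_ofReal hr]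
  have h1 : ∫⁻ x, ‖f x‖ₑ ^ r ∂μ ≤ M ^ (r - p) * ∫⁻ x, ‖f x‖ₑ ^ p ∂μ := by
    rw [← lintegral_const_mul' _ _ (ENNReal.rpow_ne_top_of_nonneg h0 hMt)]
    refine lintegral_mono fun x => ?_
    calc ‖f x‖ₑ ^ r = ‖f x‖ₑ ^ (r - p) * ‖f x‖ₑ ^ p := by
          rw [← ENNReal.rpow_add_of_nonneg _ _ h0 hp.le]; ring_nf
      _ ≤ _ := by gcongr; exact hM x
  refine (ENNReal.rpow_le_rpow h1 (by positivity)).trans (le_of_eq ?_)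
  rw [ENNReal.mul_rpow_of_nonneg _ _ (by positivity), ← ENNReal.rpow_mul, ← ENNReal.rpow_mul,
    mul_comm]
  congr 2 <;> field_simp

theorem memLp_of_integrable_of_bound {α : Type*} [MeasurableSpace α] {μ : Measure α} {f : α → ℂ}
    (hf : Integrable f μ) {K : ℝ} (hK : ∀ x, ‖f x‖ ≤ K) (q : ℝ≥0∞) (hq : 1 ≤ q) :
    MemLp f q μ := by
  refine ⟨hf.1, ?_⟩
  rcases eq_or_ne q ⊤ with rfl | hqt
  · exact (memLp_top_of_bound hf.1 K (Eventually.of_forall hK)).2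
  · have hq1 : 1 ≤ q.toReal := by
      rw [← ENNReal.toReal_one]; exact ENNReal.toReal_mono hqt hq
    have hM : ∀ x, ‖f x‖ₑ ≤ ENNReal.ofReal K := fun x => by
      rw [← ofReal_norm]; exact ENNReal.ofReal_le_ofReal (hK x)
    have := eLpNorm_le_of_enorm_le (μ := μ) one_pos hq1 ENNReal.ofReal_ne_top hM
    rw [ENNReal.ofReal_toReal hqt] at this
    refine this.trans_lt (ENNReal.mul_lt_top ?_ ?_)
    · refine ENNReal.rpow_lt_top_of_nonneg (by positivity) ?_
      rw [ENNReal.ofReal_one]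
      exact (memLp_one_iff_integrable.2 hf).2.ne
    · refine ENNReal.rpow_lt_top_of_nonneg ?_ ENNReal.ofReal_ne_top
      rw [sub_nonneg, div_le_one (by linarith)]; exact hq1

end Interpolation

/-! ### Transposition of convolution operators. -/

section Duality

variable {E : Type*} [NormedAddCommGroup E] [InnerProductSpace ℝ E] [FiniteDimensional ℝ E]
  [MeasurableSpace E] [BorelSpace E]

theorem integral_mul_cv {κ f g : E → ℂ} {p q : ℝ≥0∞} [hpq : ENNReal.HolderConjugate q p]
    (hκ : MemLp κ q volume) (hf : MemLp f p volume) (hg : AEStronglyMeasurable g volume)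
    (hi : Integrable fun x => ‖g x‖ * ‖cv (fun y => (‖κ y‖ : ℂ)) (fun y => (‖f y‖ : ℂ)) x‖) :
    ∫ x, g x * cv κ f x = ∫ y, f y * cv (fun s => κ (-s)) g y := by
  have hm : AEStronglyMeasurable (fun z : E × E => g z.1 * (κ (z.1 - z.2) * f z.2))
      (volume.prod volume) :=
    hg.comp_fst.mul ((aestronglyMeasurable_sub_prod hκ.1).mul hf.1.comp_snd)
  have hint : Integrable (fun z : E × E => g z.1 * (κ (z.1 - z.2) * f z.2))
      (volume.prod volume) := by
    rw [integrable_prod_iff hm]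
    refine ⟨Eventually.of_forall fun x => (integrable_cv hκ hf x).const_mul (g x), ?_⟩
    refine hi.congr (Eventually.of_forall fun x => ?_)
    simp only [norm_mul]
    rw [integral_const_mul]
    congr 1
    unfold cv
    simp_rw [← Complex.ofReal_mul]
    rw [integral_complex_ofReal, Complex.norm_real, Real.norm_of_nonneg]
    exact integral_nonneg fun y => by positivity
  calc ∫ x, g x * cv κ f x = ∫ x, ∫ y, g x * (κ (x - y) * f y) := by
        simp_rw [cv, ← integral_const_mul]
    _ = ∫ y, ∫ x, g x * (κ (x - y) * f y) := integral_integral_swap hint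
    _ = _ := by
        refine integral_congr_ae (Eventually.of_forall fun y => ?_)
        beta_reduce
        rw [cv, ← integral_const_mul]
        refine integral_congr_ae (Eventually.of_forall fun x => ?_)
        simp only [neg_sub]
        ring

theorem integral_mul_cv_of_integrable {κ f g : E → ℂ} {p q : ℝ≥0∞}
    [hpq : ENNReal.HolderConjugate q p]
    (hκ : MemLp κ q volume) (hf : MemLp f p volume) (hg : Integrable g) :
    ∫ x, g x * cv κ f x = ∫ y, f y * cv (fun s => κ (-s)) g y := by
  refine integral_mul_cv hκ hf hg.1 ?_
  have hκ' : MemLp (fun y => (‖κ y‖ : ℂ)) q volume := hκ.norm.ofReal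
  have hf' : MemLp (fun y => (‖f y‖ : ℂ)) p volume := hf.norm.ofReal
  refine Integrable.mul_bdd (c := (eLpNorm (fun y => (‖κ y‖ : ℂ)) q volume *
      eLpNorm (fun y => (‖f y‖ : ℂ)) p volume).toReal) hg.norm
      (aestronglyMeasurable_cv hκ'.1 hf'.1).norm ?_
  filter_upwards with x
  rw [norm_norm]
  have := enorm_cv_le hκ'.1 hf'.1 p q x
  rw [← ofReal_norm, ENNReal.ofReal_le_iff_le_toReal (ENNReal.mul_lt_top hκ'.2 hf'.2).ne] at this
  exact this

/-- Boundedness of a convolution operator on `L^q` implies that of the transposed operator on the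
dual space. -/
theorem eLpNorm_cv_le_of_dual {p q : ℝ} (hpq : p.HolderConjugate q) {κ : E → ℂ}
    (hκ1 : MemLp κ 1 volume) (hκq : MemLp κ (ENNReal.ofReal q) volume) {C : ℝ≥0∞}
    (hC : ∀ g : E → ℂ, MemLp g (ENNReal.ofReal q) volume →
      eLpNorm (cv (fun s => κ (-s)) g) (ENNReal.ofReal q) volume ≤
        C * eLpNorm g (ENNReal.ofReal q) volume)
    {f : E → ℂ} (hf : MemLp f (ENNReal.ofReal p) volume) :
    eLpNorm (cv κ f) (ENNReal.ofReal p) volume ≤ C * eLpNorm f (ENNReal.ofReal p) volume := by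
  have hp := hpq.pos
  have hq := hpq.symm.pos
  have : ENNReal.HolderConjugate (ENNReal.ofReal q) (ENNReal.ofReal p) := hpq.symm.ennrealOfReal
  have : ENNReal.HolderConjugate (ENNReal.ofReal p) (ENNReal.ofReal q) := hpq.ennrealOfReal
  set h := cv κ f with hh
  have hhL : MemLp h (ENNReal.ofReal p) volume := memLp_cv_one hκ1 hpq.lt.le hf
  -- The extremal test function: g h = |h|^p and |g|^q = |h|^p, so pairing g with h returns the p-th
  -- power of the L^p norm of h.
  set g : E → ℂ := fun x => (starRingEnd ℂ) (h x) * ((‖h x‖ ^ (p - 2) : ℝ) : ℂ) with hg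
  have hgn : ∀ x, ‖g x‖ = ‖h x‖ ^ (p - 1) := by
    intro x
    simp only [hg, norm_mul, RCLike.norm_conj, Complex.norm_real]
    rw [Real.norm_of_nonneg (by positivity)]
    rcases (norm_nonneg (h x)).eq_or_lt with h0 | h0
    · rw [← h0, zero_mul, Real.zero_rpow]; linarith [hpq.lt]
    · rw [show p - 1 = 1 + (p - 2) by ring, Real.rpow_add h0, Real.rpow_one]
  have hgm : AEStronglyMeasurable g volume := by
    refine AEStronglyMeasurable.mul ?_ ?_
    · exact Complex.continuous_conj.comp_aestronglyMeasurable hhL.1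
    · exact Complex.continuous_ofReal.comp_aestronglyMeasurable
        (hhL.1.norm.aemeasurable.pow_const _).aestronglyMeasurable
  have hge : ∀ x, ‖g x‖ₑ ^ q = ‖h x‖ₑ ^ p := by
    intro x
    rw [← ofReal_norm, hgn, ENNReal.ofReal_rpow_of_nonneg (by positivity) hq.le,
      ← Real.rpow_mul (norm_nonneg _), hpq.sub_one_mul_conj,
      ← ENNReal.ofReal_rpow_of_nonneg (norm_nonneg _) hp.le, ofReal_norm]
  have hgN : eLpNorm g (ENNReal.ofReal q) volume =
      eLpNorm h (ENNReal.ofReal p) volume ^ (p / q) := by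
    rw [eLpNorm_ofReal hp, eLpNorm_ofReal hq, ← ENNReal.rpow_mul]
    simp_rw [hge]
    congr 1; field_simp
  have hgL : MemLp g (ENNReal.ofReal q) volume := by
    refine ⟨hgm, ?_⟩
    rw [hgN]
    exact ENNReal.rpow_lt_top_of_nonneg (by positivity) hhL.2.ne
  have hκ' : MemLp (fun y => (‖κ y‖ : ℂ)) 1 volume := hκ1.norm.ofReal
  have hf' : MemLp (fun y => (‖f y‖ : ℂ)) (ENNReal.ofReal p) volume := hf.norm.ofReal
  have hdual := integral_mul_cv hκq hf hgm
    (MemLp.integrable_mul (p := ENNReal.ofReal q) (q := ENNReal.ofReal p) hgL.norm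
      (memLp_cv_one hκ' hpq.lt.le hf').norm)
  have hlhs : ‖∫ x, g x * cv κ f x‖ₑ = eLpNorm h (ENNReal.ofReal p) volume ^ p := by
    have e1 : ∀ x, g x * cv κ f x = ((‖h x‖ ^ p : ℝ) : ℂ) := by
      intro x
      rw [← hh]
      simp only [hg]
      rw [mul_right_comm, mul_comm ((starRingEnd ℂ) (h x)), Complex.mul_conj,
        Complex.normSq_eq_norm_sq, ← Complex.ofReal_mul]
      congr 1
      rcases (norm_nonneg (h x)).eq_or_lt with h0 | h0
      · rw [← h0, Real.zero_rpow hp.ne']; simp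
      · rw [← Real.rpow_natCast, ← Real.rpow_add h0]; congr 1; push_cast; ring
    simp_rw [e1]
    rw [integral_complex_ofReal, ← ofReal_norm, Complex.norm_real,
      Real.norm_of_nonneg (integral_nonneg fun x => by positivity),
      ofReal_integral_eq_lintegral_ofReal _ (Eventually.of_forall fun x => by positivity)]
    · rw [eLpNorm_ofReal hp, ← ENNReal.rpow_mul, one_div_mul_cancel hp.ne', ENNReal.rpow_one]
      refine lintegral_congr fun x => ?_
      rw [← ENNReal.ofReal_rpow_of_nonneg (norm_nonneg _) hp.le, ofReal_norm]
    · have := hhL.integrable_norm_rpow (by simpa using hp) ENNReal.ofReal_ne_top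
      simpa [ENNReal.toReal_ofReal hp.le] using this
  have hrhs : ‖∫ y, f y * cv (fun s => κ (-s)) g y‖ₑ ≤
      eLpNorm f (ENNReal.ofReal p) volume *
        (C * eLpNorm h (ENNReal.ofReal p) volume ^ (p / q)) := by
    have hm2 : AEStronglyMeasurable (fun s => κ (-s)) volume :=
      hκ1.1.comp_measurePreserving (Measure.measurePreserving_neg volume)
    refine (enorm_integral_le_lintegral_enorm _).trans ?_
    have := eLpNorm_smul_le_mul_eLpNorm (p := ENNReal.ofReal p) (q := ENNReal.ofReal q) (r := 1)
      (aestronglyMeasurable_cv hm2 hgm) hf.1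
    rw [eLpNorm_one_eq_lintegral_enorm] at this
    refine le_trans (by simpa using this) ?_
    gcongr
    rw [← hgN]
    exact hC g hgL
  rw [← hdual, hlhs] at hrhs
  set N := eLpNorm h (ENNReal.ofReal p) volume
  -- The integrability of κ makes `N` finite beforehand, so that N^{p/q} can be cancelled when `N`
  -- is nonzero.
  rcases eq_or_ne N 0 with h0 | h0
  · rw [h0]; exact zero_le
  have hNt : N ≠ ⊤ := hhL.2.ne
  have e2 : N ^ p = N * N ^ (p / q) := by
    rw [show N * N ^ (p / q) = N ^ (1 : ℝ) * N ^ (p / q) by rw [ENNReal.rpow_one],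
      ← ENNReal.rpow_add _ _ h0 hNt]
    congr 1
    have := hpq.div_conj_eq_sub_one
    linarith
  rw [e2, ← mul_assoc] at hrhs
  rw [mul_comm C]
  refine (ENNReal.mul_le_mul_iff_left ?_ ?_).1 hrhs
  · simp only [ne_eq, ENNReal.rpow_eq_zero_iff, h0, hNt, false_and, or_self, not_false_eq_true]
  · exact ENNReal.rpow_ne_top_of_nonneg (by positivity) hNt

end Duality

/-! ### M. Riesz' theorem for truncated Hilbert transforms. -/

section HilbertKernel

theorem poisson_eq {y : ℝ} (hy : 0 < y) (s : ℝ) :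
    poisson y s = (1 / Real.pi * y⁻¹) * (1 + (s / y) ^ 2)⁻¹ := by
  unfold poisson
  have : s ^ 2 + y ^ 2 ≠ 0 := by positivity
  field_simp
  rw [add_comm]

theorem integrable_poisson {y : ℝ} (hy : 0 < y) : Integrable (poisson y) := by
  have h : Integrable fun s : ℝ => (1 + (s / y) ^ 2)⁻¹ :=
    integrable_inv_one_add_sq.comp_div hy.ne'
  exact (h.const_mul (1 / Real.pi * y⁻¹)).congr
    (Eventually.of_forall fun s => (poisson_eq hy s).symm)

theorem integral_poisson {y : ℝ} (hy : 0 < y) : ∫ s, poisson y s = 1 := by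
  simp_rw [poisson_eq hy]
  rw [integral_const_mul, Measure.integral_comp_div (fun s => (1 + s ^ 2)⁻¹) y,
    integral_univ_inv_one_add_sq, abs_of_pos hy, smul_eq_mul]
  have := Real.pi_ne_zero
  field_simp

theorem eLpNorm_poisson {y : ℝ} (hy : 0 < y) :
    eLpNorm (fun s => (poisson y s : ℂ)) 1 volume = 1 := by
  rw [eLpNorm_one_eq_lintegral_enorm]
  have : ∀ s, ‖(poisson y s : ℂ)‖ₑ = ENNReal.ofReal (poisson y s) := fun s => by
    rw [← ofReal_norm, Complex.norm_real, Real.norm_of_nonneg (poisson_pos hy s).le]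
  simp_rw [this]
  rw [← ofReal_integral_eq_lintegral_ofReal (integrable_poisson hy)
    (Eventually.of_forall fun s => (poisson_pos hy s).le), integral_poisson hy, ENNReal.ofReal_one]

/-- A smooth integrable truncation of the kernel of the Hilbert transform. -/
def hilbertKernel (y Y : ℝ) (s : ℝ) : ℂ := ((conjPoisson y s - conjPoisson Y s : ℝ) : ℂ)

theorem hilbertKernel_neg (y Y s : ℝ) : hilbertKernel y Y (-s) = -hilbertKernel y Y s := by
  unfold hilbertKernel conjPoisson
  push_cast
  ring

theorem continuous_hilbertKernel {y Y : ℝ} (hy : 0 < y) (hY : 0 < Y) :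
    Continuous (hilbertKernel y Y) := by
  unfold hilbertKernel conjPoisson
  have h1 : ∀ s : ℝ, s ^ 2 + y ^ 2 ≠ 0 := fun s => by positivity
  have h2 : ∀ s : ℝ, s ^ 2 + Y ^ 2 ≠ 0 := fun s => by positivity
  fun_prop (disch := assumption)

/-- Each conjugate Poisson kernel decays only like 1/|s| and is not integrable; in the difference
the leading terms cancel, which leaves a kernel dominated by a Poisson kernel. -/
theorem norm_hilbertKernel_le {y Y : ℝ} (hy : 0 < y) (hY : 0 < Y) (s : ℝ) :
    ‖hilbertKernel y Y s‖ ≤ (|Y ^ 2 - y ^ 2| / (2 * Y * y)) * poisson y s := by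
  unfold hilbertKernel
  rw [Complex.norm_real, Real.norm_eq_abs]
  have h1 : 0 < s ^ 2 + y ^ 2 := by positivity
  have h2 : 0 < s ^ 2 + Y ^ 2 := by positivity
  have hπ := Real.pi_pos
  have e : conjPoisson y s - conjPoisson Y s =
      (1 / Real.pi) * ((s / (s ^ 2 + Y ^ 2)) * ((Y ^ 2 - y ^ 2) / (s ^ 2 + y ^ 2))) := by
    unfold conjPoisson
    field_simp
    ring
  have h3 : |s / (s ^ 2 + Y ^ 2)| ≤ 1 / (2 * Y) := by
    rw [abs_div, abs_of_pos h2, div_le_div_iff₀ h2 (by positivity)]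
    have h5 : |s| ^ 2 = s ^ 2 := sq_abs s
    nlinarith [sq_nonneg (|s| - Y)]
  rw [e, abs_mul, abs_mul, abs_div (Y ^ 2 - y ^ 2), abs_of_pos h1, abs_of_pos (by positivity)]
  calc 1 / Real.pi * (|s / (s ^ 2 + Y ^ 2)| * (|Y ^ 2 - y ^ 2| / (s ^ 2 + y ^ 2)))
      ≤ 1 / Real.pi * (1 / (2 * Y) * (|Y ^ 2 - y ^ 2| / (s ^ 2 + y ^ 2))) := by gcongr
    _ = _ := by unfold poisson; field_simp

theorem integrable_hilbertKernel {y Y : ℝ} (hy : 0 < y) (hY : 0 < Y) :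
    Integrable (hilbertKernel y Y) :=
  ((integrable_poisson hy).const_mul _).mono' (continuous_hilbertKernel hy hY).aestronglyMeasurable
    (Eventually.of_forall fun s => norm_hilbertKernel_le hy hY s)

theorem poisson_le {y : ℝ} (hy : 0 < y) (s : ℝ) : poisson y s ≤ 1 / Real.pi * y⁻¹ := by
  rw [poisson_eq hy]
  have := Real.pi_pos
  refine mul_le_of_le_one_right (by positivity) (inv_le_one_of_one_le₀ ?_)
  nlinarith [sq_nonneg (s / y)]

theorem memLp_hilbertKernel {y Y : ℝ} (hy : 0 < y) (hY : 0 < Y) {q : ℝ≥0∞} (hq : 1 ≤ q) :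
    MemLp (hilbertKernel y Y) q volume := by
  refine memLp_of_integrable_of_bound (integrable_hilbertKernel hy hY)
    (K := (|Y ^ 2 - y ^ 2| / (2 * Y * y)) * (1 / Real.pi * y⁻¹)) (fun s => ?_) q hq
  refine (norm_hilbertKernel_le hy hY s).trans ?_
  gcongr
  exact poisson_le hy s

theorem cv_ofReal (k f : ℝ → ℝ) (x : ℝ) : cv (fun s => (k s : ℂ)) (fun s => (f s : ℂ)) x =
    ((∫ t, k (x - t) * f t : ℝ) : ℂ) := by
  unfold cv
  rw [← integral_complex_ofReal]
  simp

/-- The real part of the Cauchy integral is the Poisson integral, a contraction of L^p because the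
Poisson kernel has mass one. The contour estimate transfers this bound to the imaginary part,
uniformly in y. -/
theorem exists_eLpNorm_conjPoisson_le {p : ℝ} (hp : 1 < p) (hp2 : p ≤ 2) :
    ∃ C : ℝ≥0∞, C ≠ ⊤ ∧ ∀ f : ℝ → ℝ, Integrable f → 0 ≤ f → (∃ L, ∀ t, L < |t| → f t = 0) →
      ∀ y : ℝ, 0 < y → eLpNorm (cv (fun s => (conjPoisson y s : ℂ)) (fun s => (f s : ℂ)))
        (ENNReal.ofReal p) volume ≤ C * eLpNorm (fun s => (f s : ℂ)) (ENNReal.ofReal p) volume := by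
  obtain ⟨A, hA, hAf⟩ := exists_lintegral_im_cauchyInt_le hp hp2
  have hp0 : 0 < p := by linarith
  refine ⟨ENNReal.ofReal A ^ (1 / p), ENNReal.rpow_ne_top_of_nonneg (by positivity)
    ENNReal.ofReal_ne_top, fun f hf h0 hL y hy => ?_⟩
  have hY := eLpNorm_cv_le_one (k := fun s => (poisson y s : ℂ)) (f := fun s => (f s : ℂ))
    (integrable_poisson hy).ofReal.1 hf.ofReal.1 hp.le
  rw [eLpNorm_poisson hy, one_mul] at hY
  refine le_trans ?_ (mul_le_mul_right hY _)
  rw [eLpNorm_ofReal hp0, eLpNorm_ofReal hp0, ← ENNReal.mul_rpow_of_nonneg _ _ (by positivity)]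
  refine ENNReal.rpow_le_rpow ?_ (by positivity)
  have key := hAf f hf h0 hL y hy
  have e1 : ∀ x : ℝ, ‖cv (fun s => (conjPoisson y s : ℂ)) (fun s => (f s : ℂ)) x‖ₑ ^ p =
      ENNReal.ofReal (|(cauchyInt f (x + y * Complex.I)).im| ^ p) := by
    intro x
    rw [cauchyInt_eq hf x hy, cv_ofReal, ← ofReal_norm, Complex.norm_real, Real.norm_eq_abs,
      ENNReal.ofReal_rpow_of_nonneg (abs_nonneg _) hp0.le]
    simp
  have e2 : ∀ x : ℝ, ‖cv (fun s => (poisson y s : ℂ)) (fun s => (f s : ℂ)) x‖ₑ ^ p =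
      ENNReal.ofReal (|(cauchyInt f (x + y * Complex.I)).re| ^ p) := by
    intro x
    rw [cauchyInt_eq hf x hy, cv_ofReal, ← ofReal_norm, Complex.norm_real, Real.norm_eq_abs,
      ENNReal.ofReal_rpow_of_nonneg (abs_nonneg _) hp0.le]
    simp
  simp_rw [e1, e2]
  exact key

/-- Uniform `L^p` boundedness on compactly supported nonnegative functions passes to all
complex-valued functions. -/
theorem eLpNorm_cv_le_of_nonneg {p q : ℝ} (hpq : p.HolderConjugate q) {κ : ℝ → ℂ}
    (hκ : MemLp κ (ENNReal.ofReal q) volume) {C : ℝ≥0∞}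
    (hC : ∀ f : ℝ → ℝ, Integrable f → MemLp f (ENNReal.ofReal p) volume → 0 ≤ f →
      (∃ L, ∀ t, L < |t| → f t = 0) → eLpNorm (cv κ (fun s => (f s : ℂ)))
        (ENNReal.ofReal p) volume ≤ C * eLpNorm (fun s => (f s : ℂ)) (ENNReal.ofReal p) volume)
    {f : ℝ → ℂ} (hf : MemLp f (ENNReal.ofReal p) volume) :
    eLpNorm (cv κ f) (ENNReal.ofReal p) volume ≤
      4 * C * eLpNorm f (ENNReal.ofReal p) volume := by
  have hp1 : (1 : ℝ≥0∞) ≤ ENNReal.ofReal p := by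
    rw [← ENNReal.ofReal_one]; exact ENNReal.ofReal_le_ofReal hpq.lt.le
  have : ENNReal.HolderConjugate (ENNReal.ofReal q) (ENNReal.ofReal p) := hpq.symm.ennrealOfReal
  have hpos : ∀ g : ℝ → ℝ, MemLp g (ENNReal.ofReal p) volume → 0 ≤ g →
      eLpNorm (cv κ (fun s => (g s : ℂ))) (ENNReal.ofReal p) volume ≤
        C * eLpNorm (fun s => (g s : ℂ)) (ENNReal.ofReal p) volume := by
    intro g hg g0
    set gn : ℕ → ℝ → ℝ := fun n => (Set.Icc (-n : ℝ) n).indicator g with hgn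
    have hgnL : ∀ n, MemLp (gn n) (ENNReal.ofReal p) volume := fun n => hg.indicator measurableSet_Icc
    have hgni : ∀ n, Integrable (gn n) := by
      intro n
      rw [integrable_indicator_iff measurableSet_Icc]
      have := (hg.restrict (Set.Icc (-n : ℝ) n)).mono_exponent hp1
      exact memLp_one_iff_integrable.1 this
    have hgb : ∀ n t, ‖(gn n t : ℂ)‖ ≤ ‖(g t : ℂ)‖ := by
      intro n t
      rw [Complex.norm_real, Complex.norm_real]
      exact norm_indicator_le_norm_self _ _
    have hb : ∀ n, eLpNorm (cv κ (fun s => (gn n s : ℂ))) (ENNReal.ofReal p) volume ≤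
        C * eLpNorm (fun s => (g s : ℂ)) (ENNReal.ofReal p) volume := by
      intro n
      refine (hC (gn n) (hgni n) (hgnL n) (fun t => Set.indicator_nonneg (fun t _ => g0 t) t)
        ⟨n, fun t ht => ?_⟩).trans (mul_le_mul_right (eLpNorm_mono (hgb n)) C)
      refine Set.indicator_of_notMem (fun h => ?_) _
      exact absurd (abs_le.2 h) (not_le.2 ht)
    have hlim : ∀ x, Tendsto (fun n => cv κ (fun s => (gn n s : ℂ)) x) atTop
        (𝓝 (cv κ (fun s => (g s : ℂ)) x)) := by
      intro x
      refine tendsto_integral_of_dominated_convergence (fun y => ‖κ (x - y) * (g y : ℂ)‖) ?_ ?_ ?_ ?_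
      · intro n
        exact (aestronglyMeasurable_sub_left hκ.1 x).mul (hgni n).ofReal.1
      · exact (integrable_cv hκ hg.ofReal x).norm
      · intro n
        refine Eventually.of_forall fun t => ?_
        rw [norm_mul, norm_mul]
        exact mul_le_mul_of_nonneg_left (hgb n t) (norm_nonneg _)
      · refine Eventually.of_forall fun t => ?_
        refine tendsto_const_nhds.congr' ?_
        filter_upwards [eventually_ge_atTop ⌈|t|⌉₊] with n hn
        have : t ∈ Set.Icc (-n : ℝ) n := abs_le.1 ((Nat.le_ceil _).trans (by exact_mod_cast hn))
        simp only [hgn]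
        rw [Set.indicator_of_mem this]
    refine (Lp.eLpNorm_lim_le_liminf_eLpNorm (fun n =>
      aestronglyMeasurable_cv hκ.1 (hgni n).ofReal.1) _ (Eventually.of_forall hlim)).trans ?_
    exact liminf_le_of_le (by isBoundedDefault) fun b hb' => by
      obtain ⟨n, hn⟩ := hb'.exists
      exact hn.trans (hb n)
  set g1 : ℝ → ℝ := fun t => max (f t).re 0
  set g2 : ℝ → ℝ := fun t => max (-(f t).re) 0
  set g3 : ℝ → ℝ := fun t => max (f t).im 0
  set g4 : ℝ → ℝ := fun t => max (-(f t).im) 0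
  have key : ∀ g : ℝ → ℝ, AEStronglyMeasurable g volume → (∀ t, 0 ≤ g t) → (∀ t, g t ≤ ‖f t‖) →
      MemLp (fun s => (g s : ℂ)) (ENNReal.ofReal p) volume ∧
      eLpNorm (cv κ (fun s => (g s : ℂ))) (ENNReal.ofReal p) volume ≤
        C * eLpNorm f (ENNReal.ofReal p) volume := by
    intro g gm g0 gf
    have hb : ∀ t, ‖(g t : ℂ)‖ ≤ ‖f t‖ := fun t => by
      rw [Complex.norm_real, Real.norm_of_nonneg (g0 t)]; exact gf t
    have hm : MemLp g (ENNReal.ofReal p) volume := hf.mono gm (Eventually.of_forall fun t => by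
      rw [Real.norm_of_nonneg (g0 t)]; exact gf t)
    exact ⟨hm.ofReal, (hpos g hm g0).trans (mul_le_mul_right (eLpNorm_mono hb) C)⟩
  have hre : AEStronglyMeasurable (fun t => (f t).re) volume :=
    Complex.continuous_re.comp_aestronglyMeasurable hf.1
  have him : AEStronglyMeasurable (fun t => (f t).im) volume :=
    Complex.continuous_im.comp_aestronglyMeasurable hf.1
  have hmax : ∀ u : ℝ → ℝ, AEStronglyMeasurable u volume →
      AEStronglyMeasurable (fun t => max (u t) 0) volume := fun u hu =>
    (by fun_prop : Continuous fun r : ℝ => max r 0).comp_aestronglyMeasurable hu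
  have k1 := key g1 (hmax _ hre) (fun t => le_max_right _ _) (fun t => max_le
    ((le_abs_self _).trans (Complex.abs_re_le_norm _)) (norm_nonneg _))
  have k2 := key g2 (hmax _ hre.neg) (fun t => le_max_right _ _) (fun t => max_le
    ((neg_le_abs _).trans (Complex.abs_re_le_norm _)) (norm_nonneg _))
  have k3 := key g3 (hmax _ him) (fun t => le_max_right _ _) (fun t => max_le
    ((le_abs_self _).trans (Complex.abs_im_le_norm _)) (norm_nonneg _))
  have k4 := key g4 (hmax _ him.neg) (fun t => le_max_right _ _) (fun t => max_le
    ((neg_le_abs _).trans (Complex.abs_im_le_norm _)) (norm_nonneg _))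
  have e : cv κ f = (cv κ (fun s => (g1 s : ℂ)) - cv κ (fun s => (g2 s : ℂ))) +
      Complex.I • (cv κ (fun s => (g3 s : ℂ)) - cv κ (fun s => (g4 s : ℂ))) := by
    funext x
    simp only [Pi.add_apply, Pi.sub_apply, Pi.smul_apply, smul_eq_mul]
    unfold cv
    have i1 := integrable_cv hκ k1.1 x
    have i2 := integrable_cv hκ k2.1 x
    have i3 := integrable_cv hκ k3.1 x
    have i4 := integrable_cv hκ k4.1 x
    have hadd := integral_add (i1.sub i2) ((i3.sub i4).const_mul Complex.I)
    simp only [Pi.sub_apply] at hadd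
    rw [← integral_sub i1 i2, ← integral_sub i3 i4, ← integral_const_mul, ← hadd]
    refine integral_congr_ae (Eventually.of_forall fun t => ?_)
    beta_reduce
    have m : ∀ r : ℝ, max r 0 - max (-r) 0 = r := fun r => by
      rcases le_total r 0 with h | h
      · rw [max_eq_right h, max_eq_left (by linarith)]; ring
      · rw [max_eq_left h, max_eq_right (by linarith)]; ring
    have e1 : ((g1 t : ℂ) - g2 t) = ((f t).re : ℂ) := by
      rw [← Complex.ofReal_sub]; exact congrArg _ (m _)
    have e2 : ((g3 t : ℂ) - g4 t) = ((f t).im : ℂ) := by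
      rw [← Complex.ofReal_sub]; exact congrArg _ (m _)
    rw [← mul_sub, ← mul_sub, e1, e2]
    conv_lhs => rw [← Complex.re_add_im (f t)]
    ring
  have m1 := aestronglyMeasurable_cv hκ.1 k1.1.1
  have m2 := aestronglyMeasurable_cv hκ.1 k2.1.1
  have m3 := aestronglyMeasurable_cv hκ.1 k3.1.1
  have m4 := aestronglyMeasurable_cv hκ.1 k4.1.1
  rw [e]
  refine (eLpNorm_add_le (m1.sub m2) ((m3.sub m4).const_smul _) hp1).trans ?_
  rw [eLpNorm_const_smul]
  have hI : ‖Complex.I‖ₑ = 1 := by rw [← ofReal_norm]; simp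
  rw [hI, one_mul]
  refine (add_le_add (eLpNorm_sub_le m1 m2 hp1) (eLpNorm_sub_le m3 m4 hp1)).trans ?_
  refine (add_le_add (add_le_add k1.2 k2.2) (add_le_add k3.2 k4.2)).trans (le_of_eq ?_)
  ring

/-- **M. Riesz' theorem** for truncated Hilbert transforms, uniformly in the truncation. -/
theorem exists_eLpNorm_hilbertKernel_le {p : ℝ} (hp : 1 < p) :
    ∃ C : ℝ≥0∞, C ≠ ⊤ ∧ ∀ y Y : ℝ, 0 < y → 0 < Y → ∀ f : ℝ → ℂ,
      MemLp f (ENNReal.ofReal p) volume → eLpNorm (cv (hilbertKernel y Y) f)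
        (ENNReal.ofReal p) volume ≤ C * eLpNorm f (ENNReal.ofReal p) volume := by
  have main : ∀ r : ℝ, 1 < r → r ≤ 2 → ∃ C : ℝ≥0∞, C ≠ ⊤ ∧ ∀ y Y : ℝ, 0 < y → 0 < Y →
      ∀ f : ℝ → ℂ, MemLp f (ENNReal.ofReal r) volume → eLpNorm (cv (hilbertKernel y Y) f)
        (ENNReal.ofReal r) volume ≤ C * eLpNorm f (ENNReal.ofReal r) volume := by
    intro r hr hr2
    obtain ⟨C, hC, h⟩ := exists_eLpNorm_conjPoisson_le hr hr2
    refine ⟨4 * (C + C), by finiteness, fun y Y hy hY f hf => ?_⟩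
    have hr1 : (1 : ℝ≥0∞) ≤ ENNReal.ofReal r := by
      rw [← ENNReal.ofReal_one]; exact ENNReal.ofReal_le_ofReal hr.le
    have hq1 : (1 : ℝ≥0∞) ≤ ENNReal.ofReal r.conjExponent := by
      rw [← ENNReal.ofReal_one]
      exact ENNReal.ofReal_le_ofReal (Real.HolderConjugate.conjExponent hr).symm.lt.le
    refine eLpNorm_cv_le_of_nonneg (Real.HolderConjugate.conjExponent hr)
      (memLp_hilbertKernel hy hY hq1) (fun g hg hgL g0 hL => ?_) hf
    have hm : ∀ {y : ℝ}, 0 < y → AEStronglyMeasurable (fun s => (conjPoisson y s : ℂ)) volume := by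
      intro y hy
      refine Continuous.aestronglyMeasurable ?_
      unfold conjPoisson
      have h1 : ∀ s : ℝ, s ^ 2 + y ^ 2 ≠ 0 := fun s => by positivity
      fun_prop (disch := assumption)
    have e : cv (hilbertKernel y Y) (fun s => (g s : ℂ)) =
        cv (fun s => (conjPoisson y s : ℂ)) (fun s => (g s : ℂ)) -
        cv (fun s => (conjPoisson Y s : ℂ)) (fun s => (g s : ℂ)) := by
      funext x
      have : hilbertKernel y Y = fun s => ((conjPoisson y s - conjPoisson Y s : ℝ) : ℂ) := rfl
      rw [Pi.sub_apply, this, cv_ofReal, cv_ofReal, cv_ofReal, ← Complex.ofReal_sub,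
        ← integral_sub (integrable_conjPoisson_mul hg x hy) (integrable_conjPoisson_mul hg x hY)]
      simp_rw [sub_mul]
    rw [e, add_mul]
    exact (eLpNorm_sub_le (aestronglyMeasurable_cv (hm hy) hg.ofReal.1)
      (aestronglyMeasurable_cv (hm hY) hg.ofReal.1) hr1).trans
      (add_le_add (h g hg g0 hL y hy) (h g hg g0 hL Y hY))
  rcases le_or_gt p 2 with h2 | h2
  · exact main p hp h2
  -- For p > 2 the conjugate exponent is below 2. The kernel is odd, so the transposed operator is
  -- minus the operator itself.
  · have hpq := Real.HolderConjugate.conjExponent hp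
    set q := p.conjExponent with hq
    have hq2 : q ≤ 2 := by
      rw [hq, Real.conjExponent, div_le_iff₀ (by linarith)]; linarith
    have hq1 : (1 : ℝ≥0∞) ≤ ENNReal.ofReal q := by
      rw [← ENNReal.ofReal_one]; exact ENNReal.ofReal_le_ofReal hpq.symm.lt.le
    obtain ⟨C, hC, h⟩ := main q hpq.symm.lt hq2
    refine ⟨C, hC, fun y Y hy hY f hf => eLpNorm_cv_le_of_dual hpq (memLp_hilbertKernel hy hY le_rfl)
      (memLp_hilbertKernel hy hY hq1) (fun g hg => ?_) hf⟩
    have e : cv (fun s => hilbertKernel y Y (-s)) g = -cv (hilbertKernel y Y) g := by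
      funext x
      simp only [Pi.neg_apply, cv, hilbertKernel_neg, neg_mul, integral_neg]
    rw [e, eLpNorm_neg]
    exact h y Y hy hY g hg

end HilbertKernel

/-! ### Fourier multipliers of L^p. -/

section Multiplier

variable {E : Type*} [NormedAddCommGroup E] [InnerProductSpace ℝ E] [FiniteDimensional ℝ E]
  [MeasurableSpace E] [BorelSpace E]

/-- `m` is a bounded Fourier multiplier on `L^p` with norm at most `C`, tested on functions with
integrable Fourier transform. -/
structure IsMult (p : ℝ) (C : ℝ≥0∞) (m : E → ℂ) : Prop where
  meas : AEStronglyMeasurable m volume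
  bdd : ∃ K : ℝ, ∀ ξ, ‖m ξ‖ ≤ K
  bound : ∀ g : E → ℂ, Integrable g → eLpNorm (𝓕⁻ (fun ξ => m ξ * g ξ)) (ENNReal.ofReal p) volume ≤
    C * eLpNorm (𝓕⁻ g) (ENNReal.ofReal p) volume

theorem IsMult.integrable {p : ℝ} {C : ℝ≥0∞} {m : E → ℂ} (hm : IsMult p C m) {g : E → ℂ}
    (hg : Integrable g) : Integrable fun ξ => m ξ * g ξ := by
  obtain ⟨K, hK⟩ := hm.bdd
  exact hg.bdd_mul hm.meas (Eventually.of_forall hK)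

theorem IsMult.mono {p : ℝ} {C C' : ℝ≥0∞} {m : E → ℂ} (hm : IsMult p C m) (h : C ≤ C') :
    IsMult p C' m :=
  ⟨hm.meas, hm.bdd, fun g hg => (hm.bound g hg).trans (mul_le_mul_left h _)⟩

theorem IsMult.mul {p : ℝ} {C C' : ℝ≥0∞} {m m' : E → ℂ} (hm : IsMult p C m)
    (hm' : IsMult p C' m') : IsMult p (C * C') (fun ξ => m ξ * m' ξ) := by
  refine ⟨hm.meas.mul hm'.meas, ?_, fun g hg => ?_⟩
  · obtain ⟨K, hK⟩ := hm.bdd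
    obtain ⟨K', hK'⟩ := hm'.bdd
    refine ⟨K * K', fun ξ => ?_⟩
    rw [norm_mul]
    exact mul_le_mul (hK ξ) (hK' ξ) (norm_nonneg _) ((norm_nonneg _).trans (hK ξ))
  · have h1 := hm.bound _ (hm'.integrable hg)
    have h2 := mul_le_mul_right (hm'.bound g hg) C
    simp_rw [mul_assoc] at h1 h2 ⊢
    exact h1.trans h2

theorem isMult_const (p : ℝ) (c : ℂ) : IsMult p ‖c‖ₑ (fun _ : E => c) := by
  refine ⟨aestronglyMeasurable_const, ⟨‖c‖, fun _ => le_rfl⟩, fun g hg => ?_⟩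
  have : 𝓕⁻ (fun ξ => c * g ξ) = c • 𝓕⁻ g := by
    funext x
    simp only [Real.fourierInv_eq', Pi.smul_apply, smul_eq_mul]
    rw [← integral_const_mul]
    congr 1; funext v; ring
  rw [this, eLpNorm_const_smul]

theorem fourierInv_add_apply {f g : E → ℂ} (hf : Integrable f) (hg : Integrable g) (x : E) :
    𝓕⁻ (fun ξ => f ξ + g ξ) x = 𝓕⁻ f x + 𝓕⁻ g x := by
  have key : ∀ h : E → ℂ, Integrable h → Integrable fun v : E =>
      Complex.exp (↑(2 * Real.pi * inner ℝ v x) * Complex.I) • h v := by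
    intro h hh
    refine Integrable.bdd_mul (c := 1) hh (Continuous.aestronglyMeasurable (by fun_prop)) ?_
    filter_upwards with z
    rw [Complex.norm_exp_ofReal_mul_I]
  rw [Real.fourierInv_eq', Real.fourierInv_eq', Real.fourierInv_eq',
    ← integral_add (key f hf) (key g hg)]
  simp_rw [smul_add]

theorem IsMult.add {p : ℝ} (hp : 1 ≤ p) {C C' : ℝ≥0∞} {m m' : E → ℂ} (hm : IsMult p C m)
    (hm' : IsMult p C' m') : IsMult p (C + C') (fun ξ => m ξ + m' ξ) := by
  refine ⟨hm.meas.add hm'.meas, ?_, fun g hg => ?_⟩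
  · obtain ⟨K, hK⟩ := hm.bdd
    obtain ⟨K', hK'⟩ := hm'.bdd
    exact ⟨K + K', fun ξ => (norm_add_le _ _).trans (add_le_add (hK ξ) (hK' ξ))⟩
  · have e : 𝓕⁻ (fun ξ => (m ξ + m' ξ) * g ξ) =
        𝓕⁻ (fun ξ => m ξ * g ξ) + 𝓕⁻ (fun ξ => m' ξ * g ξ) := by
      funext x
      rw [Pi.add_apply, ← fourierInv_add_apply (hm.integrable hg) (hm'.integrable hg)]
      simp_rw [add_mul]
    rw [e, add_mul]
    refine (eLpNorm_add_le (continuous_fourierInv (hm.integrable hg)).aestronglyMeasurable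
      (continuous_fourierInv (hm'.integrable hg)).aestronglyMeasurable ?_).trans
      (add_le_add (hm.bound g hg) (hm'.bound g hg))
    rw [← ENNReal.ofReal_one]; exact ENNReal.ofReal_le_ofReal hp

theorem isMult_prod {ι : Type*} (s : Finset ι) {p : ℝ} {C : ι → ℝ≥0∞} {m : ι → E → ℂ}
    (hm : ∀ i ∈ s, IsMult p (C i) (m i)) :
    IsMult p (∏ i ∈ s, C i) (fun ξ => ∏ i ∈ s, m i ξ) := by
  classical
  induction s using Finset.induction_on with
  | empty =>
    have := isMult_const (E := E) p (1 : ℂ)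
    simpa using this
  | insert a s ha ih =>
    have := (hm a (Finset.mem_insert_self a s)).mul
      (ih fun i hi => hm i (Finset.mem_insert_of_mem hi))
    simpa only [Finset.prod_insert ha] using this

theorem isMult_fourier {p : ℝ} (hp : 1 ≤ p) {k : E → ℂ} (hk : Integrable k) :
    IsMult p (eLpNorm k 1 volume) (𝓕 k) := by
  refine ⟨(VectorFourier.fourierIntegral_continuous Real.continuous_fourierChar
    continuous_inner hk).aestronglyMeasurable, ⟨∫ v, ‖k v‖, fun ξ =>
    VectorFourier.norm_fourierIntegral_le_integral_norm _ _ _ k ξ⟩, fun g hg => ?_⟩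
  rw [← cv_fourierInv_right hk hg]
  exact eLpNorm_cv_le_one hk.1 (continuous_fourierInv hg).aestronglyMeasurable hp

/-- Dominated convergence gives pointwise convergence of the images, and Fatou's lemma passes the
uniform bound to the limit. This reaches discontinuous symbols such as the sign, which are not
Fourier transforms of integrable kernels. -/
theorem isMult_of_tendsto {p : ℝ} {C : ℝ≥0∞} {m : ℕ → E → ℂ} {m' : E → ℂ}
    (hm : ∀ n, IsMult p C (m n)) {K : ℝ} (hK : ∀ n ξ, ‖m n ξ‖ ≤ K)
    (hlim : ∀ ξ, Tendsto (fun n => m n ξ) atTop (𝓝 (m' ξ))) : IsMult p C m' := by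
  refine ⟨aestronglyMeasurable_of_tendsto_ae _ (fun n => (hm n).meas) (Eventually.of_forall hlim),
    ⟨K, fun ξ => le_of_tendsto (hlim ξ).norm (Eventually.of_forall fun n => hK n ξ)⟩,
    fun g hg => ?_⟩
  have hl : ∀ x, Tendsto (fun n => 𝓕⁻ (fun ξ => m n ξ * g ξ) x) atTop
      (𝓝 (𝓕⁻ (fun ξ => m' ξ * g ξ) x)) := by
    intro x
    simp_rw [Real.fourierInv_eq']
    refine tendsto_integral_of_dominated_convergence (fun ξ => K * ‖g ξ‖) (fun n => ?_)
      (hg.norm.const_mul K) (fun n => Eventually.of_forall fun ξ => ?_)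
      (Eventually.of_forall fun ξ => ?_)
    · have hc : Continuous fun v : E => Complex.exp (↑(2 * Real.pi * inner ℝ v x) * Complex.I) := by
        fun_prop
      exact hc.aestronglyMeasurable.smul ((hm n).meas.mul hg.1)
    · rw [norm_smul, Complex.norm_exp_ofReal_mul_I, one_mul, norm_mul]
      exact mul_le_mul_of_nonneg_right (hK n ξ) (norm_nonneg _)
    · exact ((hlim ξ).mul_const _).const_smul _
  refine (Lp.eLpNorm_lim_le_liminf_eLpNorm (fun n =>
    (continuous_fourierInv ((hm n).integrable hg)).aestronglyMeasurable) _
    (Eventually.of_forall hl)).trans ?_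
  exact liminf_le_of_le (by isBoundedDefault) fun b hb => by
    obtain ⟨n, hn⟩ := hb.exists
    exact hn.trans ((hm n).bound g hg)

end Multiplier

/-! ### Multipliers acting in one variable. -/

section Coordinate

variable {d : ℕ}

theorem fourierInv_coord {κ : ℝ → ℂ} (hκ : Integrable κ) (i : Fin d) {g : Space d → ℂ}
    (hg : Integrable g) (x : Space d) :
    𝓕⁻ (fun ξ => 𝓕 κ (ξ i) * g ξ) x =
      ∫ s : ℝ, κ s * 𝓕⁻ g (x - s • EuclideanSpace.single i (1 : ℝ)) := by
  have hint : Integrable (fun z : ℝ × Space d =>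
      Complex.exp (↑(2 * Real.pi * inner ℝ z.2 (x - z.1 • EuclideanSpace.single i (1 : ℝ))) *
        Complex.I) * (κ z.1 * g z.2)) (volume.prod volume) := by
    refine Integrable.bdd_mul (c := 1) (hκ.mul_prod hg) (Continuous.aestronglyMeasurable
      (by fun_prop)) ?_
    filter_upwards with z
    rw [Complex.norm_exp_ofReal_mul_I]
  have h1 : ∫ s : ℝ, κ s * 𝓕⁻ g (x - s • EuclideanSpace.single i (1 : ℝ)) =
      ∫ s : ℝ, ∫ ξ : Space d, Complex.exp (↑(2 * Real.pi *
        inner ℝ ξ (x - s • EuclideanSpace.single i (1 : ℝ))) * Complex.I) * (κ s * g ξ) := by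
    refine integral_congr_ae (Eventually.of_forall fun s => ?_)
    beta_reduce
    rw [Real.fourierInv_eq', ← integral_const_mul]
    refine integral_congr_ae (Eventually.of_forall fun v => ?_)
    simp only [smul_eq_mul]; ring
  rw [h1, integral_integral_swap hint, Real.fourierInv_eq']
  refine integral_congr_ae (Eventually.of_forall fun ξ => ?_)
  simp only [smul_eq_mul]
  rw [Real.fourier_eq', ← mul_assoc, mul_right_comm, ← integral_const_mul]
  refine integral_congr_ae (Eventually.of_forall fun s => ?_)
  simp only [smul_eq_mul]
  have e : Complex.exp (↑(2 * Real.pi * inner ℝ ξ (x - s • EuclideanSpace.single i (1 : ℝ))) *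
      Complex.I) = Complex.exp (↑(2 * Real.pi * inner ℝ ξ x) * Complex.I) *
        Complex.exp (↑(-2 * Real.pi * inner ℝ s (ξ i)) * Complex.I) := by
    rw [← Complex.exp_add, ← add_mul, ← Complex.ofReal_add]
    congr 3
    rw [inner_sub_right, inner_smul_right, EuclideanSpace.inner_single_right]
    simp
    ring
  rw [e]
  ring

theorem rpow_one_div_le_mul_iff {p : ℝ} (hp : 0 < p) {A B C : ℝ≥0∞} :
    A ^ (1 / p) ≤ C * B ^ (1 / p) ↔ A ≤ C ^ p * B := by
  rw [← ENNReal.rpow_le_rpow_iff hp, ENNReal.mul_rpow_of_nonneg _ _ hp.le, ← ENNReal.rpow_mul,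
    ← ENNReal.rpow_mul, one_div_mul_cancel hp.ne', ENNReal.rpow_one, ENNReal.rpow_one]

/-- A convolution operator bounded on `L^p(ℝ)` gives a multiplier on `ℝ^d` acting in one
variable. -/
theorem isMult_coord {p : ℝ} (hp : 1 ≤ p) {κ : ℝ → ℂ} (hκ : Integrable κ) {C : ℝ≥0∞}
    (hC : ∀ f : ℝ → ℂ, Continuous f → eLpNorm (cv κ f) (ENNReal.ofReal p) volume ≤
      C * eLpNorm f (ENNReal.ofReal p) volume) (i : Fin d) :
    IsMult p C (fun ξ : Space d => 𝓕 κ (ξ i)) := by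
  have hp0 : 0 < p := by linarith
  have hcont : Continuous (𝓕 κ) := VectorFourier.fourierIntegral_continuous
    Real.continuous_fourierChar continuous_inner hκ
  have hcont2 : Continuous (fun ξ : Space d => 𝓕 κ (ξ i)) := hcont.comp (by fun_prop)
  have hb : ∀ ξ : Space d, ‖𝓕 κ (ξ i)‖ ≤ ∫ v, ‖κ v‖ := fun ξ =>
    VectorFourier.norm_fourierIntegral_le_integral_norm _ _ _ κ (ξ i)
  refine ⟨hcont2.aestronglyMeasurable, ⟨_, hb⟩, fun g hg => ?_⟩
  have hmg : Integrable fun ξ : Space d => 𝓕 κ (ξ i) * g ξ :=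
    hg.bdd_mul hcont2.aestronglyMeasurable (Eventually.of_forall hb)
  set f := 𝓕⁻ g with hf
  set h := 𝓕⁻ (fun ξ : Space d => 𝓕 κ (ξ i) * g ξ) with hh
  have hfc : Continuous f := continuous_fourierInv hg
  have hhc : Continuous h := continuous_fourierInv hmg
  have mp := EuclideanSpace.volume_preserving_symm_measurableEquiv_toLp (Fin d)
  have mp' : MeasurePreserving (fun x : Fin d → ℝ => (WithLp.toLp 2 x : Space d)) volume volume :=
    mp.symm
  have hto : Continuous (fun x : Fin d → ℝ => (WithLp.toLp 2 x : Space d)) := by fun_prop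
  have etr : ∀ F : Space d → ℝ≥0∞, Measurable F →
      ∫⁻ x, F x = ∫⁻ x : Fin d → ℝ, F (WithLp.toLp 2 x) := fun F hF =>
    (mp'.lintegral_comp hF).symm
  have main : ∫⁻ x, ‖h x‖ₑ ^ p ≤ ∫⁻ x, C ^ p * ‖f x‖ₑ ^ p := by
    have mh : Measurable fun x => ‖h x‖ₑ ^ p := hhc.enorm.measurable.pow_const p
    have mf : Measurable fun x => C ^ p * ‖f x‖ₑ ^ p :=
      (hfc.enorm.measurable.pow_const p).const_mul _
    rw [etr _ mh, etr _ mf]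
    -- It is enough to compare integrals along each line in direction i and then integrate in the
    -- other variables. The restriction of f to a single line may have infinite norm, which is why
    -- `hC` is required for all continuous functions.
    refine lintegral_le_of_lmarginal_le (μ := fun _ => volume) {i} (mh.comp hto.measurable)
      (mf.comp hto.measurable) ?_
    intro x
    rw [lmarginal_singleton, lmarginal_singleton]
    set fx : ℝ → ℂ := fun s => f (WithLp.toLp 2 (Function.update x i s)) with hfx
    have hfxc : Continuous fx := hfc.comp (hto.comp (continuous_const.update i continuous_id))
    have e1 : ∀ s, h (WithLp.toLp 2 (Function.update x i s)) = cv κ fx s := by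
      intro s
      have e2 : cv κ fx s = ∫ r, κ r * fx (s - r) := by
        rw [cv, ← integral_sub_left_eq_self (fun y => κ (s - y) * fx y) volume s]
        simp only [sub_sub_cancel]
      rw [hh, fourierInv_coord hκ i hg, e2]
      refine integral_congr_ae (Eventually.of_forall fun r => ?_)
      have e3 : (WithLp.toLp 2 (Function.update x i s) : Space d) -
          r • EuclideanSpace.single i (1 : ℝ) = WithLp.toLp 2 (Function.update x i (s - r)) := by
        ext j
        by_cases hj : j = i
        · subst hj; simp
        · simp [hj]
      simp only [hfx, hf, e3]
    simp_rw [e1]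
    have := hC fx hfxc
    rw [eLpNorm_ofReal hp0, eLpNorm_ofReal hp0, rpow_one_div_le_mul_iff hp0] at this
    rw [lintegral_const_mul _ (hfxc.enorm.measurable.pow_const p)]
    exact this
  rw [lintegral_const_mul _ (hfc.enorm.measurable.pow_const p)] at main
  rw [eLpNorm_ofReal hp0, eLpNorm_ofReal hp0, rpow_one_div_le_mul_iff hp0]
  exact main

end Coordinate

/-! ### The one-dimensional symbols e^{-2πy|ξ|} and sign. -/

section ExponentialSymbols

/-- Treats at once the symbol of the Poisson kernel (α = β = 1) and its product with the sign (α =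
1, β = −1). The value at 0 is irrelevant. -/
theorem integrable_and_fourierInv_of_exp {y : ℝ} (hy : 0 < y) {f : ℝ → ℂ} {α β : ℂ}
    (hpos : ∀ ξ : ℝ, 0 < ξ → f ξ = α * Real.exp (-(2 * Real.pi * y * ξ)))
    (hneg : ∀ ξ : ℝ, ξ < 0 → f ξ = β * Real.exp (2 * Real.pi * y * ξ)) :
    Integrable f ∧ ∀ s : ℝ, 𝓕⁻ f s = α * (1 / (2 * Real.pi * (y - s * Complex.I))) +
      β * (1 / (2 * Real.pi * (y + s * Complex.I))) := by
  have hπ := Real.pi_pos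
  have key : ∀ s : ℝ, Integrable (fun v : ℝ =>
      Complex.exp (↑(2 * Real.pi * inner ℝ v s) * Complex.I) • f v) ∧
      ∫ v : ℝ, Complex.exp (↑(2 * Real.pi * inner ℝ v s) * Complex.I) • f v =
      α * (1 / (2 * Real.pi * (y - s * Complex.I))) +
      β * (1 / (2 * Real.pi * (y + s * Complex.I))) := by
    intro s
    set g : ℝ → ℂ := fun v => Complex.exp (↑(2 * Real.pi * inner ℝ v s) * Complex.I) • f v with hg
    set c1 : ℂ := -(2 * Real.pi * (y - s * Complex.I)) with hc1
    set c2 : ℂ := 2 * Real.pi * (y + s * Complex.I) with hc2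
    have hc1re : c1.re < 0 := by simp [hc1]; positivity
    have hc2re : 0 < c2.re := by simp [hc2]; positivity
    have e1 : Set.EqOn g (fun v : ℝ => α * Complex.exp (c1 * v)) (Set.Ioi 0) := by
      intro v hv
      simp only [hg, smul_eq_mul]
      rw [hpos v hv, Complex.ofReal_exp, mul_left_comm, ← Complex.exp_add]
      congr 2
      simp [hc1]; ring
    have e2 : Set.EqOn g (fun v : ℝ => β * Complex.exp (c2 * v)) (Set.Iio 0) := by
      intro v hv
      simp only [hg, smul_eq_mul]
      rw [hneg v hv, Complex.ofReal_exp, mul_left_comm, ← Complex.exp_add]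
      congr 2
      simp [hc2]; ring
    have i1 : IntegrableOn g (Set.Ioi 0) :=
      IntegrableOn.congr_fun (Integrable.const_mul (integrableOn_exp_mul_complex_Ioi hc1re 0) α)
        e1.symm measurableSet_Ioi
    have i2 : IntegrableOn g (Set.Iic 0) := by
      rw [integrableOn_Iic_iff_integrableOn_Iio]
      exact IntegrableOn.congr_fun (Integrable.const_mul ((integrableOn_exp_mul_complex_Iic hc2re
        0).mono_set Set.Iio_subset_Iic_self) β) e2.symm measurableSet_Iio
    have hgi : Integrable g := by
      rw [← integrableOn_univ, ← Set.Iic_union_Ioi (a := (0 : ℝ))]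
      exact i2.union i1
    refine ⟨hgi, ?_⟩
    rw [← intervalIntegral.integral_Iic_add_Ioi i2 i1, integral_Iic_eq_integral_Iio,
      setIntegral_congr_fun measurableSet_Ioi e1, setIntegral_congr_fun measurableSet_Iio e2,
      integral_const_mul, integral_const_mul, integral_exp_mul_complex_Ioi hc1re,
      ← integral_Iic_eq_integral_Iio, integral_exp_mul_complex_Iic hc2re]
    simp only [Complex.ofReal_zero, mul_zero, Complex.exp_zero]
    rw [hc1, neg_div_neg_eq, add_comm]
  refine ⟨?_, fun s => ?_⟩
  · simpa using (key 0).1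
  · rw [Real.fourierInv_eq']; exact (key s).2

theorem integrable_poisson_complex {y : ℝ} (hy : 0 < y) :
    Integrable (fun s : ℝ => (poisson y s : ℂ)) := (integrable_poisson hy).ofReal

/-- The symbol `e^{-2πy|ξ|}` of the Poisson kernel. -/
def expSymbol (y ξ : ℝ) : ℂ := Real.exp (-(2 * Real.pi * y * |ξ|))

theorem continuous_expSymbol (y : ℝ) : Continuous (expSymbol y) := by
  unfold expSymbol
  fun_prop

theorem expSymbol_facts {y : ℝ} (hy : 0 < y) : Integrable (expSymbol y) ∧
    ∀ s, 𝓕⁻ (expSymbol y) s = poisson y s := by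
  obtain ⟨h1, h2⟩ := integrable_and_fourierInv_of_exp hy (f := expSymbol y) (α := 1) (β := 1)
    (fun ξ h => by simp [expSymbol, abs_of_pos h]) (fun ξ h => by simp [expSymbol, abs_of_neg h])
  refine ⟨h1, fun s => ?_⟩
  rw [h2 s]
  have a1 : (y : ℂ) - s * Complex.I ≠ 0 := fun h => by
    have := congrArg Complex.re h; simp at this; linarith
  have a2 : (y : ℂ) + s * Complex.I ≠ 0 := fun h => by
    have := congrArg Complex.re h; simp at this; linarith
  have a3 : (s : ℂ) ^ 2 + (y : ℂ) ^ 2 ≠ 0 := by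
    have : s ^ 2 + y ^ 2 ≠ 0 := by positivity
    exact_mod_cast this
  have hπ : (Real.pi : ℂ) ≠ 0 := by exact_mod_cast Real.pi_ne_zero
  unfold poisson
  push_cast
  field_simp
  linear_combination (2 * (y : ℂ) * s ^ 2) * Complex.I_sq

theorem fourier_poisson {y : ℝ} (hy : 0 < y) : 𝓕 (fun s => (poisson y s : ℂ)) = expSymbol y := by
  have h : (fun s => (poisson y s : ℂ)) = 𝓕⁻ (expSymbol y) :=
    funext fun s => ((expSymbol_facts hy).2 s).symm
  rw [h]
  refine (continuous_expSymbol y).fourier_fourierInv_eq (expSymbol_facts hy).1 ?_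
  have : 𝓕 (expSymbol y) = fun s => (poisson y (-s) : ℂ) := by
    funext s
    rw [← (expSymbol_facts hy).2, Real.fourierInv_eq_fourier_neg, neg_neg]
  rw [this]
  exact (integrable_poisson_complex hy).comp_neg

/-- The symbol of the truncated Hilbert transform. -/
def signSymbol (y Y ξ : ℝ) : ℂ := Real.sign ξ * (expSymbol y ξ - expSymbol Y ξ)

theorem continuous_signSymbol (y Y : ℝ) : Continuous (signSymbol y Y) := by
  have h : signSymbol y Y = fun ξ : ℝ => if 0 ≤ ξ then (expSymbol y ξ - expSymbol Y ξ)
      else -(expSymbol y ξ - expSymbol Y ξ) := by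
    funext ξ
    unfold signSymbol
    rcases lt_trichotomy ξ 0 with h | h | h
    · rw [Real.sign_of_neg h, if_neg (not_le.2 h)]; simp
    · subst h; simp [expSymbol]
    · rw [Real.sign_of_pos h, if_pos h.le]; simp
  rw [h]
  have hc : Continuous fun ξ => expSymbol y ξ - expSymbol Y ξ :=
    (continuous_expSymbol y).sub (continuous_expSymbol Y)
  refine Continuous.if_le hc hc.neg continuous_const continuous_id fun ξ hξ => ?_
  rw [← hξ]; simp [expSymbol]

theorem signSymbol_facts {y Y : ℝ} (hy : 0 < y) (hY : 0 < Y) : Integrable (signSymbol y Y) ∧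
    ∀ s, 𝓕⁻ (signSymbol y Y) s = Complex.I * hilbertKernel y Y s := by
  have one : ∀ y : ℝ, 0 < y → Integrable (fun ξ : ℝ => (Real.sign ξ : ℂ) * expSymbol y ξ) ∧
      ∀ s, 𝓕⁻ (fun ξ : ℝ => (Real.sign ξ : ℂ) * expSymbol y ξ) s =
        Complex.I * conjPoisson y s := by
    intro y hy
    obtain ⟨h1, h2⟩ := integrable_and_fourierInv_of_exp hy
      (f := fun ξ : ℝ => (Real.sign ξ : ℂ) * expSymbol y ξ) (α := 1) (β := -1)
      (fun ξ h => by simp [expSymbol, abs_of_pos h, Real.sign_of_pos h])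
      (fun ξ h => by simp [expSymbol, abs_of_neg h, Real.sign_of_neg h])
    refine ⟨h1, fun s => ?_⟩
    rw [h2 s]
    have a1 : (y : ℂ) - s * Complex.I ≠ 0 := fun h => by
      have := congrArg Complex.re h; simp at this; linarith
    have a2 : (y : ℂ) + s * Complex.I ≠ 0 := fun h => by
      have := congrArg Complex.re h; simp at this; linarith
    have a3 : (s : ℂ) ^ 2 + (y : ℂ) ^ 2 ≠ 0 := by
      have : s ^ 2 + y ^ 2 ≠ 0 := by positivity
      exact_mod_cast this
    have hπ : (Real.pi : ℂ) ≠ 0 := by exact_mod_cast Real.pi_ne_zero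
    unfold conjPoisson
    push_cast
    field_simp
    linear_combination (2 * (s : ℂ) ^ 3 * Complex.I) * Complex.I_sq
  obtain ⟨i1, f1⟩ := one y hy
  obtain ⟨i2, f2⟩ := one Y hY
  have e : signSymbol y Y = fun ξ : ℝ => (Real.sign ξ : ℂ) * expSymbol y ξ +
      (-1 : ℂ) * ((Real.sign ξ : ℂ) * expSymbol Y ξ) := by
    funext ξ; unfold signSymbol; ring
  rw [e]
  refine ⟨i1.add (i2.const_mul _), fun s => ?_⟩
  rw [fourierInv_add_apply i1 (i2.const_mul _), f1]
  have : 𝓕⁻ (fun ξ : ℝ => (-1 : ℂ) * ((Real.sign ξ : ℂ) * expSymbol Y ξ)) s =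
      -1 * (Complex.I * conjPoisson Y s) := by
    rw [← f2 s, Real.fourierInv_eq', Real.fourierInv_eq', ← integral_const_mul]
    congr 1; funext v; simp only [smul_eq_mul]; ring
  rw [this]
  unfold hilbertKernel
  push_cast; ring

theorem fourier_hilbertKernel {y Y : ℝ} (hy : 0 < y) (hY : 0 < Y) :
    𝓕 (fun s => Complex.I * hilbertKernel y Y s) = signSymbol y Y := by
  have h : (fun s => Complex.I * hilbertKernel y Y s) = 𝓕⁻ (signSymbol y Y) :=
    funext fun s => ((signSymbol_facts hy hY).2 s).symm
  rw [h]
  refine (continuous_signSymbol y Y).fourier_fourierInv_eq (signSymbol_facts hy hY).1 ?_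
  have : 𝓕 (signSymbol y Y) = fun s => Complex.I * hilbertKernel y Y (-s) := by
    funext s
    rw [← (signSymbol_facts hy hY).2, Real.fourierInv_eq_fourier_neg, neg_neg]
  rw [this]
  exact ((integrable_hilbertKernel hy hY).const_mul Complex.I).comp_neg

variable {d : ℕ}

theorem norm_expSymbol_le {y : ℝ} (hy : 0 ≤ y) (ξ : ℝ) : ‖expSymbol y ξ‖ ≤ 1 := by
  unfold expSymbol
  rw [Complex.norm_real, Real.norm_of_nonneg (Real.exp_pos _).le, Real.exp_le_one_iff]
  have := Real.pi_pos
  have : 0 ≤ 2 * Real.pi * y * |ξ| := by positivity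
  linarith

theorem isMult_expSymbol {p : ℝ} (hp : 1 ≤ p) {y : ℝ} (hy : 0 < y) (i : Fin d) :
    IsMult p 1 (fun ξ : Space d => expSymbol y (ξ i)) := by
  have := isMult_coord (d := d) hp (κ := fun s => (poisson y s : ℂ)) (integrable_poisson_complex hy)
    (C := 1) (fun f hf => by
      have := eLpNorm_cv_le_one (integrable_poisson_complex hy).1 hf.aestronglyMeasurable hp
      rwa [eLpNorm_poisson hy] at this) i
  rwa [fourier_poisson hy] at this

/-- The sign is the pointwise limit of sign(ξ)(e^{-2πy|ξ|} − e^{-2πY|ξ|}) as y → 0 and Y → ∞. These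
are the symbols of truncated Hilbert transforms up to a factor i, so Riesz' theorem bounds them
uniformly. -/
theorem exists_isMult_sign {p : ℝ} (hp : 1 < p) : ∃ C : ℝ≥0∞, C ≠ ⊤ ∧ ∀ (d : ℕ) (i : Fin d),
    IsMult p C (fun ξ : Space d => (Real.sign (ξ i) : ℂ)) := by
  obtain ⟨C, hC, h⟩ := exists_eLpNorm_hilbertKernel_le hp
  -- A nonzero constant makes the bound trivially true for functions of infinite norm.
  refine ⟨C + 1, by finiteness, fun d i => ?_⟩
  have hn : ∀ n : ℕ, (0 : ℝ) < 1 / ((n : ℝ) + 1) := fun n => by positivity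
  have hN : ∀ n : ℕ, (0 : ℝ) < (n : ℝ) + 1 := fun n => by positivity
  refine isMult_of_tendsto (m := fun n ξ => signSymbol (1 / ((n : ℝ) + 1)) ((n : ℝ) + 1) (ξ i))
    (K := 2) (fun n => ?_) (fun n ξ => ?_) (fun ξ => ?_)
  · have hi := (integrable_hilbertKernel (hn n) (hN n)).const_mul Complex.I
    have := isMult_coord (d := d) hp.le hi (C := C + 1) (fun f hf => by
      have e : cv (fun s => Complex.I * hilbertKernel (1 / ((n : ℝ) + 1)) ((n : ℝ) + 1) s) f =
          Complex.I • cv (hilbertKernel (1 / ((n : ℝ) + 1)) ((n : ℝ) + 1)) f := by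
        funext x
        simp only [cv, Pi.smul_apply, smul_eq_mul, ← integral_const_mul, mul_assoc]
      have hI : ‖Complex.I‖ₑ = 1 := by rw [← ofReal_norm]; simp
      rw [e, eLpNorm_const_smul, hI, one_mul]
      by_cases hfL : MemLp f (ENNReal.ofReal p) volume
      · exact (h _ _ (hn n) (hN n) f hfL).trans (mul_le_mul_left le_self_add _)
      · have : eLpNorm f (ENNReal.ofReal p) volume = ⊤ := by
          by_contra hne
          exact hfL ⟨hf.aestronglyMeasurable, lt_top_iff_ne_top.2 hne⟩
        rw [this, ENNReal.mul_top (by simp)]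
        exact le_top) i
    rwa [fourier_hilbertKernel (hn n) (hN n)] at this
  · unfold signSymbol
    rw [norm_mul]
    have h1 : ‖(Real.sign (ξ i) : ℂ)‖ ≤ 1 := by
      rw [Complex.norm_real]
      rcases Real.sign_apply_eq (ξ i) with h | h | h <;> rw [h] <;> simp
    have h2 := norm_sub_le (expSymbol (1 / ((n : ℝ) + 1)) (ξ i)) (expSymbol ((n : ℝ) + 1) (ξ i))
    have h3 := norm_expSymbol_le (hn n).le (ξ i)
    have h4 := norm_expSymbol_le (hN n).le (ξ i)
    nlinarith [norm_nonneg (Real.sign (ξ i) : ℂ),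
      norm_nonneg (expSymbol (1 / ((n : ℝ) + 1)) (ξ i) - expSymbol ((n : ℝ) + 1) (ξ i))]
  · unfold signSymbol
    rcases eq_or_ne (ξ i) 0 with h0 | h0
    · simp [h0]
    have habs : 0 < |ξ i| := abs_pos.2 h0
    have t1 : Tendsto (fun n : ℕ => expSymbol (1 / ((n : ℝ) + 1)) (ξ i)) atTop (𝓝 1) := by
      unfold expSymbol
      have : Tendsto (fun n : ℕ => -(2 * Real.pi * (1 / ((n : ℝ) + 1)) * |ξ i|)) atTop (𝓝 0) := by
        have := ((tendsto_one_div_add_atTop_nhds_zero_nat (𝕜 := ℝ)).const_mul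
          (2 * Real.pi)).mul_const (|ξ i|)
        simpa using this.neg
      have := (Real.continuous_exp.tendsto 0).comp this
      rw [Real.exp_zero] at this
      exact_mod_cast (Complex.continuous_ofReal.tendsto 1).comp this
    have t2 : Tendsto (fun n : ℕ => expSymbol ((n : ℝ) + 1) (ξ i)) atTop (𝓝 0) := by
      unfold expSymbol
      have : Tendsto (fun n : ℕ => 2 * Real.pi * ((n : ℝ) + 1) * |ξ i|) atTop atTop := by
        refine Tendsto.atTop_mul_const habs (Tendsto.const_mul_atTop Real.two_pi_pos ?_)
        exact tendsto_atTop_add_const_right _ _ tendsto_natCast_atTop_atTop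
      have := Real.tendsto_exp_neg_atTop_nhds_zero.comp this
      exact_mod_cast (Complex.continuous_ofReal.tendsto 0).comp this
    simpa using (t1.sub t2).const_mul (Real.sign (ξ i) : ℂ)

end ExponentialSymbols

/-! ### Orthant projections, imaginary translations, and the kernel of e^{-aΛ₁}. -/

section Symbols

variable {d : ℕ}

/-- The sign attached to a Boolean. -/
def boolSign (b : Bool) : ℝ := if b then 1 else -1

/-- The projection onto the orthant with signs `ε`. -/
def proj (ε : Fin d → Bool) (ξ : Space d) : ℂ :=
  ∏ i, ((1 + boolSign (ε i) * Real.sign (ξ i)) / 2 : ℂ)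

/-- The symbol of the translation by `-i a ε`. -/
def growth (a : ℝ) (ε : Fin d → Bool) (ξ : Space d) : ℂ :=
  Real.exp (2 * Real.pi * a * ∑ i, boolSign (ε i) * ξ i)

/-- The symbol `e^{-a|ξ|₁}`, in Mathlib's normalization. -/
def decay (a : ℝ) (ξ : Space d) : ℂ := Real.exp (-(a * ∑ i, |2 * Real.pi * ξ i|))

/-- The symbol of `e^{-aΛ₁}` followed by the translation by `-i a ε`. -/
def shift (a : ℝ) (ε : Fin d → Bool) (ξ : Space d) : ℂ := growth a ε ξ * decay a ξ

theorem abs_boolSign (b : Bool) : |boolSign b| = 1 := by cases b <;> simp [boolSign]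

/-- Expand the product over coordinates of (1 + s)/2 + (1 − s)/2 = 1. On coordinate hyperplanes both
halves equal 1/2, so the identity holds everywhere and not just almost everywhere. -/
theorem sum_proj (ξ : Space d) : ∑ ε : Fin d → Bool, proj ε ξ = 1 := by
  unfold proj
  have := Finset.prod_univ_sum (fun _ : Fin d => (Finset.univ : Finset Bool))
    (fun i b => ((1 + boolSign b * Real.sign (ξ i)) / 2 : ℂ))
  rw [Fintype.piFinset_univ] at this
  rw [← this]
  refine Finset.prod_eq_one fun i _ => ?_
  simp [boolSign]
  ring

/-- The point of splitting into orthants: unlike e^{a|ξ|₁}, the exponential of a linear form is a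
character and passes through a convolution of spectra. -/
theorem growth_add (a : ℝ) (ε : Fin d → Bool) (ξ η : Space d) :
    growth a ε (ξ + η) = growth a ε ξ * growth a ε η := by
  unfold growth
  rw [← Complex.ofReal_mul, ← Real.exp_add, ← mul_add, ← Finset.sum_add_distrib]
  simp only [PiLp.add_apply, mul_add]

/-- Where the projection does not vanish, each ξ_i is zero or has the sign ε_i. There ε·ξ = |ξ|₁,
and the growth factor is exactly the inverse of the decay. -/
theorem decay_mul_proj_mul_growth (a : ℝ) (ε : Fin d → Bool) (ξ : Space d) :
    decay a ξ * (proj ε ξ * growth a ε ξ) = proj ε ξ := by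
  by_cases h : ∀ i, boolSign (ε i) * ξ i = |ξ i|
  · have : decay a ξ * growth a ε ξ = 1 := by
      unfold decay growth
      rw [← Complex.ofReal_mul, ← Real.exp_add]
      have : -(a * ∑ i, |2 * Real.pi * ξ i|) + 2 * Real.pi * a * ∑ i, boolSign (ε i) * ξ i = 0 := by
        have e : ∀ i, |2 * Real.pi * ξ i| = 2 * Real.pi * |ξ i| := fun i => by
          rw [abs_mul, abs_of_pos Real.two_pi_pos]
        simp_rw [h, e, ← Finset.mul_sum]
        ring
      rw [this, Real.exp_zero, Complex.ofReal_one]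
    linear_combination proj ε ξ * this
  · push Not at h
    obtain ⟨i, hi⟩ := h
    have : proj ε ξ = 0 := by
      unfold proj
      refine Finset.prod_eq_zero (Finset.mem_univ i) ?_
      unfold boolSign at hi ⊢
      rcases lt_trichotomy (ξ i) 0 with h | h | h
      · rw [Real.sign_of_neg h]
        cases hε : ε i
        · rw [hε] at hi; simp [abs_of_neg h] at hi
        · simp
      · simp [h] at hi
      · rw [Real.sign_of_pos h]
        cases hε : ε i
        · simp
        · rw [hε] at hi; simp [abs_of_pos h] at hi
    rw [this]; ring

theorem continuous_decay (a : ℝ) : Continuous (decay a : Space d → ℂ) := by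
  unfold decay; fun_prop

theorem continuous_growth (a : ℝ) (ε : Fin d → Bool) : Continuous (growth a ε) := by
  unfold growth; fun_prop

theorem continuous_shift_uncurry (ε : Fin d → Bool) :
    Continuous fun z : ℝ × Space d => shift z.1 ε z.2 := by
  unfold shift decay growth; fun_prop

theorem continuous_shift (a : ℝ) (ε : Fin d → Bool) : Continuous (shift a ε) :=
  (continuous_growth a ε).mul (continuous_decay a)

theorem exists_isMult_proj {p : ℝ} (hp : 1 < p) (d : ℕ) : ∃ C : ℝ≥0∞, C ≠ ⊤ ∧
    ∀ ε : Fin d → Bool, IsMult p C (proj ε) := by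
  obtain ⟨C, hC, h⟩ := exists_isMult_sign hp
  refine ⟨∏ _i : Fin d, (1 + C), ENNReal.prod_ne_top fun _ _ => by finiteness, fun ε => ?_⟩
  refine isMult_prod Finset.univ fun i _ => ?_
  have h1 := (isMult_const (E := Space d) p (1 / 2)).add hp.le
    ((isMult_const (E := Space d) p (boolSign (ε i) / 2)).mul (h d i))
  have e : (fun ξ : Space d => ((1 + boolSign (ε i) * Real.sign (ξ i)) / 2 : ℂ)) =
      fun ξ => (1 / 2 : ℂ) + boolSign (ε i) / 2 * Real.sign (ξ i) := by
    funext ξ; ring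
  rw [e]
  refine h1.mono (add_le_add ?_ (mul_le_of_le_one_left' ?_))
  · rw [← ofReal_norm]; norm_num
  · rw [← ofReal_norm, norm_div, Complex.norm_real, Real.norm_eq_abs, abs_boolSign]; norm_num

/-- The symbol factors over coordinates: the i-th factor is 1 if ξ_i has the sign ε_i and
e^{-4πa|ξ_i|} if it has the opposite sign. It is thus a half-line projection plus the opposite one
times `expSymbol (2 * a)`, whose multiplier norm is at most 1 for every a; hence the uniformity in
a. -/
theorem exists_isMult_shift {p : ℝ} (hp : 1 < p) (d : ℕ) : ∃ C : ℝ≥0∞, C ≠ ⊤ ∧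
    ∀ (a : ℝ), 0 < a → ∀ ε : Fin d → Bool, IsMult p C (shift a ε) := by
  obtain ⟨C, hC, h⟩ := exists_isMult_sign hp
  refine ⟨∏ _i : Fin d, ((1 + C) + (1 + C)), ENNReal.prod_ne_top fun _ _ => by finiteness, fun a ha ε => ?_⟩
  have hhalf : ∀ (i : Fin d) (c : ℝ), |c| = 1 →
      IsMult p (1 + C) (fun ξ : Space d => ((1 + c * Real.sign (ξ i)) / 2 : ℂ)) := by
    intro i c hc
    have h1 := (isMult_const (E := Space d) p (1 / 2)).add hp.le
      ((isMult_const (E := Space d) p (c / 2)).mul (h d i))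
    have e : (fun ξ : Space d => ((1 + c * Real.sign (ξ i)) / 2 : ℂ)) =
        fun ξ => (1 / 2 : ℂ) + c / 2 * Real.sign (ξ i) := by
      funext ξ; ring
    rw [e]
    refine h1.mono (add_le_add ?_ (mul_le_of_le_one_left' ?_))
    · rw [← ofReal_norm]; norm_num
    · rw [← ofReal_norm, norm_div, Complex.norm_real, Real.norm_eq_abs, hc]; norm_num
  have e : shift a ε = fun ξ : Space d => ∏ i, (((1 + boolSign (ε i) * Real.sign (ξ i)) / 2 : ℂ) +
      ((1 + (-boolSign (ε i) : ℝ) * Real.sign (ξ i)) / 2 : ℂ) * expSymbol (2 * a) (ξ i)) := by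
    funext ξ
    unfold shift growth decay
    rw [← Complex.ofReal_mul, ← Real.exp_add, Finset.mul_sum, Finset.mul_sum,
      ← Finset.sum_neg_distrib, ← Finset.sum_add_distrib, Real.exp_sum, Complex.ofReal_prod]
    refine Finset.prod_congr rfl fun i _ => ?_
    unfold expSymbol
    rw [abs_mul, abs_of_pos Real.two_pi_pos]
    rcases lt_trichotomy (ξ i) 0 with h | h | h
    · rw [Real.sign_of_neg h, abs_of_neg h]
      cases ε i
      · rw [show 2 * Real.pi * a * (boolSign false * ξ i) + -(a * (2 * Real.pi * -ξ i)) = 0 by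
          simp only [boolSign]; norm_num; ring]
        simp [boolSign]
      · simp [boolSign]; congr 1; ring
    · simp [h]; ring
    · rw [Real.sign_of_pos h, abs_of_pos h]
      cases ε i
      · simp [boolSign]; congr 1; ring
      · rw [show 2 * Real.pi * a * (boolSign true * ξ i) + -(a * (2 * Real.pi * ξ i)) = 0 by
          simp only [boolSign, if_true]; ring]
        simp [boolSign]
  rw [e]
  refine isMult_prod Finset.univ fun i _ => ?_
  refine (hhalf i _ (abs_boolSign _)).add hp.le ?_
  have := (hhalf i (-boolSign (ε i)) (by rw [abs_neg, abs_boolSign])).mul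
    (isMult_expSymbol hp.le (by positivity : 0 < 2 * a) i)
  rwa [mul_one] at this

theorem decay_eq_prod (a : ℝ) (ξ : Space d) : decay a ξ = ∏ i, expSymbol a (ξ i) := by
  unfold decay expSymbol
  rw [Finset.mul_sum, ← Finset.sum_neg_distrib, Real.exp_sum, Complex.ofReal_prod]
  refine Finset.prod_congr rfl fun i _ => ?_
  rw [abs_mul, abs_of_pos Real.two_pi_pos]
  congr 3; ring

theorem isMult_decay {p : ℝ} (hp : 1 ≤ p) {a : ℝ} (ha : 0 < a) :
    IsMult p 1 (decay a : Space d → ℂ) := by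
  have := isMult_prod (E := Space d) Finset.univ (p := p) (C := fun _ => 1)
    (m := fun (i : Fin d) (ξ : Space d) => expSymbol a (ξ i))
    fun i _ => isMult_expSymbol hp ha i
  rw [Finset.prod_const_one] at this
  have e : (decay a : Space d → ℂ) = fun ξ => ∏ i, expSymbol a (ξ i) := funext (decay_eq_prod a)
  rwa [e]

theorem mp_toLp (d : ℕ) :
    MeasurePreserving (fun x : Fin d → ℝ => (WithLp.toLp 2 x : Space d)) volume volume :=
  (EuclideanSpace.volume_preserving_symm_measurableEquiv_toLp (Fin d)).symm

theorem measurableEmbedding_toLp (d : ℕ) :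
    MeasurableEmbedding (fun x : Fin d → ℝ => (WithLp.toLp 2 x : Space d)) :=
  (MeasurableEquiv.toLp 2 (Fin d → ℝ)).measurableEmbedding

/-- The symbol splits over the coordinates, so the kernel is a product of one-dimensional Poisson
kernels, bounded and integrable. -/
theorem kernel_eq {a : ℝ} (ha : 0 < a) (x : Space d) :
    kernel a x = ∏ i, (poisson a (x i) : ℂ) := by
  have h0 : kernel a x = 𝓕⁻ (decay a) x := rfl
  rw [h0, Real.fourierInv_eq', ← (mp_toLp d).integral_comp (measurableEmbedding_toLp d)]
  have : ∀ i, (poisson a (x i) : ℂ) = ∫ v : ℝ,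
      Complex.exp (↑(2 * Real.pi * inner ℝ v (x i)) * Complex.I) • expSymbol a v := fun i => by
    rw [← Real.fourierInv_eq', (expSymbol_facts ha).2]
  simp_rw [this]
  rw [← integral_fintype_prod_eq_prod
    (fun (i : Fin d) (v : ℝ) =>
      Complex.exp (↑(2 * Real.pi * inner ℝ v (x i)) * Complex.I) • expSymbol a v)]
  refine integral_congr_ae (Eventually.of_forall fun v => ?_)
  simp only [smul_eq_mul]
  rw [Finset.prod_mul_distrib, decay_eq_prod, ← Complex.exp_sum, ← Finset.sum_mul,
    PiLp.inner_apply, Finset.mul_sum, Complex.ofReal_sum]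

theorem integrable_kernel {a : ℝ} (ha : 0 < a) : Integrable (kernel a : Space d → ℂ) := by
  have e : (kernel a : Space d → ℂ) = fun x => ∏ i, (poisson a (x i) : ℂ) := funext (kernel_eq ha)
  rw [e, ← (mp_toLp d).integrable_comp_emb (measurableEmbedding_toLp d)]
  exact Integrable.fintype_prod (f := fun (_ : Fin d) (s : ℝ) => (poisson a s : ℂ))
    fun i => integrable_poisson_complex ha

theorem integrable_decay {a : ℝ} (ha : 0 < a) : Integrable (decay a : Space d → ℂ) := by
  have e : (decay a : Space d → ℂ) = fun x => ∏ i, expSymbol a (x i) := funext (decay_eq_prod a)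
  rw [e, ← (mp_toLp d).integrable_comp_emb (measurableEmbedding_toLp d)]
  exact Integrable.fintype_prod (f := fun (_ : Fin d) (s : ℝ) => expSymbol a s)
    fun i => (expSymbol_facts ha).1

theorem memLp_kernel {a : ℝ} (ha : 0 < a) {q : ℝ≥0∞} (hq : 1 ≤ q) :
    MemLp (kernel a : Space d → ℂ) q volume := by
  refine memLp_of_integrable_of_bound (integrable_kernel ha)
    (K := ∏ _i : Fin d, (1 / Real.pi * a⁻¹)) (fun x => ?_) q hq
  rw [kernel_eq ha, norm_prod]
  refine Finset.prod_le_prod (fun i _ => norm_nonneg _) fun i _ => ?_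
  rw [Complex.norm_real, Real.norm_of_nonneg (poisson_pos ha _).le]
  exact poisson_le ha _

theorem fourier_kernel {a : ℝ} (ha : 0 < a) : 𝓕 (kernel a : Space d → ℂ) = decay a := by
  refine (continuous_decay a).fourier_fourierInv_eq (integrable_decay ha) ?_
  have : 𝓕 (decay a : Space d → ℂ) = fun s => kernel a (-s) := by
    funext s
    change _ = 𝓕⁻ (decay a) (-s)
    rw [Real.fourierInv_eq_fourier_neg, neg_neg]
  rw [this]
  exact (integrable_kernel ha).comp_neg

end Symbols

/-! ### Dilated cut-offs and their scaling. -/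

section Cutoffs

variable {d : ℕ}

/-- The dilated cut-off `θ(2^{-j} ·)`, in Mathlib's normalization of the frequencies. -/
def dil (θ : Space d → ℝ) (j : ℤ) (ξ : Space d) : ℂ :=
  ((θ ((2 : ℝ) ^ (-j) • ((2 * Real.pi) • ξ)) : ℝ) : ℂ)

/-- Smooth compactly supported functions. -/
structure IsBump (θ : Space d → ℝ) : Prop where
  smooth : ContDiff ℝ ∞ θ
  compact : HasCompactSupport θ

theorem dil_hasCompactSupport {θ : Space d → ℝ} (hθ : IsBump θ) (j : ℤ) :
    HasCompactSupport (dil θ j) := by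
  have h : HasCompactSupport fun ξ : Space d => θ (((2 : ℝ) ^ (-j) * (2 * Real.pi)) • ξ) :=
    hθ.compact.comp_smul (by positivity)
  have h2 : dil θ j = fun ξ => ((θ (((2 : ℝ) ^ (-j) * (2 * Real.pi)) • ξ) : ℝ) : ℂ) := by
    funext ξ; rw [dil, smul_smul]
  rw [h2]
  exact h.comp_left (g := fun x : ℝ => (x : ℂ)) Complex.ofReal_zero

theorem dil_contDiff {θ : Space d → ℝ} (hθ : IsBump θ) (j : ℤ) : ContDiff ℝ ∞ (dil θ j) := by
  have h := hθ.smooth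
  unfold dil
  exact Complex.ofRealCLM.contDiff.comp (by fun_prop : ContDiff ℝ ∞ fun ξ : Space d =>
    θ ((2 : ℝ) ^ (-j) • ((2 * Real.pi) • ξ)))

/-- The dilated cut-off as a Schwartz function. -/
def dilS {θ : Space d → ℝ} (hθ : IsBump θ) (j : ℤ) : 𝓢(Space d, ℂ) :=
  (dil_hasCompactSupport hθ j).toSchwartzMap (dil_contDiff hθ j)

theorem dilS_apply {θ : Space d → ℝ} (hθ : IsBump θ) (j : ℤ) : ⇑(dilS hθ j) = dil θ j := rfl

theorem fourierInv_dilS {θ : Space d → ℝ} (hθ : IsBump θ) (j : ℤ) :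
    ⇑(𝓕⁻ (dilS hθ j) : 𝓢(Space d, ℂ)) = 𝓕⁻ (dil θ j) := by
  rw [SchwartzMap.fourierInv_coe, dilS_apply]

theorem integrable_dil {θ : Space d → ℝ} (hθ : IsBump θ) (j : ℤ) : Integrable (dil θ j) :=
  (dilS hθ j).integrable

theorem continuous_dil {θ : Space d → ℝ} (hθ : IsBump θ) (j : ℤ) : Continuous (dil θ j) :=
  (dilS hθ j).continuous

theorem memLp_fourierInv_dil {θ : Space d → ℝ} (hθ : IsBump θ) (j : ℤ) (q : ℝ≥0∞) :
    MemLp (𝓕⁻ (dil θ j)) q volume := by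
  rw [← fourierInv_dilS hθ]; exact SchwartzMap.memLp _ _ volume

theorem fourier_fourierInv_dil {θ : Space d → ℝ} (hθ : IsBump θ) (j : ℤ) :
    𝓕 (𝓕⁻ (dil θ j)) = dil θ j := by
  rw [← fourierInv_dilS hθ, ← SchwartzMap.fourier_coe, FourierTransform.fourier_fourierInv_eq,
    dilS_apply]

theorem fourierInv_dil (θ : Space d → ℝ) (j : ℤ) (x : Space d) :
    𝓕⁻ (dil θ j) x = (((2 : ℝ) ^ j) ^ d : ℝ) • 𝓕⁻ (dil θ 0) ((2 : ℝ) ^ j • x) := by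
  have h2 : (0 : ℝ) < 2 ^ j := by positivity
  rw [Real.fourierInv_eq', Real.fourierInv_eq']
  have := Measure.integral_comp_smul (μ := (volume : Measure (Space d)))
    (fun v : Space d => Complex.exp (↑(2 * Real.pi * inner ℝ v ((2 : ℝ) ^ j • x)) * Complex.I) •
      dil θ 0 v) ((2 : ℝ) ^ (-j))
  rw [finrank_euclideanSpace_fin] at this
  rw [abs_of_nonneg (by positivity)] at this
  have e : ∀ v : Space d, Complex.exp (↑(2 * Real.pi *
        inner ℝ ((2 : ℝ) ^ (-j) • v) ((2 : ℝ) ^ j • x)) * Complex.I) • dil θ 0 ((2 : ℝ) ^ (-j) • v) =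
      Complex.exp (↑(2 * Real.pi * inner ℝ v x) * Complex.I) • dil θ j v := by
    intro v
    rw [real_inner_smul_left, real_inner_smul_right, ← mul_assoc ((2 : ℝ) ^ (-j)),
      ← zpow_add₀ two_ne_zero, neg_add_cancel, zpow_zero, one_mul]
    congr 1
    simp only [dil, neg_zero, zpow_zero, one_smul]
    rw [smul_comm]
  simp_rw [e] at this
  rw [this]
  congr 1
  rw [zpow_neg, inv_pow, inv_inv]

/-- The kernel is 2^{jd} times a dilate of the one at j = 0. The power d(1 − 1/q) is the loss in
Bernstein's inequality; it vanishes for q = 1, which makes the multiplier norm of the cut-off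
independent of j. -/
theorem eLpNorm_fourierInv_dil {θ : Space d → ℝ} (hθ : IsBump θ) (j : ℤ) {q : ℝ} (hq : 1 ≤ q) :
    eLpNorm (𝓕⁻ (dil θ j)) (ENNReal.ofReal q) volume =
      (2 : ℝ≥0∞) ^ ((j : ℝ) * (d * (1 - 1 / q))) *
        eLpNorm (𝓕⁻ (dil θ 0)) (ENNReal.ofReal q) volume := by
  have hq0 : 0 < q := by linarith
  have h2 : (0 : ℝ) < 2 ^ j := by positivity
  have e : 𝓕⁻ (dil θ j) = (((2 : ℝ) ^ j) ^ d : ℝ) • fun x => 𝓕⁻ (dil θ 0) ((2 : ℝ) ^ j • x) := by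
    funext x; rw [fourierInv_dil]; rfl
  have e2 : eLpNorm (fun x : Space d => 𝓕⁻ (dil θ 0) ((2 : ℝ) ^ j • x)) (ENNReal.ofReal q) volume =
      (ENNReal.ofReal (((2 : ℝ) ^ j) ^ d)⁻¹) ^ (1 / q) *
        eLpNorm (𝓕⁻ (dil θ 0)) (ENNReal.ofReal q) volume := by
    have := eLpNorm_map_measure (μ := (volume : Measure (Space d))) (p := ENNReal.ofReal q)
      (f := fun x : Space d => (2 : ℝ) ^ j • x) (g := 𝓕⁻ (dil θ 0))
      (continuous_fourierInv (integrable_dil hθ 0)).aestronglyMeasurable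
      (by fun_prop)
    rw [Measure.map_addHaar_smul _ h2.ne', finrank_euclideanSpace_fin,
      abs_of_nonneg (by positivity)] at this
    change eLpNorm (𝓕⁻ (dil θ 0) ∘ fun x : Space d => (2 : ℝ) ^ j • x) _ _ = _
    rw [← this, eLpNorm_smul_measure_of_ne_top ENNReal.ofReal_ne_top,
      ENNReal.toReal_div, ENNReal.toReal_one, ENNReal.toReal_ofReal hq0.le, smul_eq_mul]
  rw [e, eLpNorm_const_smul, e2, ← mul_assoc]
  congr 1
  have h3 : (2 : ℝ≥0∞) = ENNReal.ofReal 2 := by simp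
  rw [Real.enorm_of_nonneg (by positivity), h3, ENNReal.ofReal_rpow_of_pos two_pos,
    ENNReal.ofReal_rpow_of_pos (by positivity), ← ENNReal.ofReal_mul (by positivity)]
  congr 1
  rw [← Real.rpow_intCast, ← Real.rpow_natCast, ← Real.rpow_mul two_pos.le,
    ← Real.rpow_neg two_pos.le, ← Real.rpow_mul two_pos.le, ← Real.rpow_add two_pos]
  congr 1
  ring

theorem isMult_dil {θ : Space d → ℝ} (hθ : IsBump θ) (j : ℤ) {p : ℝ} (hp : 1 ≤ p) :
    IsMult p (eLpNorm (𝓕⁻ (dil θ 0)) 1 volume) (dil θ j) := by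
  have h := isMult_fourier hp (memLp_one_iff_integrable.1 (memLp_fourierInv_dil hθ j 1))
  rw [fourier_fourierInv_dil hθ] at h
  refine h.mono (le_of_eq ?_)
  have := eLpNorm_fourierInv_dil hθ j (le_refl 1)
  simpa using this

end Cutoffs

/-! ### Multiplier operators on the whole of L^p. -/

section Operators

variable {E : Type*} [NormedAddCommGroup E] [InnerProductSpace ℝ E] [FiniteDimensional ℝ E]
  [MeasurableSpace E] [BorelSpace E]

theorem exists_schwartz_tendsto {p : ℝ} (hp : 1 ≤ p) {f : E → ℂ}
    (hf : MemLp f (ENNReal.ofReal p) volume) :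
    ∃ S : ℕ → 𝓢(E, ℂ), Tendsto (fun n => eLpNorm (f - ⇑(S n)) (ENNReal.ofReal p) volume)
      atTop (𝓝 0) := by
  have : Fact (1 ≤ ENNReal.ofReal p) := ⟨by simpa using hp⟩
  have hd := SchwartzMap.denseRange_toLpCLM (E := E) (F := ℂ) (μ := volume)
    (ENNReal.ofReal_ne_top (r := p))
  have hx := hd (hf.toLp f)
  obtain ⟨x, hx1, hx2⟩ := mem_closure_iff_seq_limit.1 hx
  choose S hS using hx1
  refine ⟨S, ?_⟩
  rw [tendsto_iff_edist_tendsto_0] at hx2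
  refine hx2.congr fun n => ?_
  rw [← hS n, edist_comm, SchwartzMap.toLpCLM_apply]
  exact Lp.edist_toLp_toLp f (S n) hf ((S n).memLp _ _)

theorem tendsto_cv {p q : ℝ≥0∞} [ENNReal.HolderConjugate q p] {k f : E → ℂ} {g : ℕ → E → ℂ}
    (hk : MemLp k q volume) (hf : MemLp f p volume) (hg : ∀ n, MemLp (g n) p volume)
    (h : Tendsto (fun n => eLpNorm (f - g n) p volume) atTop (𝓝 0)) (x : E) :
    Tendsto (fun n => cv k (g n) x) atTop (𝓝 (cv k f x)) := by
  rw [tendsto_iff_edist_tendsto_0]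
  have h2 : Tendsto (fun n => eLpNorm k q volume * eLpNorm (f - g n) p volume) atTop (𝓝 0) := by
    have := ENNReal.Tendsto.const_mul h (Or.inr hk.2.ne)
    rwa [mul_zero] at this
  refine tendsto_of_tendsto_of_tendsto_of_le_of_le tendsto_const_nhds h2 (fun _ => zero_le)
    fun n => ?_
  beta_reduce
  rw [edist_comm, edist_eq_enorm_sub, ← cv_sub_right hk hf (hg n) x]
  exact enorm_cv_le hk.1 (hf.sub (hg n)).1 p q x

theorem cv_fourierInv_schwartz {m : E → ℂ} (hm : Integrable m) (f : 𝓢(E, ℂ)) :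
    cv (𝓕⁻ m) f = 𝓕⁻ (fun ξ => m ξ * (𝓕 f : 𝓢(E, ℂ)) ξ) := by
  rw [cv_fourierInv_left hm f.integrable]
  rfl

theorem fourierInv_fourier_schwartz (f : 𝓢(E, ℂ)) : 𝓕⁻ (⇑(𝓕 f : 𝓢(E, ℂ))) = ⇑f := by
  rw [← SchwartzMap.fourierInv_coe, FourierTransform.fourierInv_fourier_eq]

/-- `IsMult` tests only functions with integrable spectrum, in particular Schwartz functions. These
are dense in L^p, a kernel in L^q makes the convolutions converge pointwise, and Fatou's lemma
extends the bound. -/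
theorem eLpNorm_cv_le_of_isMult {p q : ℝ} (hpq : p.HolderConjugate q) {C : ℝ≥0∞} (hC : C ≠ ⊤)
    {m : E → ℂ} (hm : Integrable m) (hk : MemLp (𝓕⁻ m) (ENNReal.ofReal q) volume)
    (hM : IsMult p C m) {f : E → ℂ} (hf : MemLp f (ENNReal.ofReal p) volume) :
    eLpNorm (cv (𝓕⁻ m) f) (ENNReal.ofReal p) volume ≤ C * eLpNorm f (ENNReal.ofReal p) volume := by
  have : ENNReal.HolderConjugate (ENNReal.ofReal q) (ENNReal.ofReal p) := hpq.symm.ennrealOfReal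
  have hp1 : 1 ≤ ENNReal.ofReal p := by simpa using hpq.lt.le
  obtain ⟨S, hS⟩ := exists_schwartz_tendsto hpq.lt.le hf
  have hSm : ∀ n, MemLp (S n) (ENNReal.ofReal p) volume := fun n => (S n).memLp _ _
  have h1 := Lp.eLpNorm_lim_le_liminf_eLpNorm (p := ENNReal.ofReal p) (μ := volume)
    (f := fun n => cv (𝓕⁻ m) (S n)) (fun n => aestronglyMeasurable_cv hk.1 (hSm n).1)
    (cv (𝓕⁻ m) f) (Eventually.of_forall fun x => tendsto_cv hk hf hSm hS x)
  refine h1.trans ?_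
  have h2 : ∀ n, eLpNorm (cv (𝓕⁻ m) (S n)) (ENNReal.ofReal p) volume ≤
      C * (eLpNorm f (ENNReal.ofReal p) volume + eLpNorm (f - ⇑(S n)) (ENNReal.ofReal p) volume) := by
    intro n
    rw [cv_fourierInv_schwartz hm]
    refine (hM.bound _ (𝓕 (S n) : 𝓢(E, ℂ)).integrable).trans ?_
    rw [fourierInv_fourier_schwartz]
    refine mul_le_mul_right ?_ _
    have : (⇑(S n) : E → ℂ) = f - (f - ⇑(S n)) := by simp
    conv_lhs => rw [this]
    exact eLpNorm_sub_le hf.1 (hf.sub (hSm n)).1 hp1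
  have h3 : Tendsto (fun n => C * (eLpNorm f (ENNReal.ofReal p) volume +
      eLpNorm (f - ⇑(S n)) (ENNReal.ofReal p) volume)) atTop
      (𝓝 (C * eLpNorm f (ENNReal.ofReal p) volume)) := by
    have := ENNReal.Tendsto.const_mul (a := C)
      (tendsto_const_nhds (x := eLpNorm f (ENNReal.ofReal p) volume).add hS) (Or.inr hC)
    rwa [add_zero] at this
  rw [← h3.liminf_eq]
  exact liminf_le_liminf (Eventually.of_forall h2)

/-- Symbols of operators acting on all the spaces `L^p`, `1 < p < ∞`, and mapping them into
`L^∞`. -/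
structure IsSym (m : E → ℂ) : Prop where
  integrable : Integrable m
  memLp : ∀ q : ℝ, 1 < q → MemLp (𝓕⁻ m) (ENNReal.ofReal q) volume
  isMult : ∀ p : ℝ, 1 < p → ∃ C : ℝ≥0∞, C ≠ ⊤ ∧ IsMult p C m

theorem IsSym.memLp_cv {m : E → ℂ} (hm : IsSym m) {p : ℝ} (hp : 1 < p) {f : E → ℂ}
    (hf : MemLp f (ENNReal.ofReal p) volume) : MemLp (cv (𝓕⁻ m) f) (ENNReal.ofReal p) volume := by
  have hpq := Real.HolderConjugate.conjExponent hp
  obtain ⟨C, hC, hM⟩ := hm.isMult p hp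
  refine ⟨aestronglyMeasurable_cv (continuous_fourierInv hm.integrable).aestronglyMeasurable hf.1,
    (eLpNorm_cv_le_of_isMult hpq hC hm.integrable (hm.memLp _ hpq.symm.lt) hM hf).trans_lt ?_⟩
  exact ENNReal.mul_lt_top hC.lt_top hf.2

theorem IsSym.tendsto {m : E → ℂ} (hm : IsSym m) {p : ℝ} (hp : 1 < p) {f : E → ℂ}
    {g : ℕ → E → ℂ} (hf : MemLp f (ENNReal.ofReal p) volume)
    (hg : ∀ n, MemLp (g n) (ENNReal.ofReal p) volume)
    (h : Tendsto (fun n => eLpNorm (f - g n) (ENNReal.ofReal p) volume) atTop (𝓝 0)) (x : E) :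
    Tendsto (fun n => cv (𝓕⁻ m) (g n) x) atTop (𝓝 (cv (𝓕⁻ m) f x)) := by
  have hpq := Real.HolderConjugate.conjExponent hp
  have := hpq.symm.ennrealOfReal
  exact tendsto_cv (hm.memLp _ hpq.symm.lt) hf hg h x

theorem IsSym.tendsto_eLpNorm {m : E → ℂ} (hm : IsSym m) {p : ℝ} (hp : 1 < p) {f : E → ℂ}
    {g : ℕ → E → ℂ} (hf : MemLp f (ENNReal.ofReal p) volume)
    (hg : ∀ n, MemLp (g n) (ENNReal.ofReal p) volume)
    (h : Tendsto (fun n => eLpNorm (f - g n) (ENNReal.ofReal p) volume) atTop (𝓝 0)) :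
    Tendsto (fun n => eLpNorm (cv (𝓕⁻ m) f - cv (𝓕⁻ m) (g n)) (ENNReal.ofReal p) volume)
      atTop (𝓝 0) := by
  have hpq := Real.HolderConjugate.conjExponent hp
  have := hpq.symm.ennrealOfReal
  obtain ⟨C, hC, hM⟩ := hm.isMult p hp
  have h2 : Tendsto (fun n => C * eLpNorm (f - g n) (ENNReal.ofReal p) volume) atTop (𝓝 0) := by
    have := ENNReal.Tendsto.const_mul h (Or.inr hC)
    rwa [mul_zero] at this
  refine tendsto_of_tendsto_of_tendsto_of_le_of_le tendsto_const_nhds h2 (fun _ => zero_le)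
    fun n => ?_
  have e : cv (𝓕⁻ m) f - cv (𝓕⁻ m) (g n) = cv (𝓕⁻ m) (f - g n) := by
    funext x
    rw [cv_sub_right (hm.memLp _ hpq.symm.lt) hf (hg n)]; rfl
  beta_reduce
  rw [e]
  exact eLpNorm_cv_le_of_isMult hpq hC hm.integrable (hm.memLp _ hpq.symm.lt) hM (hf.sub (hg n))

/-- A bounded multiplier maps the kernel of θ into L^q for every q > 1. The localized kernel need
not be integrable when m is discontinuous, which is why `IsSym` leaves out q = 1. -/
theorem IsMult.isSym_mul {m θ : E → ℂ} (hm : ∀ p : ℝ, 1 < p → ∃ C : ℝ≥0∞, C ≠ ⊤ ∧ IsMult p C m)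
    (hθ : IsSym θ) : IsSym fun ξ => m ξ * θ ξ := by
  have hi : Integrable fun ξ => m ξ * θ ξ := by
    obtain ⟨C, -, h⟩ := hm 2 one_lt_two
    exact h.integrable hθ.integrable
  refine ⟨hi, fun q hq => ?_, fun p hp => ?_⟩
  · obtain ⟨C, hC, h⟩ := hm q hq
    exact ⟨(continuous_fourierInv hi).aestronglyMeasurable,
      (h.bound _ hθ.integrable).trans_lt (ENNReal.mul_lt_top hC.lt_top (hθ.memLp q hq).2)⟩
  · obtain ⟨C, hC, h⟩ := hm p hp
    obtain ⟨C', hC', h'⟩ := hθ.isMult p hp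
    exact ⟨C * C', by finiteness, h.mul h'⟩

theorem isSym_dil {d : ℕ} {θ : Space d → ℝ} (hθ : IsBump θ) (j : ℤ) : IsSym (dil θ j) :=
  ⟨integrable_dil hθ j, fun _ _ => memLp_fourierInv_dil hθ j _, fun _ hp =>
    ⟨_, (memLp_fourierInv_dil hθ 0 1).2.ne, isMult_dil hθ j hp.le⟩⟩

/-- Convolution operators with integrable kernel compose with the operators with symbol `m`. -/
theorem IsSym.cv_cv {m k : E → ℂ} (hm : IsSym m) (hk : Integrable k)
    (hk' : ∀ q : ℝ, 1 < q → MemLp k (ENNReal.ofReal q) volume)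
    {p : ℝ} (hp : 1 < p) {f : E → ℂ} (hf : MemLp f (ENNReal.ofReal p) volume) :
    cv k (cv (𝓕⁻ m) f) = cv (𝓕⁻ fun ξ => 𝓕 k ξ * m ξ) f := by
  have hpq := Real.HolderConjugate.conjExponent hp
  have := hpq.symm.ennrealOfReal
  have hs : IsSym fun ξ => 𝓕 k ξ * m ξ := IsMult.isSym_mul (fun p hp =>
    ⟨_, (memLp_one_iff_integrable.2 hk).2.ne, isMult_fourier hp.le hk⟩) hm
  obtain ⟨S, hS⟩ := exists_schwartz_tendsto hp.le hf
  have hSm : ∀ n, MemLp (S n) (ENNReal.ofReal p) volume := fun n => (S n).memLp _ _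
  funext x
  have h1 := hs.tendsto hp hf hSm hS x
  have h2 := tendsto_cv (hk' _ hpq.symm.lt) (hm.memLp_cv hp hf) (fun n => hm.memLp_cv hp (hSm n))
    (hm.tendsto_eLpNorm hp hf hSm hS) x
  refine tendsto_nhds_unique h2 (h1.congr fun n => ?_)
  rw [cv_fourierInv_schwartz hs.integrable, cv_fourierInv_schwartz hm.integrable,
    cv_fourierInv_right hk]
  · simp_rw [mul_assoc]
  · obtain ⟨C, -, h⟩ := hm.isMult p hp
    exact h.integrable (𝓕 (S n) : 𝓢(E, ℂ)).integrable

end Operators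

/-! ### Products of band-limited functions. -/

section Products

variable {E : Type*} [NormedAddCommGroup E] [InnerProductSpace ℝ E] [FiniteDimensional ℝ E]
  [MeasurableSpace E] [BorelSpace E]

theorem fourierInv_cv {f g : E → ℂ} (hf : Integrable f) (hg : Integrable g) :
    𝓕⁻ (cv g f) = fun x => 𝓕⁻ f x * 𝓕⁻ g x := by
  have hc : cv g f = convolution f g (ContinuousLinearMap.mul ℂ ℂ) volume := by
    funext x
    simp [cv, convolution, mul_comm]
  funext x
  rw [Real.fourierInv_eq_fourier_neg, hc, Real.fourier_mul_convolution_eq hf hg,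
    ← Real.fourierInv_eq_fourier_neg, ← Real.fourierInv_eq_fourier_neg]

theorem fourier_fourierInv_mul {f g : E → ℂ} (hf : Continuous f) (hfs : HasCompactSupport f)
    (hg : Continuous g) (hgs : HasCompactSupport g)
    (hi : Integrable fun x => 𝓕⁻ f x * 𝓕⁻ g x) :
    𝓕 (fun x => 𝓕⁻ f x * 𝓕⁻ g x) = cv g f ∧ Integrable (cv g f) := by
  have hfi := hf.integrable_of_hasCompactSupport (μ := volume) hfs
  have hgi := hg.integrable_of_hasCompactSupport (μ := volume) hgs
  have hc : cv g f = convolution f g (ContinuousLinearMap.mul ℂ ℂ) volume := by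
    funext x
    simp [cv, convolution, mul_comm]
  have hcont : Continuous (cv g f) := by
    rw [hc]
    exact hgs.continuous_convolution_right _ hfi.locallyIntegrable hg
  have hint : Integrable (cv g f) := by
    have := memLp_cv_one (memLp_one_iff_integrable.2 hgi) le_rfl
      (f := f) (by simpa using memLp_one_iff_integrable.2 hfi)
    simpa [memLp_one_iff_integrable] using this
  have hF : ∀ ξ, 𝓕 (cv g f) ξ = 𝓕 f ξ * 𝓕 g ξ := fun ξ => by
    rw [hc]; exact Real.fourier_mul_convolution_eq hfi hgi ξ
  have hinv := fourierInv_cv hfi hgi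
  refine ⟨?_, hint⟩
  rw [← hinv]
  refine hcont.fourier_fourierInv_eq hint ?_
  have : 𝓕 (cv g f) = fun s => (fun x => 𝓕⁻ f x * 𝓕⁻ g x) (-s) := by
    funext s
    rw [hF]
    beta_reduce
    rw [Real.fourierInv_eq_fourier_neg, Real.fourierInv_eq_fourier_neg, neg_neg]
  rw [this]
  exact hi.comp_neg

theorem eLpNorm_mul_le_top {α : Type*} [MeasurableSpace α] {μ : Measure α} {p : ℝ≥0∞}
    {f g : α → ℂ} (hf : AEStronglyMeasurable f μ) (hg : AEStronglyMeasurable g μ) :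
    eLpNorm (fun x => f x * g x) p μ ≤ eLpNorm f p μ * eLpNorm g ⊤ μ := by
  have := eLpNorm_smul_le_mul_eLpNorm (p := p) (q := ⊤) (r := p) hg hf
  exact this

theorem tendsto_eLpNorm_mul {α : Type*} [MeasurableSpace α] {μ : Measure α} {p : ℝ≥0∞}
    (hp : 1 ≤ p) {A B : α → ℂ} {A' B' : ℕ → α → ℂ} (hA : MemLp A p μ) (hB : MemLp B ⊤ μ)
    (hA' : ∀ n, MemLp (A' n) p μ) (hB' : ∀ n, MemLp (B' n) ⊤ μ)
    (h1 : Tendsto (fun n => eLpNorm (A - A' n) p μ) atTop (𝓝 0))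
    (h2 : Tendsto (fun n => eLpNorm (B - B' n) ⊤ μ) atTop (𝓝 0)) :
    Tendsto (fun n => eLpNorm ((fun x => A x * B x) - fun x => A' n x * B' n x) p μ)
      atTop (𝓝 0) := by
  have key : ∀ (f g : α → ℂ), AEStronglyMeasurable f μ → AEStronglyMeasurable g μ →
      eLpNorm (fun x => f x * g x) p μ ≤ eLpNorm f p μ * eLpNorm g ⊤ μ := fun _ _ hf hg =>
    eLpNorm_mul_le_top hf hg
  have hlim : Tendsto (fun n => eLpNorm A p μ * eLpNorm (B - B' n) ⊤ μ +
      eLpNorm (A - A' n) p μ * eLpNorm B ⊤ μ +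
      eLpNorm (A - A' n) p μ * eLpNorm (B - B' n) ⊤ μ) atTop (𝓝 0) := by
    have a := ENNReal.Tendsto.const_mul h2 (Or.inr hA.2.ne)
    have b := ENNReal.Tendsto.mul_const h1 (Or.inr hB.2.ne)
    have c := ENNReal.Tendsto.mul h1 (Or.inr ENNReal.zero_ne_top) h2 (Or.inr ENNReal.zero_ne_top)
    simpa using (a.add b).add c
  refine tendsto_of_tendsto_of_tendsto_of_le_of_le tendsto_const_nhds hlim (fun _ => zero_le)
    fun n => ?_
  beta_reduce
  have e : ((fun x => A x * B x) - fun x => A' n x * B' n x) =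
      ((fun x => A x * (B - B' n) x) + fun x => (A - A' n) x * B x) -
        fun x => (A - A' n) x * (B - B' n) x := by
    funext x; simp only [Pi.sub_apply, Pi.add_apply]; ring
  have m1 := hB.1.sub (hB' n).1
  have m2 := hA.1.sub (hA' n).1
  rw [e]
  refine (eLpNorm_sub_le ((hA.1.mul m1).add (m2.mul hB.1)) (m2.mul m1) hp).trans ?_
  refine add_le_add ((eLpNorm_add_le (hA.1.mul m1) (m2.mul hB.1) hp).trans
    (add_le_add (key _ _ hA.1 m1) (key _ _ m2 hB.1))) (key _ _ m2 m1)

theorem IsSym.memLp_top {m : E → ℂ} (hm : IsSym m) {p : ℝ} (hp : 1 < p) {f : E → ℂ}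
    (hf : MemLp f (ENNReal.ofReal p) volume) : MemLp (cv (𝓕⁻ m) f) ⊤ volume := by
  have hpq := Real.HolderConjugate.conjExponent hp
  have := hpq.symm.ennrealOfReal
  have hk := hm.memLp _ hpq.symm.lt
  refine ⟨aestronglyMeasurable_cv hk.1 hf.1, ?_⟩
  rw [eLpNorm_exponent_top]
  refine (eLpNormEssSup_le_of_ae_enorm_bound (Eventually.of_forall fun x =>
    enorm_cv_le hk.1 hf.1 _ _ x)).trans_lt (ENNReal.mul_lt_top hk.2 hf.2)

theorem IsSym.tendsto_top {m : E → ℂ} (hm : IsSym m) {p : ℝ} (hp : 1 < p) {f : E → ℂ}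
    {g : ℕ → E → ℂ} (hf : MemLp f (ENNReal.ofReal p) volume)
    (hg : ∀ n, MemLp (g n) (ENNReal.ofReal p) volume)
    (h : Tendsto (fun n => eLpNorm (f - g n) (ENNReal.ofReal p) volume) atTop (𝓝 0)) :
    Tendsto (fun n => eLpNorm (cv (𝓕⁻ m) f - cv (𝓕⁻ m) (g n)) ⊤ volume) atTop (𝓝 0) := by
  have hpq := Real.HolderConjugate.conjExponent hp
  have := hpq.symm.ennrealOfReal
  have hk := hm.memLp _ hpq.symm.lt
  have h2 : Tendsto (fun n => eLpNorm (𝓕⁻ m) (ENNReal.ofReal p.conjExponent) volume *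
      eLpNorm (f - g n) (ENNReal.ofReal p) volume) atTop (𝓝 0) := by
    have := ENNReal.Tendsto.const_mul h (Or.inr hk.2.ne)
    rwa [mul_zero] at this
  refine tendsto_of_tendsto_of_tendsto_of_le_of_le tendsto_const_nhds h2 (fun _ => zero_le)
    fun n => ?_
  beta_reduce
  have e : cv (𝓕⁻ m) f - cv (𝓕⁻ m) (g n) = cv (𝓕⁻ m) (f - g n) := by
    funext x
    rw [cv_sub_right hk hf (hg n)]; rfl
  rw [e, eLpNorm_exponent_top]
  exact eLpNormEssSup_le_of_ae_enorm_bound (Eventually.of_forall fun x =>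
    enorm_cv_le hk.1 (hf.sub (hg n)).1 _ _ x)

theorem memLp_mul_of_memLp_top {α : Type*} [MeasurableSpace α] {μ : Measure α} {p : ℝ≥0∞}
    {A B : α → ℂ} (hA : MemLp A p μ) (hB : MemLp B ⊤ μ) : MemLp (fun x => A x * B x) p μ :=
  ⟨hA.1.mul hB.1, (eLpNorm_mul_le_top hA.1 hB.1).trans_lt
    (ENNReal.mul_lt_top hA.2 hB.2)⟩

/-- Products of band-limited functions are continuous in both factors. -/
theorem IsSym.tendsto_cv_mul {m m₁ m₂ : E → ℂ} (hm : IsSym m) (h₁ : IsSym m₁) (h₂ : IsSym m₂)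
    {p : ℝ} (hp : 1 < p) {f g : E → ℂ} (hf : MemLp f (ENNReal.ofReal p) volume)
    (hg : MemLp g (ENNReal.ofReal p) volume) {f' g' : ℕ → E → ℂ}
    (hf' : ∀ n, MemLp (f' n) (ENNReal.ofReal p) volume)
    (hg' : ∀ n, MemLp (g' n) (ENNReal.ofReal p) volume)
    (hF : Tendsto (fun n => eLpNorm (f - f' n) (ENNReal.ofReal p) volume) atTop (𝓝 0))
    (hG : Tendsto (fun n => eLpNorm (g - g' n) (ENNReal.ofReal p) volume) atTop (𝓝 0)) (x : E) :
    Tendsto (fun n => cv (𝓕⁻ m) (fun y => cv (𝓕⁻ m₁) (f' n) y * cv (𝓕⁻ m₂) (g' n) y) x) atTop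
      (𝓝 (cv (𝓕⁻ m) (fun y => cv (𝓕⁻ m₁) f y * cv (𝓕⁻ m₂) g y) x)) :=
  hm.tendsto hp (memLp_mul_of_memLp_top (h₁.memLp_cv hp hf) (h₂.memLp_top hp hg))
    (fun n => memLp_mul_of_memLp_top (h₁.memLp_cv hp (hf' n)) (h₂.memLp_top hp (hg' n)))
    (tendsto_eLpNorm_mul (by simpa using hp.le) (h₁.memLp_cv hp hf) (h₂.memLp_top hp hg)
      (fun n => h₁.memLp_cv hp (hf' n)) (fun n => h₂.memLp_top hp (hg' n))
      (h₁.tendsto_eLpNorm hp hf hf' hF) (h₂.tendsto_top hp hg hg' hG)) x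

theorem integrable_mul_fourierInv {m₁ m₂ : E → ℂ} (h₁ : IsSym m₁) (h₂ : IsSym m₂)
    (f g : 𝓢(E, ℂ)) : Integrable fun x => cv (𝓕⁻ m₁) f x * cv (𝓕⁻ m₂) g x := by
  have a := h₁.memLp_cv one_lt_two (f := f) (SchwartzMap.memLp _ _ _)
  have b := h₂.memLp_cv one_lt_two (f := g) (SchwartzMap.memLp _ _ _)
  have : ENNReal.HolderConjugate (ENNReal.ofReal 2) (ENNReal.ofReal 2) :=
    (Real.holderConjugate_iff.2 ⟨one_lt_two, by norm_num⟩ : (2 : ℝ).HolderConjugate 2).ennrealOfReal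
  exact a.integrable_mul b

/-- The symbol of the product. -/
theorem IsSym.cv_mul_schwartz {m m₁ m₂ : E → ℂ} (hm : IsSym m) (h₁ : IsSym m₁) (h₂ : IsSym m₂)
    (c₁ : Continuous m₁) (c₂ : Continuous m₂) (s₁ : HasCompactSupport m₁)
    (s₂ : HasCompactSupport m₂) (f g : 𝓢(E, ℂ)) :
    cv (𝓕⁻ m) (fun x => cv (𝓕⁻ m₁) f x * cv (𝓕⁻ m₂) g x) =
      𝓕⁻ (fun ξ => m ξ * cv (fun η => m₂ η * (𝓕 g : 𝓢(E, ℂ)) η)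
        (fun η => m₁ η * (𝓕 f : 𝓢(E, ℂ)) η) ξ) ∧
      Integrable (cv (fun η => m₂ η * (𝓕 g : 𝓢(E, ℂ)) η) (fun η => m₁ η * (𝓕 f : 𝓢(E, ℂ)) η)) := by
  have hi := integrable_mul_fourierInv h₁ h₂ f g
  rw [cv_fourierInv_left hm.integrable hi]
  rw [cv_fourierInv_schwartz h₁.integrable, cv_fourierInv_schwartz h₂.integrable] at hi ⊢
  have := fourier_fourierInv_mul (c₁.mul (𝓕 f : 𝓢(E, ℂ)).continuous) s₁.mul_right
    (c₂.mul (𝓕 g : 𝓢(E, ℂ)).continuous) s₂.mul_right hi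
  refine ⟨?_, this.2⟩
  congr 1
  funext ξ
  exact congrArg (m ξ * ·) (congrFun this.1 ξ)

end Products

/-! ### The frequency localized Gevrey product. -/

section Pieces

variable {d : ℕ}

/-- A cut-off equal to `1` on the support of the annulus. -/
def fat (χ : Space d → ℝ) (ξ : Space d) : ℝ := χ ((1 / 4 : ℝ) • ξ) - χ ((2 : ℝ) • ξ)

theorem IsCutoff.isBump {χ : Space d → ℝ} (hχ : IsCutoff χ) : IsBump χ :=
  ⟨hχ.smooth, (isCompact_closedBall _ _).of_isClosed_subset (isClosed_tsupport _)
    hχ.support_subset⟩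

theorem IsBump.comp_smul {θ : Space d → ℝ} (hθ : IsBump θ) {c : ℝ} (hc : c ≠ 0) :
    IsBump fun ξ => θ (c • ξ) := by
  have := hθ.smooth
  exact ⟨by fun_prop, hθ.compact.comp_smul hc⟩

theorem IsBump.sub {θ η : Space d → ℝ} (hθ : IsBump θ) (hη : IsBump η) :
    IsBump fun ξ => θ ξ - η ξ :=
  ⟨hθ.smooth.sub hη.smooth, hθ.compact.sub hη.compact⟩

theorem IsCutoff.isBump_annulus {χ : Space d → ℝ} (hχ : IsCutoff χ) : IsBump (annulus χ) :=
  (hχ.isBump.comp_smul (by norm_num)).sub hχ.isBump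

theorem IsCutoff.isBump_fat {χ : Space d → ℝ} (hχ : IsCutoff χ) : IsBump (fat χ) :=
  (hχ.isBump.comp_smul (by norm_num)).sub (hχ.isBump.comp_smul (by norm_num))

theorem IsCutoff.eq_zero {χ : Space d → ℝ} (hχ : IsCutoff χ) {ξ : Space d} (h : 4 / 3 < ‖ξ‖) :
    χ ξ = 0 := by
  by_contra h0
  have := hχ.support_subset (subset_tsupport _ h0)
  rw [mem_closedBall_zero_iff] at this
  linarith

theorem IsCutoff.eq_one' {χ : Space d → ℝ} (hχ : IsCutoff χ) {ξ : Space d} (h : ‖ξ‖ ≤ 3 / 4) :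
    χ ξ = 1 := hχ.eq_one ξ (mem_closedBall_zero_iff.2 h)

theorem IsCutoff.annulus_ne_zero {χ : Space d → ℝ} (hχ : IsCutoff χ) {ξ : Space d}
    (h : annulus χ ξ ≠ 0) : 3 / 4 < ‖ξ‖ ∧ ‖ξ‖ ≤ 8 / 3 := by
  unfold annulus at h
  refine ⟨not_le.1 fun h1 => h ?_, not_lt.1 fun h1 => h ?_⟩
  · rw [hχ.eq_one' h1, hχ.eq_one', sub_self]
    rw [norm_smul]; norm_num; linarith
  · rw [hχ.eq_zero (ξ := ξ) (by linarith), hχ.eq_zero, sub_self]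
    rw [norm_smul]; norm_num; linarith

theorem IsCutoff.fat_ne_zero {χ : Space d → ℝ} (hχ : IsCutoff χ) {ξ : Space d}
    (h : fat χ ξ ≠ 0) : 3 / 8 < ‖ξ‖ ∧ ‖ξ‖ ≤ 16 / 3 := by
  unfold fat at h
  refine ⟨not_le.1 fun h1 => h ?_, not_lt.1 fun h1 => h ?_⟩
  · rw [hχ.eq_one', hχ.eq_one', sub_self] <;> rw [norm_smul] <;> norm_num <;> linarith
  · rw [hχ.eq_zero, hχ.eq_zero, sub_self] <;> rw [norm_smul] <;> norm_num <;> linarith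

theorem IsCutoff.fat_eq_one {χ : Space d → ℝ} (hχ : IsCutoff χ) {ξ : Space d}
    (h : annulus χ ξ ≠ 0) : fat χ ξ = 1 := by
  obtain ⟨h1, h2⟩ := hχ.annulus_ne_zero h
  unfold fat
  rw [hχ.eq_one', hχ.eq_zero, sub_zero] <;> rw [norm_smul] <;> norm_num <;> linarith

theorem norm_dil_arg (j : ℤ) (ξ : Space d) :
    ‖(2 : ℝ) ^ (-j) • ((2 * Real.pi) • ξ)‖ = ‖(2 * Real.pi) • ξ‖ / 2 ^ j := by
  rw [norm_smul, Real.norm_of_nonneg (by positivity), zpow_neg]; field_simp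

theorem IsCutoff.dil_annulus_ne_zero {χ : Space d → ℝ} (hχ : IsCutoff χ) {j : ℤ} {ξ : Space d}
    (h : dil (annulus χ) j ξ ≠ 0) : 3 / 4 * 2 ^ j < ‖(2 * Real.pi) • ξ‖ ∧
      ‖(2 * Real.pi) • ξ‖ ≤ 8 / 3 * 2 ^ j := by
  have h' := hχ.annulus_ne_zero fun h0 => h (by rw [dil, h0, Complex.ofReal_zero])
  rw [norm_dil_arg] at h'
  have h2 : (0 : ℝ) < 2 ^ j := by positivity
  rwa [lt_div_iff₀ h2, div_le_iff₀ h2] at h'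

theorem IsCutoff.dil_fat_ne_zero {χ : Space d → ℝ} (hχ : IsCutoff χ) {j : ℤ} {ξ : Space d}
    (h : dil (fat χ) j ξ ≠ 0) : 3 / 8 * 2 ^ j < ‖(2 * Real.pi) • ξ‖ ∧
      ‖(2 * Real.pi) • ξ‖ ≤ 16 / 3 * 2 ^ j := by
  have h' := hχ.fat_ne_zero fun h0 => h (by rw [dil, h0, Complex.ofReal_zero])
  rw [norm_dil_arg] at h'
  have h2 : (0 : ℝ) < 2 ^ j := by positivity
  rwa [lt_div_iff₀ h2, div_le_iff₀ h2] at h'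

theorem IsCutoff.dil_fat_mul_dil_annulus {χ : Space d → ℝ} (hχ : IsCutoff χ) (j : ℤ) (ξ : Space d) :
    dil (fat χ) j ξ * dil (annulus χ) j ξ = dil (annulus χ) j ξ := by
  by_cases h : annulus χ ((2 : ℝ) ^ (-j) • ((2 * Real.pi) • ξ)) = 0
  · rw [dil, dil, h, Complex.ofReal_zero, mul_zero]
  · rw [dil, dil, hχ.fat_eq_one h, Complex.ofReal_one, one_mul]

/-- The index triples for which the frequency localized product does not vanish. -/
def Interacts (i j k : ℤ) : Prop := i ≤ max j k + 3 ∧ (k + 5 ≤ j → j ≤ i + 3) ∧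
  (j + 5 ≤ k → k ≤ i + 3)

theorem zpow_two_lt {a b : ℤ} (h : (2 : ℝ) ^ a < 2 ^ b) : a < b :=
  (zpow_lt_zpow_iff_right₀ one_lt_two).1 h

/-- With a gap of five octaves the smaller frequency is at most 16/3 · 2^k ≤ 2^j/6 and cannot cancel
the larger one, which exceeds 3/8 · 2^j. The output then exceeds 5/24 · 2^j, and comparison with 8/3
· 2^i forces 2^j < 2^{i+4}. -/
theorem le_of_add_five_le {j k i : ℤ} {x y z : ℝ} (hxy : x ≤ z + y) (hjk : k + 5 ≤ j)
    (hx : 3 / 8 * 2 ^ j < x) (hy : y ≤ 16 / 3 * 2 ^ k) (hz : z ≤ 8 / 3 * 2 ^ i) : j ≤ i + 3 := by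
  have h1 : (2 : ℝ) ^ k * 32 ≤ 2 ^ j := by
    calc (2 : ℝ) ^ k * 32 = 2 ^ (k + 5) := by rw [zpow_add₀ two_ne_zero]; norm_num
      _ ≤ 2 ^ j := zpow_le_zpow_right₀ one_le_two hjk
  have h2 : (0 : ℝ) < 2 ^ j := by positivity
  have : (2 : ℝ) ^ j < 2 ^ (i + 4) := by
    rw [zpow_add₀ two_ne_zero i 4]; norm_num; linarith
  have := zpow_two_lt this
  omega

theorem IsCutoff.interacts {χ : Space d → ℝ} (hχ : IsCutoff χ) {i j k : ℤ} {ξ η : Space d}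
    (hi : dil (annulus χ) i ξ ≠ 0) (hj : dil (fat χ) j η ≠ 0) (hk : dil (fat χ) k (ξ - η) ≠ 0) :
    Interacts i j k := by
  obtain ⟨i1, i2⟩ := hχ.dil_annulus_ne_zero hi
  obtain ⟨j1, j2⟩ := hχ.dil_fat_ne_zero hj
  obtain ⟨k1, k2⟩ := hχ.dil_fat_ne_zero hk
  have t1 : ‖(2 * Real.pi) • ξ‖ ≤ ‖(2 * Real.pi) • (ξ - η)‖ + ‖(2 * Real.pi) • η‖ := by
    have := norm_add_le ((2 * Real.pi) • (ξ - η)) ((2 * Real.pi) • η)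
    rwa [← smul_add, sub_add_cancel] at this
  have t2 : ‖(2 * Real.pi) • η‖ ≤ ‖(2 * Real.pi) • ξ‖ + ‖(2 * Real.pi) • (ξ - η)‖ := by
    have := norm_sub_le ((2 * Real.pi) • ξ) ((2 * Real.pi) • (ξ - η))
    rwa [← smul_sub, sub_sub_cancel] at this
  have t3 : ‖(2 * Real.pi) • (ξ - η)‖ ≤ ‖(2 * Real.pi) • ξ‖ + ‖(2 * Real.pi) • η‖ := by
    have := norm_sub_le ((2 * Real.pi) • ξ) ((2 * Real.pi) • η)
    rwa [← smul_sub] at this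
  refine ⟨?_, fun h => le_of_add_five_le t2 h j1 k2 i2,
    fun h => le_of_add_five_le t3 h k1 j2 i2⟩
  have h1 : (2 : ℝ) ^ j ≤ 2 ^ max j k := zpow_le_zpow_right₀ one_le_two (le_max_left _ _)
  have h2 : (2 : ℝ) ^ k ≤ 2 ^ max j k := zpow_le_zpow_right₀ one_le_two (le_max_right _ _)
  have h3 : (0 : ℝ) < 2 ^ max j k := by positivity
  have : (2 : ℝ) ^ i < 2 ^ (max j k + 4) := by
    rw [zpow_add₀ two_ne_zero _ 4]; norm_num; linarith
  have := zpow_two_lt this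
  omega

variable (χ : Space d → ℝ)

/-- The symbols of the operators acting on the factors. -/
def shiftSym (a : ℝ) (ε : Fin d → Bool) (j : ℤ) (ξ : Space d) : ℂ := shift a ε ξ * dil (fat χ) j ξ

/-- The symbol of `e^{-aΛ₁}` localized at frequency `2^j`. -/
def decaySym (a : ℝ) (j : ℤ) (ξ : Space d) : ℂ := decay a ξ * dil (fat χ) j ξ

/-- The localized projections on the orthants. -/
def projSym (ε : Fin d → Bool) (i : ℤ) (ξ : Space d) : ℂ := proj ε ξ * dil (annulus χ) i ξ

/-- The frequency localized Gevrey product: `e^{aΛ₁} Δ̇_i (e^{-aΛ₁} Δ̇_j U · e^{-aΛ₁} Δ̇_k V)`. -/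
def piece (a : ℝ) (i j k : ℤ) (U V : Space d → ℂ) (x : Space d) : ℂ :=
  ∑ ε : Fin d → Bool, cv (𝓕⁻ (projSym χ ε i)) (fun y => cv (𝓕⁻ (shiftSym χ a ε j)) U y *
    cv (𝓕⁻ (shiftSym χ a ε k)) V y) x

variable {χ}

theorem isSym_shiftSym (hχ : IsCutoff χ) {a : ℝ} (ha : 0 < a) (ε : Fin d → Bool) (j : ℤ) :
    IsSym (shiftSym χ a ε j) :=
  IsMult.isSym_mul (fun _ hp => (exists_isMult_shift hp d).imp fun _ h => ⟨h.1, h.2 a ha ε⟩)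
    (isSym_dil hχ.isBump_fat j)

theorem isSym_decaySym (hχ : IsCutoff χ) {a : ℝ} (ha : 0 < a) (j : ℤ) :
    IsSym (decaySym χ a j) :=
  IsMult.isSym_mul (fun _ hp => ⟨1, ENNReal.one_ne_top, isMult_decay hp.le ha⟩)
    (isSym_dil hχ.isBump_fat j)

theorem isSym_projSym (hχ : IsCutoff χ) (ε : Fin d → Bool) (i : ℤ) :
    IsSym (projSym χ ε i) :=
  IsMult.isSym_mul (fun _ hp => (exists_isMult_proj hp d).imp fun _ h => ⟨h.1, h.2 ε⟩)
    (isSym_dil hχ.isBump_annulus i)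

theorem continuous_decaySym (hχ : IsCutoff χ) (a : ℝ) (j : ℤ) : Continuous (decaySym χ a j) :=
  (continuous_decay a).mul (continuous_dil hχ.isBump_fat j)

theorem continuous_shiftSym (hχ : IsCutoff χ) (a : ℝ) (ε : Fin d → Bool) (j : ℤ) :
    Continuous (shiftSym χ a ε j) :=
  (continuous_shift a ε).mul (continuous_dil hχ.isBump_fat j)

theorem memLp_mul_shift (hχ : IsCutoff χ) {a : ℝ} (ha : 0 < a) (ε : Fin d → Bool) (j k : ℤ)
    {p : ℝ} (hp : 1 < p) {U V : Space d → ℂ} (hU : MemLp U (ENNReal.ofReal p) volume)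
    (hV : MemLp V (ENNReal.ofReal p) volume) :
    MemLp (fun y => cv (𝓕⁻ (shiftSym χ a ε j)) U y * cv (𝓕⁻ (shiftSym χ a ε k)) V y)
      (ENNReal.ofReal p) volume :=
  memLp_mul_of_memLp_top ((isSym_shiftSym hχ ha ε j).memLp_cv hp hU)
    ((isSym_shiftSym hχ ha ε k).memLp_top hp hV)

theorem memLp_mul_decay (hχ : IsCutoff χ) {a : ℝ} (ha : 0 < a) (j k : ℤ)
    {p : ℝ} (hp : 1 < p) {U V : Space d → ℂ} (hU : MemLp U (ENNReal.ofReal p) volume)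
    (hV : MemLp V (ENNReal.ofReal p) volume) :
    MemLp (fun y => cv (𝓕⁻ (decaySym χ a j)) U y * cv (𝓕⁻ (decaySym χ a k)) V y)
      (ENNReal.ofReal p) volume :=
  memLp_mul_of_memLp_top ((isSym_decaySym hχ ha j).memLp_cv hp hU)
    ((isSym_decaySym hχ ha k).memLp_top hp hV)

theorem memLp_piece (hχ : IsCutoff χ) {a : ℝ} (ha : 0 < a) (i j k : ℤ)
    {p : ℝ} (hp : 1 < p) {U V : Space d → ℂ} (hU : MemLp U (ENNReal.ofReal p) volume)
    (hV : MemLp V (ENNReal.ofReal p) volume) :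
    MemLp (piece χ a i j k U V) (ENNReal.ofReal p) volume :=
  memLp_finsetSum _ fun ε _ => (isSym_projSym hχ ε i).memLp_cv hp
    (memLp_mul_shift hχ ha ε j k hp hU hV)

/-- The convolution of two localized symbols multiplied by the growth factor. -/
theorem cv_shiftSym (a : ℝ) (ε : Fin d → Bool) (j k : ℤ) (f g : Space d → ℂ) (ξ : Space d) :
    cv (fun η => shiftSym χ a ε k η * g η) (fun η => shiftSym χ a ε j η * f η) ξ =
      growth a ε ξ * cv (fun η => decaySym χ a k η * g η) (fun η => decaySym χ a j η * f η) ξ := by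
  unfold cv
  rw [← integral_const_mul]
  refine integral_congr_ae (Eventually.of_forall fun η => ?_)
  have h := growth_add a ε (ξ - η) η
  rw [sub_add_cancel] at h
  simp only [shiftSym, decaySym, shift, h]
  ring

theorem piece_schwartz (hχ : IsCutoff χ) {a : ℝ} (ha : 0 < a) (i j k : ℤ) (f g : 𝓢(Space d, ℂ))
    (x : Space d) : piece χ a i j k f g x = ∑ ε : Fin d → Bool,
      𝓕⁻ (fun ξ => projSym χ ε i ξ * (growth a ε ξ * cv (fun η => decaySym χ a k η *
        (𝓕 g : 𝓢(Space d, ℂ)) η) (fun η => decaySym χ a j η * (𝓕 f : 𝓢(Space d, ℂ)) η) ξ)) x := by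
  unfold piece
  refine Finset.sum_congr rfl fun ε _ => ?_
  have := ((isSym_projSym hχ ε i).cv_mul_schwartz (isSym_shiftSym hχ ha ε j)
    (isSym_shiftSym hχ ha ε k) (continuous_shiftSym hχ a ε j) (continuous_shiftSym hχ a ε k)
    (dil_hasCompactSupport hχ.isBump_fat j).mul_left (dil_hasCompactSupport hχ.isBump_fat k).mul_left
    f g).1
  rw [this]
  simp_rw [cv_shiftSym]

theorem tendsto_piece (hχ : IsCutoff χ) {a : ℝ} (ha : 0 < a) (i j k : ℤ) {p : ℝ} (hp : 1 < p)
    {f g : Space d → ℂ} (hf : MemLp f (ENNReal.ofReal p) volume)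
    (hg : MemLp g (ENNReal.ofReal p) volume) {f' g' : ℕ → Space d → ℂ}
    (hf' : ∀ n, MemLp (f' n) (ENNReal.ofReal p) volume)
    (hg' : ∀ n, MemLp (g' n) (ENNReal.ofReal p) volume)
    (hF : Tendsto (fun n => eLpNorm (f - f' n) (ENNReal.ofReal p) volume) atTop (𝓝 0))
    (hG : Tendsto (fun n => eLpNorm (g - g' n) (ENNReal.ofReal p) volume) atTop (𝓝 0))
    (x : Space d) :
    Tendsto (fun n => piece χ a i j k (f' n) (g' n) x) atTop (𝓝 (piece χ a i j k f g x)) :=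
  tendsto_finsetSum _ fun ε _ => (isSym_projSym hχ ε i).tendsto_cv_mul (isSym_shiftSym hχ ha ε j)
    (isSym_shiftSym hχ ha ε k) hp hf hg hf' hg' hF hG x

/-- For Schwartz factors the convolution of the spectra vanishes on the output annulus, because no
frequencies η and ξ − η can meet all three supports. Density and continuity in both factors give the
rest. -/
theorem piece_eq_zero (hχ : IsCutoff χ) {a : ℝ} (ha : 0 < a) {i j k : ℤ} (h : ¬ Interacts i j k)
    {p : ℝ} (hp : 1 < p) {U V : Space d → ℂ} (hU : MemLp U (ENNReal.ofReal p) volume)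
    (hV : MemLp V (ENNReal.ofReal p) volume) : piece χ a i j k U V = 0 := by
  obtain ⟨S, hS⟩ := exists_schwartz_tendsto hp.le hU
  obtain ⟨R, hR⟩ := exists_schwartz_tendsto hp.le hV
  funext x
  refine tendsto_nhds_unique (tendsto_piece hχ ha i j k hp hU hV (fun n => (S n).memLp _ _)
    (fun n => (R n).memLp _ _) hS hR x) (tendsto_const_nhds.congr fun n => ?_)
  rw [piece_schwartz hχ ha]
  refine (Finset.sum_eq_zero fun ε _ => ?_).symm
  have : (fun ξ => projSym χ ε i ξ * (growth a ε ξ * cv (fun η => decaySym χ a k η *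
      (𝓕 (R n) : 𝓢(Space d, ℂ)) η) (fun η => decaySym χ a j η * (𝓕 (S n) : 𝓢(Space d, ℂ)) η) ξ)) =
      fun _ => 0 := by
    funext ξ
    by_cases hi : dil (annulus χ) i ξ = 0
    · simp [projSym, hi]
    · have : cv (fun η => decaySym χ a k η * (𝓕 (R n) : 𝓢(Space d, ℂ)) η)
          (fun η => decaySym χ a j η * (𝓕 (S n) : 𝓢(Space d, ℂ)) η) ξ = 0 := by
        refine integral_eq_zero_of_ae (Eventually.of_forall fun η => ?_)
        simp only [decaySym, Pi.zero_apply]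
        by_cases hj : dil (fat χ) j η = 0
        · simp [hj]
        by_cases hk : dil (fat χ) k (ξ - η) = 0
        · simp [hk]
        exact (h (hχ.interacts hi hj hk)).elim
      rw [this]; ring
  rw [this, Real.fourierInv_eq']
  simp

theorem fourierInv_finsetSum {ι : Type*} (s : Finset ι) {f : ι → Space d → ℂ}
    (hf : ∀ i ∈ s, Integrable (f i)) (x : Space d) :
    ∑ i ∈ s, 𝓕⁻ (f i) x = 𝓕⁻ (fun ξ => ∑ i ∈ s, f i ξ) x := by
  simp_rw [Real.fourierInv_eq', Finset.smul_sum]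
  rw [integral_finsetSum]
  intro i hi
  refine Integrable.bdd_mul (c := 1) (hf i hi) (Continuous.aestronglyMeasurable (by fun_prop)) ?_
  filter_upwards with z
  rw [Complex.norm_exp_ofReal_mul_I]

theorem cv_finsetSum {ι : Type*} (s : Finset ι) {k : Space d → ℂ} {f : ι → Space d → ℂ}
    {p q : ℝ≥0∞} [ENNReal.HolderConjugate q p] (hk : MemLp k q volume)
    (hf : ∀ i ∈ s, MemLp (f i) p volume) (x : Space d) :
    cv k (fun y => ∑ i ∈ s, f i y) x = ∑ i ∈ s, cv k (f i) x := by
  unfold cv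
  simp_rw [Finset.mul_sum]
  exact integral_finsetSum _ fun i hi => integrable_cv hk (hf i hi) x

/-- The frequency localized Gevrey product, after application of `e^{-aΛ₁}`. -/
theorem cv_kernel_piece (hχ : IsCutoff χ) {a : ℝ} (ha : 0 < a) (i j k : ℤ)
    {p : ℝ} (hp : 1 < p) {U V : Space d → ℂ} (hU : MemLp U (ENNReal.ofReal p) volume)
    (hV : MemLp V (ENNReal.ofReal p) volume) :
    cv (kernel a) (piece χ a i j k U V) = cv (𝓕⁻ (dil (annulus χ) i)) (fun y =>
      cv (𝓕⁻ (decaySym χ a j)) U y * cv (𝓕⁻ (decaySym χ a k)) V y) := by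
  have hpq := Real.HolderConjugate.conjExponent hp
  have := hpq.symm.ennrealOfReal
  have hs : ∀ ε : Fin d → Bool, IsSym fun ξ => decay a ξ * projSym χ ε i ξ := fun ε =>
    IsMult.isSym_mul (fun _ hp => ⟨1, ENNReal.one_ne_top, isMult_decay hp.le ha⟩)
      (isSym_projSym hχ ε i)
  have h1 : ∀ x, cv (kernel a) (piece χ a i j k U V) x = ∑ ε : Fin d → Bool,
      cv (𝓕⁻ fun ξ => decay a ξ * projSym χ ε i ξ) (fun y => cv (𝓕⁻ (shiftSym χ a ε j)) U y *
        cv (𝓕⁻ (shiftSym χ a ε k)) V y) x := by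
    intro x
    refine (cv_finsetSum Finset.univ (memLp_kernel ha (q := ENNReal.ofReal p.conjExponent)
      (by simpa using hpq.symm.lt.le)) (fun ε _ => (isSym_projSym hχ ε i).memLp_cv hp
      (memLp_mul_shift hχ ha ε j k hp hU hV)) x).trans (Finset.sum_congr rfl fun ε _ => ?_)
    rw [(isSym_projSym hχ ε i).cv_cv (integrable_kernel ha) (fun q hq => memLp_kernel ha
      (by simpa using hq.le)) hp (memLp_mul_shift hχ ha ε j k hp hU hV), fourier_kernel ha]
  obtain ⟨S, hS⟩ := exists_schwartz_tendsto hp.le hU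
  obtain ⟨R, hR⟩ := exists_schwartz_tendsto hp.le hV
  have hSm : ∀ n, MemLp (S n) (ENNReal.ofReal p) volume := fun n => (S n).memLp _ _
  have hRm : ∀ n, MemLp (R n) (ENNReal.ofReal p) volume := fun n => (R n).memLp _ _
  funext x
  rw [h1]
  refine tendsto_nhds_unique (tendsto_finsetSum _ fun ε _ => (hs ε).tendsto_cv_mul
    (isSym_shiftSym hχ ha ε j) (isSym_shiftSym hχ ha ε k) hp hU hV hSm hRm hS hR x)
    (((isSym_dil hχ.isBump_annulus i).tendsto_cv_mul (isSym_decaySym hχ ha j)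
    (isSym_decaySym hχ ha k) hp hU hV hSm hRm hS hR x).congr fun n => ?_)
  have hc := (isSym_dil hχ.isBump_annulus i).cv_mul_schwartz (isSym_decaySym hχ ha j)
    (isSym_decaySym hχ ha k) (continuous_decaySym hχ a j) (continuous_decaySym hχ a k)
    (dil_hasCompactSupport hχ.isBump_fat j).mul_left (dil_hasCompactSupport hχ.isBump_fat k).mul_left
    (S n) (R n)
  set C := cv (fun η => decaySym χ a k η * (𝓕 (R n) : 𝓢(Space d, ℂ)) η)
    (fun η => decaySym χ a j η * (𝓕 (S n) : 𝓢(Space d, ℂ)) η) with hC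
  have hε : ∀ ε : Fin d → Bool, cv (𝓕⁻ fun ξ => decay a ξ * projSym χ ε i ξ) (fun y =>
      cv (𝓕⁻ (shiftSym χ a ε j)) (S n) y * cv (𝓕⁻ (shiftSym χ a ε k)) (R n) y) =
      𝓕⁻ (fun ξ => proj ε ξ * (dil (annulus χ) i ξ * C ξ)) := by
    intro ε
    rw [((hs ε).cv_mul_schwartz (isSym_shiftSym hχ ha ε j) (isSym_shiftSym hχ ha ε k)
      (continuous_shiftSym hχ a ε j) (continuous_shiftSym hχ a ε k)
      (dil_hasCompactSupport hχ.isBump_fat j).mul_left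
      (dil_hasCompactSupport hχ.isBump_fat k).mul_left (S n) (R n)).1]
    congr 1
    funext ξ
    -- Once the growth factor has left the convolution, e^{-aΛ₁} cancels it on the orthant and only
    -- the projection remains; the projections then add up to the identity.
    rw [cv_shiftSym, ← hC, projSym]
    linear_combination (dil (annulus χ) i ξ * C ξ) * decay_mul_proj_mul_growth a ε ξ
  have hi : Integrable fun ξ => dil (annulus χ) i ξ * C ξ := by
    obtain ⟨K, -, hK⟩ := (isSym_dil hχ.isBump_annulus i).isMult 2 one_lt_two
    exact hK.integrable hc.2
  simp_rw [hε]
  rw [fourierInv_finsetSum, hc.1]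
  · simp_rw [← Finset.sum_mul, sum_proj, one_mul]
  · intro ε _
    obtain ⟨K, -, hK⟩ := exists_isMult_proj one_lt_two d
    exact (hK ε).integrable hi

/-- The frequency localized Gevrey product is frequency localized. -/
theorem cv_fat_piece (hχ : IsCutoff χ) {a : ℝ} (ha : 0 < a) (i j k : ℤ)
    {p : ℝ} (hp : 1 < p) {U V : Space d → ℂ} (hU : MemLp U (ENNReal.ofReal p) volume)
    (hV : MemLp V (ENNReal.ofReal p) volume) :
    cv (𝓕⁻ (dil (fat χ) i)) (piece χ a i j k U V) = piece χ a i j k U V := by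
  have hpq := Real.HolderConjugate.conjExponent hp
  have := hpq.symm.ennrealOfReal
  funext x
  refine (cv_finsetSum Finset.univ (memLp_fourierInv_dil hχ.isBump_fat i
    (ENNReal.ofReal p.conjExponent)) (fun ε _ => (isSym_projSym hχ ε i).memLp_cv hp
    (memLp_mul_shift hχ ha ε j k hp hU hV)) x).trans (Finset.sum_congr rfl fun ε _ => ?_)
  rw [(isSym_projSym hχ ε i).cv_cv (memLp_one_iff_integrable.1
    (memLp_fourierInv_dil hχ.isBump_fat i 1)) (fun q _ => memLp_fourierInv_dil hχ.isBump_fat i _) hp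
    (memLp_mul_shift hχ ha ε j k hp hU hV), fourier_fourierInv_dil hχ.isBump_fat]
  congr 2
  funext ξ
  rw [projSym]
  linear_combination proj ε ξ * hχ.dil_fat_mul_dil_annulus i ξ

end Pieces

/-! ### Bounds for the localized product in L^p. -/

section Bounds

variable {d : ℕ}

theorem eLpNorm_fourierInv_mul_dil {θ : Space d → ℝ} (hθ : IsBump θ) (j : ℤ) {q : ℝ} (hq : 1 ≤ q)
    {C : ℝ≥0∞} {μ : Space d → ℂ} (hμ : IsMult q C μ) :
    eLpNorm (𝓕⁻ fun ξ => μ ξ * dil θ j ξ) (ENNReal.ofReal q) volume ≤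
      C * eLpNorm (𝓕⁻ (dil θ 0)) (ENNReal.ofReal q) volume *
        (2 : ℝ≥0∞) ^ ((j : ℝ) * (d * (1 - 1 / q))) := by
  refine (hμ.bound _ (integrable_dil hθ j)).trans (le_of_eq ?_)
  rw [eLpNorm_fourierInv_dil hθ j hq]
  ring

/-- Boundedness on `L^p`, uniformly in the frequency. -/
theorem eLpNorm_cv_mul_dil {θ : Space d → ℝ} (hθ : IsBump θ) (j : ℤ) {p : ℝ} (hp : 1 < p)
    {C : ℝ≥0∞} (hC : C ≠ ⊤) {μ : Space d → ℂ} (hμ : IsMult p C μ)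
    (hs : IsSym fun ξ => μ ξ * dil θ j ξ) {f : Space d → ℂ}
    (hf : MemLp f (ENNReal.ofReal p) volume) :
    eLpNorm (cv (𝓕⁻ fun ξ => μ ξ * dil θ j ξ) f) (ENNReal.ofReal p) volume ≤
      C * eLpNorm (𝓕⁻ (dil θ 0)) 1 volume * eLpNorm f (ENNReal.ofReal p) volume := by
  have hpq := Real.HolderConjugate.conjExponent hp
  exact eLpNorm_cv_le_of_isMult hpq
    (ENNReal.mul_ne_top hC (memLp_fourierInv_dil hθ 0 1).2.ne) hs.integrable
    (hs.memLp _ hpq.symm.lt) (hμ.mul (isMult_dil hθ j hp.le)) hf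

/-- Bernstein's inequality. -/
theorem enorm_cv_mul_dil {θ : Space d → ℝ} (hθ : IsBump θ) (j : ℤ) {p q : ℝ}
    (hpq : p.HolderConjugate q) {C : ℝ≥0∞} {μ : Space d → ℂ} (hμ : IsMult q C μ)
    (hs : IsSym fun ξ => μ ξ * dil θ j ξ) {f : Space d → ℂ}
    (hf : AEStronglyMeasurable f volume) (x : Space d) :
    ‖cv (𝓕⁻ fun ξ => μ ξ * dil θ j ξ) f x‖ₑ ≤
      C * eLpNorm (𝓕⁻ (dil θ 0)) (ENNReal.ofReal q) volume *
        ((2 : ℝ≥0∞) ^ ((j : ℝ) * (d / p)) * eLpNorm f (ENNReal.ofReal p) volume) := by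
  have := hpq.symm.ennrealOfReal
  refine (enorm_cv_le (hs.memLp q hpq.symm.lt).1 hf (ENNReal.ofReal p) (ENNReal.ofReal q) x).trans ?_
  refine (mul_le_mul_left (eLpNorm_fourierInv_mul_dil hθ j hpq.symm.lt.le hμ) _).trans (le_of_eq ?_)
  have e : (d : ℝ) * (1 - 1 / q) = d / p := by
    have := hpq.inv_add_inv_eq_inv
    rw [inv_one] at this
    rw [div_eq_mul_inv (d : ℝ), one_div]; congr 1; linarith
  rw [e, mul_assoc]

/-- The kernel is measured in L^q with q the conjugate of r, so the multiplier μ is needed on L^q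
only and never on L^m. This matters because m may equal 1, where orthant projections are unbounded.
-/
theorem eLpNorm_cv_mul_dil_young {θ : Space d → ℝ} (hθ : IsBump θ) (j : ℤ) {p r q m : ℝ}
    (hp : 0 < p) (hm : 1 ≤ m) (hrq : r.HolderConjugate q) (h : 1 / m = 1 / p + 1 / r)
    {C : ℝ≥0∞} {μ : Space d → ℂ} (hμ : IsMult q C μ)
    (hs : IsSym fun ξ => μ ξ * dil θ j ξ) {f : Space d → ℂ}
    (hf : AEStronglyMeasurable f volume) :
    eLpNorm (cv (𝓕⁻ fun ξ => μ ξ * dil θ j ξ) f) (ENNReal.ofReal p) volume ≤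
      C * eLpNorm (𝓕⁻ (dil θ 0)) (ENNReal.ofReal q) volume *
        ((2 : ℝ≥0∞) ^ ((j : ℝ) * (d / r)) * eLpNorm f (ENNReal.ofReal m) volume) := by
  have e' := hrq.inv_add_inv_eq_inv
  rw [inv_one] at e'
  refine (eLpNorm_cv_le_young (hs.memLp q hrq.symm.lt).1 hf hrq.symm.lt.le hm hp ?_).trans ?_
  · rw [h, one_div q, one_div r]; linarith
  refine (mul_le_mul_left (eLpNorm_fourierInv_mul_dil hθ j hrq.symm.lt.le hμ) _).trans (le_of_eq ?_)
  have e : (d : ℝ) * (1 - 1 / q) = d / r := by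
    rw [div_eq_mul_inv (d : ℝ), one_div]; congr 1; linarith
  rw [e, mul_assoc]

open Classical in
/-- The size of the frequency localized products, where `α = d/p` and `β = min(d/p, d/p')`. -/
def weight (α β : ℝ) (i j k : ℤ) : ℝ≥0∞ :=
  if Interacts i j k then
    if k + 5 ≤ j then (2 : ℝ≥0∞) ^ ((k : ℝ) * α)
    else if j + 5 ≤ k then (2 : ℝ≥0∞) ^ ((j : ℝ) * α)
    else (2 : ℝ≥0∞) ^ ((i : ℝ) * β + (k : ℝ) * (α - β))
  else 0

/-- Collects the L^p bound and Bernstein's inequality under one constant for the whole family and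
all j. Taking a and ε as part of the index is what gives uniformity in them. -/
theorem exists_family_bounds {ι : Type*} {μ : ι → Space d → ℂ}
    (hμ : ∀ p : ℝ, 1 < p → ∃ C : ℝ≥0∞, C ≠ ⊤ ∧ ∀ i, IsMult p C (μ i)) {θ : Space d → ℝ}
    (hθ : IsBump θ) {p : ℝ} (hp : 1 < p) :
    ∃ K : ℝ≥0∞, K ≠ ⊤ ∧ ∀ (i : ι) (j : ℤ) (V : Space d → ℂ), MemLp V (ENNReal.ofReal p) volume →
      eLpNorm (cv (𝓕⁻ fun ξ => μ i ξ * dil θ j ξ) V) (ENNReal.ofReal p) volume ≤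
        K * eLpNorm V (ENNReal.ofReal p) volume ∧
      ∀ x, ‖cv (𝓕⁻ fun ξ => μ i ξ * dil θ j ξ) V x‖ₑ ≤
        K * ((2 : ℝ≥0∞) ^ ((j : ℝ) * (d / p)) * eLpNorm V (ENNReal.ofReal p) volume) := by
  have hpq := Real.HolderConjugate.conjExponent hp
  obtain ⟨C, hC, h⟩ := hμ p hp
  obtain ⟨C', hC', h'⟩ := hμ _ hpq.symm.lt
  refine ⟨C * eLpNorm (𝓕⁻ (dil θ 0)) 1 volume +
    C' * eLpNorm (𝓕⁻ (dil θ 0)) (ENNReal.ofReal p.conjExponent) volume,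
    ENNReal.add_ne_top.2 ⟨ENNReal.mul_ne_top hC (memLp_fourierInv_dil hθ 0 _).2.ne,
    ENNReal.mul_ne_top hC' (memLp_fourierInv_dil hθ 0 _).2.ne⟩, fun i j V hV => ?_⟩
  have hs : IsSym fun ξ => μ i ξ * dil θ j ξ :=
    IsMult.isSym_mul (fun p hp => (hμ p hp).imp fun _ h => ⟨h.1, h.2 i⟩) (isSym_dil hθ j)
  refine ⟨?_, fun x => ?_⟩
  · exact (eLpNorm_cv_mul_dil hθ j hp hC (h i) hs hV).trans (mul_le_mul_left le_self_add _)
  · exact (enorm_cv_mul_dil hθ j hpq (h' i) hs hV.1 x).trans (mul_le_mul_left le_add_self _)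

theorem exists_shift_bounds {χ : Space d → ℝ} (hχ : IsCutoff χ) {p : ℝ} (hp : 1 < p) :
    ∃ K : ℝ≥0∞, K ≠ ⊤ ∧ ∀ (a : ℝ), 0 < a → ∀ (ε : Fin d → Bool) (j : ℤ) (V : Space d → ℂ),
      MemLp V (ENNReal.ofReal p) volume →
      eLpNorm (cv (𝓕⁻ (shiftSym χ a ε j)) V) (ENNReal.ofReal p) volume ≤
        K * eLpNorm V (ENNReal.ofReal p) volume ∧
      ∀ x, ‖cv (𝓕⁻ (shiftSym χ a ε j)) V x‖ₑ ≤
        K * ((2 : ℝ≥0∞) ^ ((j : ℝ) * (d / p)) * eLpNorm V (ENNReal.ofReal p) volume) := by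
  obtain ⟨K, hK, h⟩ := exists_family_bounds (ι := {a : ℝ // 0 < a} × (Fin d → Bool))
    (μ := fun i => shift i.1 i.2) (fun p hp => (exists_isMult_shift hp d).imp fun _ h =>
      ⟨h.1, fun i => h.2 i.1 i.1.2 i.2⟩) hχ.isBump_fat hp
  exact ⟨K, hK, fun a ha ε j V hV => h (⟨a, ha⟩, ε) j V hV⟩

theorem exists_dil_bounds {θ : Space d → ℝ} (hθ : IsBump θ) {p : ℝ} (hp : 1 < p) :
    ∃ K : ℝ≥0∞, K ≠ ⊤ ∧ ∀ (j : ℤ) (V : Space d → ℂ), MemLp V (ENNReal.ofReal p) volume →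
      eLpNorm (cv (𝓕⁻ (dil θ j)) V) (ENNReal.ofReal p) volume ≤
        K * eLpNorm V (ENNReal.ofReal p) volume ∧
      ∀ x, ‖cv (𝓕⁻ (dil θ j)) V x‖ₑ ≤
        K * ((2 : ℝ≥0∞) ^ ((j : ℝ) * (d / p)) * eLpNorm V (ENNReal.ofReal p) volume) := by
  obtain ⟨K, hK, h⟩ := exists_family_bounds (ι := Unit) (μ := fun _ _ => (1 : ℂ))
    (fun p _ => ⟨‖(1 : ℂ)‖ₑ, enorm_ne_top, fun _ => isMult_const p 1⟩) hθ hp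
  simp_rw [one_mul] at h
  exact ⟨K, hK, h ()⟩

theorem exists_decay_bounds {χ : Space d → ℝ} (hχ : IsCutoff χ) {p : ℝ} (hp : 1 < p) :
    ∃ K : ℝ≥0∞, K ≠ ⊤ ∧ ∀ (a : ℝ), 0 < a → ∀ (j : ℤ) (V : Space d → ℂ),
      MemLp V (ENNReal.ofReal p) volume →
      eLpNorm (cv (𝓕⁻ (decaySym χ a j)) V) (ENNReal.ofReal p) volume ≤
        K * eLpNorm V (ENNReal.ofReal p) volume ∧
      ∀ x, ‖cv (𝓕⁻ (decaySym χ a j)) V x‖ₑ ≤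
        K * ((2 : ℝ≥0∞) ^ ((j : ℝ) * (d / p)) * eLpNorm V (ENNReal.ofReal p) volume) := by
  obtain ⟨K, hK, h⟩ := exists_family_bounds (ι := {a : ℝ // 0 < a})
    (μ := fun i => decay i) (fun p hp => ⟨1, ENNReal.one_ne_top, fun i => isMult_decay hp.le i.2⟩)
    hχ.isBump_fat hp
  exact ⟨K, hK, fun a ha j V hV => h ⟨a, ha⟩ j V hV⟩

theorem eLpNorm_mul_le_of_enorm_le {α : Type*} [MeasurableSpace α] {μ : Measure α} {p : ℝ≥0∞}
    {f g : α → ℂ} (hf : AEStronglyMeasurable f μ) (hg : AEStronglyMeasurable g μ) {c : ℝ≥0∞}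
    (h : ∀ x, ‖g x‖ₑ ≤ c) : eLpNorm (fun x => f x * g x) p μ ≤ c * eLpNorm f p μ := by
  rw [mul_comm]
  refine (eLpNorm_mul_le_top hf hg).trans (mul_le_mul_right ?_ _)
  rw [eLpNorm_exponent_top]
  exact eLpNormEssSup_le_of_ae_enorm_bound (Eventually.of_forall h)

/-- For separated input frequencies the factor of lower frequency goes to L^∞ by Bernstein. For
comparable ones, U stays in L^p, V goes to L^r by interpolation between L^p and L^∞ (whence p ≤ r),
their product is in L^m with 1/m = 1/p + 1/r, where m ≥ 1 because p' ≤ r, and Young's inequality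
returns to L^p. The price 2^{i d/r} is paid at the output frequency i, which is what permits
negative regularity. -/
theorem exists_eLpNorm_piece_le {χ : Space d → ℝ} (hχ : IsCutoff χ) {p r : ℝ} (hp : 1 < p)
    (hpr : p ≤ r) (hpr' : p.conjExponent ≤ r) :
    ∃ K : ℝ≥0∞, K ≠ ⊤ ∧ ∀ (a : ℝ), 0 < a → ∀ (i j k : ℤ) (U V : Space d → ℂ),
      MemLp U (ENNReal.ofReal p) volume → MemLp V (ENNReal.ofReal p) volume →
      eLpNorm (piece χ a i j k U V) (ENNReal.ofReal p) volume ≤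
        K * weight (d / p) (d / r) i j k *
          (eLpNorm U (ENNReal.ofReal p) volume * eLpNorm V (ENNReal.ofReal p) volume) := by
  have hp0 : 0 < p := by linarith
  have hr : 1 < r := by linarith
  have hr0 : 0 < r := by linarith
  have hpq := Real.HolderConjugate.conjExponent hp
  have hrq := Real.HolderConjugate.conjExponent hr
  have hpi := hpq.inv_add_inv_eq_inv
  rw [inv_one] at hpi
  obtain ⟨K, hK, hT⟩ := exists_shift_bounds hχ hp
  obtain ⟨C, hC, hPp⟩ := exists_isMult_proj hp d
  obtain ⟨C', hC', hPr⟩ := exists_isMult_proj hrq.symm.lt d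
  set N := eLpNorm (𝓕⁻ (dil (annulus χ) 0)) 1 volume with hN
  set N' := eLpNorm (𝓕⁻ (dil (annulus χ) 0)) (ENNReal.ofReal r.conjExponent) volume with hN'
  have hNt : N ≠ ⊤ := (memLp_fourierInv_dil hχ.isBump_annulus 0 _).2.ne
  have hNt' : N' ≠ ⊤ := (memLp_fourierInv_dil hχ.isBump_annulus 0 _).2.ne
  refine ⟨Fintype.card (Fin d → Bool) * ((C * N + C' * N') * (K * K)), by finiteness,
    fun a ha i j k U V hU hV => ?_⟩
  by_cases hI : Interacts i j k
  swap
  · rw [piece_eq_zero hχ ha hI hp hU hV, eLpNorm_zero]; exact zero_le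
  have hp1 : 1 ≤ ENNReal.ofReal p := by simpa using hp.le
  set u := eLpNorm U (ENNReal.ofReal p) volume with hu
  set v := eLpNorm V (ENNReal.ofReal p) volume with hv
  have main : ∀ ε : Fin d → Bool, eLpNorm (cv (𝓕⁻ (projSym χ ε i)) (fun y =>
      cv (𝓕⁻ (shiftSym χ a ε j)) U y * cv (𝓕⁻ (shiftSym χ a ε k)) V y)) (ENNReal.ofReal p) volume ≤
      (C * N + C' * N') * (K * K) * (weight (d / p) (d / r) i j k * (u * v)) := by
    intro ε
    obtain ⟨hU1, hU2⟩ := hT a ha ε j U hU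
    obtain ⟨hV1, hV2⟩ := hT a ha ε k V hV
    have mU := ((isSym_shiftSym hχ ha ε j).memLp_cv hp hU).1
    have mV := ((isSym_shiftSym hχ ha ε k).memLp_cv hp hV).1
    have hb := eLpNorm_cv_mul_dil hχ.isBump_annulus i hp hC (hPp ε) (isSym_projSym hχ ε i)
      (memLp_mul_shift hχ ha ε j k hp hU hV)
    rw [weight, if_pos hI]
    split_ifs with h1 h2
    · refine hb.trans ?_
      calc C * N * eLpNorm (fun y => cv (𝓕⁻ (shiftSym χ a ε j)) U y *
            cv (𝓕⁻ (shiftSym χ a ε k)) V y) (ENNReal.ofReal p) volume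
          ≤ C * N * ((K * ((2 : ℝ≥0∞) ^ ((k : ℝ) * (d / p)) * v)) * (K * u)) := by
            refine mul_le_mul_right ((eLpNorm_mul_le_of_enorm_le mU mV hV2).trans ?_) _
            exact mul_le_mul_right hU1 _
        _ = C * N * (K * K) * ((2 : ℝ≥0∞) ^ ((k : ℝ) * (d / p)) * (u * v)) := by ring
        _ ≤ _ := by
            refine mul_le_mul_left (mul_le_mul_left le_self_add _) _
    · refine hb.trans ?_
      calc C * N * eLpNorm (fun y => cv (𝓕⁻ (shiftSym χ a ε j)) U y *
            cv (𝓕⁻ (shiftSym χ a ε k)) V y) (ENNReal.ofReal p) volume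
          ≤ C * N * ((K * ((2 : ℝ≥0∞) ^ ((j : ℝ) * (d / p)) * u)) * (K * v)) := by
            refine mul_le_mul_right ?_ _
            simp_rw [mul_comm (cv (𝓕⁻ (shiftSym χ a ε j)) U _)]
            exact (eLpNorm_mul_le_of_enorm_le mV mU hU2).trans (mul_le_mul_right hV1 _)
        _ = C * N * (K * K) * ((2 : ℝ≥0∞) ^ ((j : ℝ) * (d / p)) * (u * v)) := by ring
        _ ≤ _ := by
            refine mul_le_mul_left (mul_le_mul_left le_self_add _) _
    · set m : ℝ := (1 / p + 1 / r)⁻¹ with hm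
      have hm' : 1 / m = 1 / p + 1 / r := by rw [hm, one_div (_⁻¹), inv_inv]
      have hmpos : 0 < m := by positivity
      have hm1 : 1 ≤ m := by
        rw [hm]
        refine (one_le_inv₀ (by positivity)).2 ?_
        have := inv_anti₀ hpq.symm.pos hpr'
        rw [one_div, one_div]; linarith
      have hb2 := eLpNorm_cv_mul_dil_young hχ.isBump_annulus i hp0 hm1 hrq hm' (hPr ε)
        (isSym_projSym hχ ε i) (mU.mul mV)
      refine hb2.trans ?_
      have hVr : eLpNorm (cv (𝓕⁻ (shiftSym χ a ε k)) V) (ENNReal.ofReal r) volume ≤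
          K * v * (2 : ℝ≥0∞) ^ ((k : ℝ) * (d / p - d / r)) := by
        have h0 : (0 : ℝ) ≤ 1 - p / r := by
          rw [sub_nonneg, div_le_one hr0]; exact hpr
        have hfin : K * ((2 : ℝ≥0∞) ^ ((k : ℝ) * (d / p)) * v) ≠ ⊤ := by
          refine ENNReal.mul_ne_top hK (ENNReal.mul_ne_top ?_ hV.2.ne)
          exact ENNReal.rpow_ne_top_of_ne_zero two_ne_zero ENNReal.ofNat_ne_top
        refine (eLpNorm_le_of_enorm_le hp0 hpr hfin hV2).trans ?_
        calc _ ≤ (K * v) ^ (p / r) * (K * ((2 : ℝ≥0∞) ^ ((k : ℝ) * (d / p)) * v)) ^ (1 - p / r) :=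
              mul_le_mul_left (ENNReal.rpow_le_rpow hV1 (by positivity)) _
          _ = (K * v) ^ (p / r) * (K * v) ^ (1 - p / r) *
              (2 : ℝ≥0∞) ^ ((k : ℝ) * (d / p - d / r)) := by
              rw [show K * ((2 : ℝ≥0∞) ^ ((k : ℝ) * (d / p)) * v) =
                K * v * (2 : ℝ≥0∞) ^ ((k : ℝ) * (d / p)) by ring,
                ENNReal.mul_rpow_of_nonneg _ _ h0, ← ENNReal.rpow_mul, ← mul_assoc,
                show (k : ℝ) * (d / p) * (1 - p / r) = k * (d / p - d / r) by field_simp]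
          _ = _ := by
              rw [← ENNReal.rpow_add_of_nonneg _ _ (by positivity) h0]
              congr 1
              rw [show p / r + (1 - p / r) = 1 by ring, ENNReal.rpow_one]
      have hHT : ENNReal.HolderTriple (ENNReal.ofReal p) (ENNReal.ofReal r) (ENNReal.ofReal m) :=
        Real.HolderTriple.ennrealOfReal ⟨by rw [← one_div, ← one_div, ← one_div, hm'], hp0, hr0⟩
      have hprod : eLpNorm (fun y => cv (𝓕⁻ (shiftSym χ a ε j)) U y *
          cv (𝓕⁻ (shiftSym χ a ε k)) V y) (ENNReal.ofReal m) volume ≤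
          K * u * (K * v * (2 : ℝ≥0∞) ^ ((k : ℝ) * (d / p - d / r))) := by
        have := eLpNorm_smul_le_mul_eLpNorm (p := ENNReal.ofReal p) (q := ENNReal.ofReal r)
          (r := ENNReal.ofReal m) mV mU
        exact this.trans (mul_le_mul' hU1 hVr)
      calc _ ≤ C' * N' * ((2 : ℝ≥0∞) ^ ((i : ℝ) * (d / r)) *
            (K * u * (K * v * (2 : ℝ≥0∞) ^ ((k : ℝ) * (d / p - d / r))))) :=
            mul_le_mul_right (mul_le_mul_right hprod _) _
        _ = C' * N' * (K * K) * ((2 : ℝ≥0∞) ^ ((i : ℝ) * (d / r)) *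
            (2 : ℝ≥0∞) ^ ((k : ℝ) * (d / p - d / r)) * (u * v)) := by ring
        _ = C' * N' * (K * K) * ((2 : ℝ≥0∞) ^ ((i : ℝ) * (d / r) + k * (d / p - d / r)) *
            (u * v)) := by
            rw [ENNReal.rpow_add _ _ two_ne_zero ENNReal.ofNat_ne_top]
        _ ≤ _ := by
            refine mul_le_mul_left (mul_le_mul_left le_add_self _) _
  have hsum : piece χ a i j k U V = ∑ ε : Fin d → Bool, cv (𝓕⁻ (projSym χ ε i)) (fun y =>
      cv (𝓕⁻ (shiftSym χ a ε j)) U y * cv (𝓕⁻ (shiftSym χ a ε k)) V y) := by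
    funext x; simp [piece]
  rw [hsum]
  refine (eLpNorm_sum_le (fun ε _ => ((isSym_projSym hχ ε i).memLp_cv hp
    (memLp_mul_shift hχ ha ε j k hp hU hV)).1) hp1).trans ?_
  refine (Finset.sum_le_sum fun ε _ => main ε).trans (le_of_eq ?_)
  rw [Finset.sum_const, Finset.card_univ, nsmul_eq_mul]
  ring

end Bounds

/-! ### The product law for weighted sequences. -/

section Sequences

/-- The weighted `ℓ¹` norm of Besov spaces. -/
def besovSum (s : ℝ) (c : ℤ → ℝ≥0∞) : ℝ≥0∞ := ∑' j : ℤ, (2 : ℝ≥0∞) ^ ((j : ℝ) * s) * c j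

/-- The sequence bounding the frequency blocks of a product. -/
def paraprod (α β : ℝ) (c e : ℤ → ℝ≥0∞) (i : ℤ) : ℝ≥0∞ :=
  ∑' jk : ℤ × ℤ, weight α β i jk.1 jk.2 * (c jk.1 * e jk.2)

theorem two_rpow_add (x y : ℝ) : (2 : ℝ≥0∞) ^ (x + y) = 2 ^ x * 2 ^ y :=
  ENNReal.rpow_add _ _ two_ne_zero ENNReal.ofNat_ne_top

theorem two_rpow_le {x y : ℝ} (h : x ≤ y) : (2 : ℝ≥0∞) ^ x ≤ 2 ^ y :=
  ENNReal.rpow_le_rpow_of_exponent_le one_le_two h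

theorem two_rpow_ne_top (x : ℝ) : (2 : ℝ≥0∞) ^ x ≠ ⊤ :=
  ENNReal.rpow_ne_top_of_ne_zero two_ne_zero ENNReal.ofNat_ne_top

theorem tsum_window_le (s : ℝ) (j : ℤ) (f : ℤ → ℝ≥0∞) (B : ℝ≥0∞)
    (h0 : ∀ i, ¬(j - 3 ≤ i ∧ i ≤ j + 3) → f i = 0)
    (h1 : ∀ i, f i ≤ (2 : ℝ≥0∞) ^ ((i : ℝ) * s) * B) :
    ∑' i, f i ≤ 7 * (2 : ℝ≥0∞) ^ (3 * |s|) * ((2 : ℝ≥0∞) ^ ((j : ℝ) * s) * B) := by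
  rw [tsum_eq_sum (s := Finset.Icc (j - 3) (j + 3)) fun i hi => h0 i (by simpa using hi)]
  have : ∀ i ∈ Finset.Icc (j - 3) (j + 3), f i ≤
      (2 : ℝ≥0∞) ^ (3 * |s|) * ((2 : ℝ≥0∞) ^ ((j : ℝ) * s) * B) := by
    intro i hi
    rw [Finset.mem_Icc] at hi
    refine (h1 i).trans ?_
    rw [← mul_assoc, ← two_rpow_add]
    refine mul_le_mul_left (two_rpow_le ?_) _
    have h2 : |((i : ℝ) - j)| ≤ 3 := by
      rw [abs_le]
      have a : ((j - 3 : ℤ) : ℝ) ≤ i := by exact_mod_cast hi.1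
      have b : (i : ℝ) ≤ ((j + 3 : ℤ) : ℝ) := by exact_mod_cast hi.2
      push_cast at a b
      constructor <;> linarith
    have h3 : ((i : ℝ) - j) * s ≤ 3 * |s| := by
      refine (le_abs_self _).trans ?_
      rw [abs_mul]
      exact mul_le_mul_of_nonneg_right h2 (abs_nonneg _)
    linarith
  refine (Finset.sum_le_sum this).trans (le_of_eq ?_)
  rw [Finset.sum_const, Int.card_Icc, show (j + 3 + 1 - (j - 3)).toNat = 7 by omega, nsmul_eq_mul]
  push_cast
  ring

theorem tsum_below_le {γ : ℝ} (N : ℤ) (f : ℤ → ℝ≥0∞) (B : ℝ≥0∞)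
    (h0 : ∀ i, ¬ i ≤ N → f i = 0) (h1 : ∀ i, f i ≤ (2 : ℝ≥0∞) ^ ((i : ℝ) * γ) * B) :
    ∑' i, f i ≤ (1 - (2 : ℝ≥0∞) ^ (-γ))⁻¹ * ((2 : ℝ≥0∞) ^ ((N : ℝ) * γ) * B) := by
  have hinj : Function.Injective fun n : ℕ => N - (n : ℤ) := fun a b h => by
    simp only at h; omega
  rw [← hinj.tsum_eq (f := f)]
  · have : ∀ n : ℕ, f (N - n) ≤ ((2 : ℝ≥0∞) ^ (-γ)) ^ n * ((2 : ℝ≥0∞) ^ ((N : ℝ) * γ) * B) := by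
      intro n
      refine (h1 _).trans (le_of_eq ?_)
      rw [← mul_assoc, ← ENNReal.rpow_natCast, ← ENNReal.rpow_mul, ← two_rpow_add]
      congr 2
      push_cast; ring
    refine (ENNReal.tsum_le_tsum this).trans (le_of_eq ?_)
    rw [ENNReal.tsum_mul_right, ENNReal.tsum_geometric]
  · intro i hi
    by_contra hn
    refine hi (h0 i fun hle => hn ⟨(N - i).toNat, ?_⟩)
    simp only; omega

/-- If j dominates, i stays within 3 of j. If k dominates, i stays within 3 of k, and 2^{ks} 2^{jα}
≤ 2^{js} 2^{kα} because j ≤ k and s ≤ α. If they are comparable, i ranges over everything below j +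
7 and the geometric series in 2^{i(s + β)} converges because s > −β; the excess jβ ≤ kβ + 4β
explains the constant `G`. -/
theorem exists_tsum_weight_le {α β s : ℝ} (hβ : 0 ≤ β) (hs : -β < s) (hs' : s ≤ α) :
    ∃ C : ℝ≥0∞, C ≠ ⊤ ∧ ∀ j k : ℤ, ∑' i : ℤ, (2 : ℝ≥0∞) ^ ((i : ℝ) * s) * weight α β i j k ≤
      C * ((2 : ℝ≥0∞) ^ ((j : ℝ) * s) * (2 : ℝ≥0∞) ^ ((k : ℝ) * α)) := by
  have hγ : 0 < s + β := by linarith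
  set A := 7 * (2 : ℝ≥0∞) ^ (3 * |s|) with hA
  set G := (1 - (2 : ℝ≥0∞) ^ (-(s + β)))⁻¹ * (2 : ℝ≥0∞) ^ (7 * (s + β) + 4 * β) with hG
  refine ⟨A + G, ?_, fun j k => ?_⟩
  · have h1 : (1 - (2 : ℝ≥0∞) ^ (-(s + β)))⁻¹ ≠ ⊤ := by
      rw [ENNReal.inv_ne_top]; refine (tsub_pos_iff_lt.2 ?_).ne'
      exact ENNReal.rpow_lt_one_of_one_lt_of_neg ENNReal.one_lt_two (by linarith)
    exact ENNReal.add_ne_top.2 ⟨ENNReal.mul_ne_top ENNReal.ofNat_ne_top (two_rpow_ne_top _),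
      ENNReal.mul_ne_top h1 (two_rpow_ne_top _)⟩
  by_cases h1 : k + 5 ≤ j
  · refine (tsum_window_le s j _ ((2 : ℝ≥0∞) ^ ((k : ℝ) * α)) (fun i hi => ?_)
      fun i => ?_).trans (mul_le_mul_left le_self_add _)
    · rw [weight, if_neg, mul_zero]
      rintro ⟨a, b, -⟩
      have := b h1
      rw [max_eq_left (by omega)] at a
      exact hi ⟨by omega, a⟩
    · refine mul_le_mul_right ?_ _
      rw [weight]
      split_ifs
      · exact le_rfl
      · exact zero_le
  by_cases h2 : j + 5 ≤ k
  · refine (tsum_window_le s k _ ((2 : ℝ≥0∞) ^ ((j : ℝ) * α)) (fun i hi => ?_)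
      fun i => ?_).trans ?_
    · rw [weight, if_neg, mul_zero]
      rintro ⟨a, -, b⟩
      have := b h2
      rw [max_eq_right (by omega)] at a
      exact hi ⟨by omega, a⟩
    · refine mul_le_mul_right ?_ _
      rw [weight]
      split_ifs
      · exact le_rfl
      · exact zero_le
    · refine mul_le_mul' le_self_add ?_
      rw [← two_rpow_add, ← two_rpow_add]
      refine two_rpow_le ?_
      have : (j : ℝ) ≤ k := by exact_mod_cast (by omega : j ≤ k)
      nlinarith
  · refine (tsum_below_le (γ := s + β) (j + 7) _ ((2 : ℝ≥0∞) ^ ((k : ℝ) * (α - β))) (fun i hi => ?_)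
      fun i => ?_).trans ?_
    · rw [weight, if_neg, mul_zero]
      rintro ⟨a, -, -⟩
      have : max j k ≤ j + 4 := by omega
      omega
    · rw [weight, if_neg h1, if_neg h2]
      split_ifs
      · rw [← two_rpow_add, ← two_rpow_add]
        exact two_rpow_le (by linarith)
      · rw [mul_zero]; exact zero_le
    · refine le_trans ?_ (mul_le_mul_left (le_add_self (a := G)) _)
      rw [hG, mul_assoc]
      refine mul_le_mul_right ?_ _
      rw [← two_rpow_add, ← two_rpow_add, ← two_rpow_add]
      refine two_rpow_le ?_
      have : (j : ℝ) ≤ k + 4 := by exact_mod_cast (by omega : j ≤ k + 4)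
      push_cast
      nlinarith

/-- Tonelli reduces this to the sum over the output frequency for fixed j and k. The first factor
carries the regularity s and the second the critical one; this asymmetry makes the final estimate
linear in the s-norm of the difference. -/
theorem exists_besovSum_paraprod_le {α β s : ℝ} (hβ : 0 ≤ β) (hs : -β < s) (hs' : s ≤ α) :
    ∃ C : ℝ≥0∞, C ≠ ⊤ ∧ ∀ c e : ℤ → ℝ≥0∞,
      besovSum s (paraprod α β c e) ≤ C * (besovSum s c * besovSum α e) := by
  obtain ⟨C, hC, h⟩ := exists_tsum_weight_le hβ hs hs'
  refine ⟨C, hC, fun c e => ?_⟩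
  unfold besovSum paraprod
  simp_rw [← ENNReal.tsum_mul_left]
  rw [ENNReal.tsum_comm]
  calc ∑' (jk : ℤ × ℤ) (i : ℤ), (2 : ℝ≥0∞) ^ ((i : ℝ) * s) *
        (weight α β i jk.1 jk.2 * (c jk.1 * e jk.2))
      = ∑' jk : ℤ × ℤ, (∑' i : ℤ, (2 : ℝ≥0∞) ^ ((i : ℝ) * s) * weight α β i jk.1 jk.2) *
        (c jk.1 * e jk.2) := by
        simp_rw [← mul_assoc, ENNReal.tsum_mul_right]
    _ ≤ ∑' jk : ℤ × ℤ, C * ((2 : ℝ≥0∞) ^ ((jk.1 : ℝ) * s) * (2 : ℝ≥0∞) ^ ((jk.2 : ℝ) * α)) *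
        (c jk.1 * e jk.2) := ENNReal.tsum_le_tsum fun jk => mul_le_mul_left (h _ _) _
    _ = ∑' jk : ℤ × ℤ, C * (((2 : ℝ≥0∞) ^ ((jk.1 : ℝ) * s) * c jk.1) *
        ((2 : ℝ≥0∞) ^ ((jk.2 : ℝ) * α) * e jk.2)) := by
        congr 1; funext jk; ring
    _ = _ := by
        rw [ENNReal.tsum_mul_left, ENNReal.tsum_prod' (f := fun jk : ℤ × ℤ =>
          ((2 : ℝ≥0∞) ^ ((jk.1 : ℝ) * s) * c jk.1) * ((2 : ℝ≥0∞) ^ ((jk.2 : ℝ) * α) * e jk.2))]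
        simp_rw [ENNReal.tsum_mul_left, ENNReal.tsum_mul_right]

theorem besovSum_mono {s : ℝ} {c e : ℤ → ℝ≥0∞} (h : ∀ j, c j ≤ e j) : besovSum s c ≤ besovSum s e :=
  ENNReal.tsum_le_tsum fun j => mul_le_mul_right (h j) _

theorem besovSum_const_mul (s : ℝ) (b : ℝ≥0∞) (c : ℤ → ℝ≥0∞) :
    besovSum s (fun j => b * c j) = b * besovSum s c := by
  unfold besovSum
  rw [← ENNReal.tsum_mul_left]
  congr 1; funext j; ring

theorem besovSum_tsum {ι : Type*} (s : ℝ) (c : ι → ℤ → ℝ≥0∞) :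
    besovSum s (fun j => ∑' n, c n j) = ∑' n, besovSum s (c n) := by
  unfold besovSum
  simp_rw [← ENNReal.tsum_mul_left]
  exact ENNReal.tsum_comm

theorem besovSum_add (s : ℝ) (c e : ℤ → ℝ≥0∞) :
    besovSum s (fun j => c j + e j) = besovSum s c + besovSum s e := by
  unfold besovSum
  simp_rw [mul_add]
  exact ENNReal.tsum_add

end Sequences

/-! ### Countable sums of functions. -/

section Series

variable {E : Type*} [NormedAddCommGroup E] [InnerProductSpace ℝ E] [FiniteDimensional ℝ E]
  [MeasurableSpace E] [BorelSpace E]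

theorem hasSum_of_tsum_enorm_ne_top {ι : Type*} {f : ι → ℂ} (h : ∑' n, ‖f n‖ₑ ≠ ⊤) :
    HasSum f (∑' n, f n) :=
  (tsum_enorm_ne_top_iff_summable_norm.1 h).of_norm.hasSum

theorem aestronglyMeasurable_tsum {α ι : Type*} [Countable ι] [MeasurableSpace α] {μ : Measure α}
    {f : ι → α → ℂ} (hf : ∀ n, AEStronglyMeasurable (f n) μ) (h : ∀ x, ∑' n, ‖f n x‖ₑ ≠ ⊤) :
    AEStronglyMeasurable (fun x => ∑' n, f n x) μ :=
  aestronglyMeasurable_of_tendsto_ae (atTop : Filter (Finset ι))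
    (f := fun s x => ∑ n ∈ s, f n x) (fun _ => Finset.aestronglyMeasurable_fun_sum _ fun n _ => hf n)
    (Eventually.of_forall fun x => hasSum_of_tsum_enorm_ne_top (h x))

theorem stronglyMeasurable_tsum {α ι : Type*} [Countable ι] [MeasurableSpace α]
    {f : ι → α → ℂ} (hf : ∀ n, StronglyMeasurable (f n)) (h : ∀ x, ∑' n, ‖f n x‖ₑ ≠ ⊤) :
    StronglyMeasurable (fun x => ∑' n, f n x) :=
  stronglyMeasurable_of_tendsto (atTop : Filter (Finset ι))
    (f := fun s x => ∑ n ∈ s, f n x) (fun _ => Finset.stronglyMeasurable_fun_sum _ fun n _ => hf n)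
    (tendsto_pi_nhds.2 fun x => hasSum_of_tsum_enorm_ne_top (h x))

theorem eLpNorm_tsum_le {α ι : Type*} [Countable ι] [MeasurableSpace α] {μ : Measure α}
    {p : ℝ≥0∞} (hp : 1 ≤ p) {f : ι → α → ℂ} (hf : ∀ n, AEStronglyMeasurable (f n) μ)
    (h : ∀ x, ∑' n, ‖f n x‖ₑ ≠ ⊤) :
    eLpNorm (fun x => ∑' n, f n x) p μ ≤ ∑' n, eLpNorm (f n) p μ := by
  obtain ⟨s, hs⟩ := exists_seq_tendsto (atTop : Filter (Finset ι))
  refine (Lp.eLpNorm_lim_le_liminf_eLpNorm (f := fun n x => ∑ i ∈ s n, f i x)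
    (fun n => Finset.aestronglyMeasurable_fun_sum _ fun i _ => hf i) _
    (Eventually.of_forall fun x => (hasSum_of_tsum_enorm_ne_top (h x)).comp hs)).trans ?_
  refine liminf_le_of_le (by isBoundedDefault) fun b hb => ?_
  obtain ⟨n, hn⟩ := hb.exists
  refine hn.trans ?_
  have : (fun x => ∑ i ∈ s n, f i x) = ∑ i ∈ s n, f i := by funext x; simp
  rw [this]
  exact (eLpNorm_sum_le (fun i _ => hf i) hp).trans (ENNReal.sum_le_tsum _)

theorem hasSum_cv {ι : Type*} [Countable ι] {p q : ℝ≥0∞} [ENNReal.HolderConjugate q p]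
    {k : E → ℂ} (hk : MemLp k q volume) {f : ι → E → ℂ} (hf : ∀ n, MemLp (f n) p volume)
    (h : ∑' n, eLpNorm (f n) p volume ≠ ⊤) (x : E) :
    HasSum (fun n => cv k (f n) x) (cv k (fun y => ∑' n, f n y) x) := by
  have hi : ∀ n, Integrable fun y => k (x - y) * f n y := fun n => integrable_cv hk (hf n) x
  have := hasSum_integral_of_summable_integral_norm hi ?_
  · simp only [tsum_mul_left] at this
    exact this
  · refine (tsum_enorm_ne_top_iff_summable_norm.1 ?_).of_norm
    have hb : ∀ n, ‖∫ y, ‖k (x - y) * f n y‖‖ₑ ≤ eLpNorm k q volume * eLpNorm (f n) p volume := by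
      intro n
      rw [Real.enorm_of_nonneg (integral_nonneg fun _ => norm_nonneg _),
        ofReal_integral_norm_eq_lintegral_enorm (hi n)]
      have h := eLpNorm_smul_le_mul_eLpNorm (p := q) (q := p) (r := 1) (hf n).1
        (aestronglyMeasurable_sub_left hk.1 x)
      rw [eLpNorm_sub_left hk.1, eLpNorm_one_eq_lintegral_enorm] at h
      exact h
    refine ne_top_of_le_ne_top ?_ (ENNReal.tsum_le_tsum hb)
    rw [ENNReal.tsum_mul_left]
    exact ENNReal.mul_ne_top hk.2.ne h

end Series

/-! ### Littlewood-Paley decomposition of a product by telescoping. -/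

section Telescope

theorem tendsto_Ico_neg_atTop : Tendsto (fun n : ℕ => Finset.Ico (-(n : ℤ)) n) atTop atTop := by
  refine tendsto_atTop_finset_of_monotone (fun a b h => ?_) fun x => ⟨x.natAbs + 1, ?_⟩
  · exact Finset.Ico_subset_Ico (by omega) (by omega)
  · rw [Finset.mem_Ico]; omega

theorem sum_Ico_neg_sub {G : Type*} [AddCommGroup G] (f : ℤ → G) (n : ℕ) :
    ∑ i ∈ Finset.Ico (-(n : ℤ)) n, (f (i + 1) - f i) = f n - f (-n) := by
  induction n with
  | zero => simp
  | succ n ih =>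
    have : Finset.Ico (-((n + 1 : ℕ) : ℤ)) ((n + 1 : ℕ) : ℤ) =
        insert (n : ℤ) (insert (-(n : ℤ) - 1) (Finset.Ico (-(n : ℤ)) n)) := by
      ext x; simp only [Finset.mem_Ico, Finset.mem_insert]; omega
    rw [this, Finset.sum_insert, Finset.sum_insert, ih]
    · rw [show -(n : ℤ) - 1 + 1 = -n by ring, show -((n + 1 : ℕ) : ℤ) = -n - 1 by push_cast; ring]
      push_cast; abel
    · simp
    · simp only [Finset.mem_insert, Finset.mem_Ico]; omega

variable {d : ℕ}

theorem dil_annulus (χ : Space d → ℝ) (i : ℤ) (ξ : Space d) :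
    dil (annulus χ) i ξ = dil χ (i + 1) ξ - dil χ i ξ := by
  rw [dil, dil, dil, annulus, Complex.ofReal_sub, smul_smul,
    show (1 / 2 : ℝ) * 2 ^ (-i) = 2 ^ (-(i + 1)) by
      rw [neg_add, zpow_add₀ two_ne_zero]; norm_num; ring]

theorem cv_dil_annulus {χ : Space d → ℝ} (hχ : IsCutoff χ) {p : ℝ} (hp : 1 < p)
    {f : Space d → ℂ} (hf : MemLp f (ENNReal.ofReal p) volume) (i : ℤ) (x : Space d) :
    cv (𝓕⁻ (dil (annulus χ) i)) f x =
      cv (𝓕⁻ (dil χ (i + 1))) f x - cv (𝓕⁻ (dil χ i)) f x := by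
  have hpq := Real.HolderConjugate.conjExponent hp
  have := hpq.symm.ennrealOfReal
  have h : ∀ y, 𝓕⁻ (dil (annulus χ) i) y = 𝓕⁻ (dil χ (i + 1)) y - 𝓕⁻ (dil χ i) y := by
    intro y
    rw [eq_sub_iff_add_eq, ← fourierInv_add_apply (integrable_dil hχ.isBump_annulus i)
      (integrable_dil hχ.isBump i)]
    refine congrArg (fun m : Space d → ℂ => (𝓕⁻ m : Space d → ℂ) y) (funext fun ξ => ?_)
    rw [dil_annulus, sub_add_cancel]
  unfold cv
  rw [← integral_sub (integrable_cv (memLp_fourierInv_dil hχ.isBump _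
    (ENNReal.ofReal p.conjExponent)) hf x) (integrable_cv (memLp_fourierInv_dil hχ.isBump _
    (ENNReal.ofReal p.conjExponent)) hf x)]
  simp_rw [h, sub_mul]

/-- Bernstein's inequality at frequency 2^{-n} gives a factor 2^{-n d/p}, which tends to zero
because d ≥ 1. No low frequency remainder survives in L^p. -/
theorem tendsto_cv_dil_neg (hd : 1 ≤ d) {χ : Space d → ℝ} (hχ : IsCutoff χ) {p : ℝ} (hp : 1 < p)
    {f : Space d → ℂ} (hf : MemLp f (ENNReal.ofReal p) volume) (x : Space d) :
    Tendsto (fun n : ℕ => cv (𝓕⁻ (dil χ (-n))) f x) atTop (𝓝 0) := by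
  obtain ⟨K, hK, h⟩ := exists_dil_bounds hχ.isBump hp
  have hα : (0 : ℝ) < d / p := by
    have : (1 : ℝ) ≤ d := by exact_mod_cast hd
    positivity
  rw [tendsto_iff_edist_tendsto_0]
  have h0 : Tendsto (fun n : ℕ => K * (((2 : ℝ≥0∞) ^ (-(d / p : ℝ))) ^ n *
      eLpNorm f (ENNReal.ofReal p) volume)) atTop (𝓝 0) := by
    have h1 := ENNReal.tendsto_pow_atTop_nhds_zero_of_lt_one
      (ENNReal.rpow_lt_one_of_one_lt_of_neg ENNReal.one_lt_two (neg_lt_zero.2 hα))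
    have h2 := ENNReal.Tendsto.const_mul (ENNReal.Tendsto.mul_const h1 (Or.inr hf.2.ne))
      (Or.inr hK)
    rwa [zero_mul, mul_zero] at h2
  refine tendsto_of_tendsto_of_tendsto_of_le_of_le tendsto_const_nhds h0 (fun _ => zero_le)
    fun n => ?_
  beta_reduce
  rw [edist_zero_right]
  refine ((h (-n) f hf).2 x).trans (le_of_eq ?_)
  rw [← ENNReal.rpow_natCast, ← ENNReal.rpow_mul]
  congr 3
  push_cast; ring

theorem IsCutoff.dil_eq_one {χ : Space d → ℝ} (hχ : IsCutoff χ) {n : ℤ} {ξ : Space d}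
    (h : ‖(2 * Real.pi) • ξ‖ ≤ 3 / 4 * 2 ^ n) : dil χ n ξ = 1 := by
  rw [dil, hχ.eq_one', Complex.ofReal_one]
  rw [norm_dil_arg, div_le_iff₀ (by positivity)]
  exact h

/-- The spectrum of the product lies in the ball of radius 2 · 16/3 · 2^{max(j,k)}. For n ≥ max(j,k)
+ 4 this is below 3/4 · 2^n, since 32/3 ≤ 12, and the cut-off equals 1 there. -/
theorem cv_dil_mul_decay {χ : Space d → ℝ} (hχ : IsCutoff χ) {p : ℝ} (hp : 1 < p) {a : ℝ}
    (ha : 0 < a) {j k n : ℤ} (hn : max j k + 4 ≤ n) {f g : Space d → ℂ}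
    (hf : MemLp f (ENNReal.ofReal p) volume) (hg : MemLp g (ENNReal.ofReal p) volume)
    (x : Space d) :
    cv (𝓕⁻ (dil χ n)) (fun y => cv (𝓕⁻ (decaySym χ a j)) f y * cv (𝓕⁻ (decaySym χ a k)) g y) x =
      cv (𝓕⁻ (decaySym χ a j)) f x * cv (𝓕⁻ (decaySym χ a k)) g x := by
  obtain ⟨S, hS⟩ := exists_schwartz_tendsto hp.le hf
  obtain ⟨R, hR⟩ := exists_schwartz_tendsto hp.le hg
  have hSm : ∀ n, MemLp (S n) (ENNReal.ofReal p) volume := fun n => (S n).memLp _ _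
  have hRm : ∀ n, MemLp (R n) (ENNReal.ofReal p) volume := fun n => (R n).memLp _ _
  refine tendsto_nhds_unique ((isSym_dil hχ.isBump n).tendsto_cv_mul (isSym_decaySym hχ ha j)
    (isSym_decaySym hχ ha k) hp hf hg hSm hRm hS hR x)
    ((((isSym_decaySym hχ ha j).tendsto hp hf hSm hS x).mul
      ((isSym_decaySym hχ ha k).tendsto hp hg hRm hR x)).congr fun l => ?_)
  rw [((isSym_dil hχ.isBump n).cv_mul_schwartz (isSym_decaySym hχ ha j)
    (isSym_decaySym hχ ha k) (continuous_decaySym hχ a j) (continuous_decaySym hχ a k)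
    (dil_hasCompactSupport hχ.isBump_fat j).mul_left (dil_hasCompactSupport hχ.isBump_fat k).mul_left
    (S l) (R l)).1, cv_fourierInv_schwartz (isSym_decaySym hχ ha j).integrable,
    cv_fourierInv_schwartz (isSym_decaySym hχ ha k).integrable]
  have hi : ∀ (j : ℤ) (S : 𝓢(Space d, ℂ)),
      Integrable fun ξ => decaySym χ a j ξ * (𝓕 S : 𝓢(Space d, ℂ)) ξ := fun j S => by
    obtain ⟨C, -, h⟩ := (isSym_decaySym hχ ha j).isMult 2 one_lt_two
    exact h.integrable (𝓕 S : 𝓢(Space d, ℂ)).integrable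
  have := congrFun (fourierInv_cv (hi j (S l)) (hi k (R l))) x
  rw [← this]
  refine congrArg (fun m : Space d → ℂ => (𝓕⁻ m : Space d → ℂ) x) (funext fun ξ => ?_)
  by_cases h : ‖(2 * Real.pi) • ξ‖ ≤ 3 / 4 * 2 ^ n
  · rw [hχ.dil_eq_one h, one_mul]
  · have h0 : cv (fun η => decaySym χ a k η * (𝓕 (R l) : 𝓢(Space d, ℂ)) η)
        (fun η => decaySym χ a j η * (𝓕 (S l) : 𝓢(Space d, ℂ)) η) ξ = 0 := by
      refine integral_eq_zero_of_ae (Eventually.of_forall fun η => ?_)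
      simp only [decaySym, Pi.zero_apply]
      by_cases hj : dil (fat χ) j η = 0
      · simp [hj]
      by_cases hk : dil (fat χ) k (ξ - η) = 0
      · simp [hk]
      refine (h ?_).elim
      have j2 := (hχ.dil_fat_ne_zero hj).2
      have k2 := (hχ.dil_fat_ne_zero hk).2
      have t1 := norm_add_le ((2 * Real.pi) • (ξ - η)) ((2 * Real.pi) • η)
      rw [← smul_add, sub_add_cancel] at t1
      have h1 : (2 : ℝ) ^ j ≤ 2 ^ max j k := zpow_le_zpow_right₀ one_le_two (le_max_left _ _)
      have h2 : (2 : ℝ) ^ k ≤ 2 ^ max j k := zpow_le_zpow_right₀ one_le_two (le_max_right _ _)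
      have h3 : (2 : ℝ) ^ max j k * 16 ≤ 2 ^ n := by
        calc (2 : ℝ) ^ max j k * 16 = 2 ^ (max j k + 4) := by
              rw [zpow_add₀ two_ne_zero]; norm_num
          _ ≤ 2 ^ n := zpow_le_zpow_right₀ one_le_two hn
      have h4 : (0 : ℝ) < 2 ^ max j k := by positivity
      linarith
    rw [h0, mul_zero]

/-- The Littlewood-Paley decomposition of a product of frequency localized functions. -/
theorem hasSum_cv_annulus_mul (hd : 1 ≤ d) {χ : Space d → ℝ} (hχ : IsCutoff χ) {p : ℝ}
    (hp : 1 < p) {a : ℝ} (ha : 0 < a) (j k : ℤ) {f g : Space d → ℂ}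
    (hf : MemLp f (ENNReal.ofReal p) volume) (hg : MemLp g (ENNReal.ofReal p) volume) (x : Space d)
    (hs : Summable fun i => cv (𝓕⁻ (dil (annulus χ) i)) (fun y =>
      cv (𝓕⁻ (decaySym χ a j)) f y * cv (𝓕⁻ (decaySym χ a k)) g y) x) :
    HasSum (fun i => cv (𝓕⁻ (dil (annulus χ) i)) (fun y =>
      cv (𝓕⁻ (decaySym χ a j)) f y * cv (𝓕⁻ (decaySym χ a k)) g y) x)
      (cv (𝓕⁻ (decaySym χ a j)) f x * cv (𝓕⁻ (decaySym χ a k)) g x) := by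
  have hm := memLp_mul_decay hχ ha j k hp hf hg
  convert hs.hasSum using 1
  refine tendsto_nhds_unique ?_ (hs.hasSum.comp tendsto_Ico_neg_atTop)
  have h1 := (tendsto_cv_dil_neg hd hχ hp hm x).const_sub
    (cv (𝓕⁻ (decaySym χ a j)) f x * cv (𝓕⁻ (decaySym χ a k)) g x)
  rw [sub_zero] at h1
  refine h1.congr' ?_
  filter_upwards [eventually_ge_atTop (max j k + 4).toNat] with n hn
  simp only [Function.comp_apply]
  simp_rw [cv_dil_annulus hχ hp hm]
  rw [sum_Ico_neg_sub fun i => cv (𝓕⁻ (dil χ i)) (fun y =>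
    cv (𝓕⁻ (decaySym χ a j)) f y * cv (𝓕⁻ (decaySym χ a k)) g y) x,
    cv_dil_mul_decay hχ hp ha (n := (n : ℤ)) (by omega) hf hg]

end Telescope

/-! ### Gevrey decompositions and their products. -/

section Decompositions

variable {d : ℕ}

/-- `U` is frequency localized around `2^j`. -/
structure IsLocalized (χ : Space d → ℝ) (p : ℝ) (j : ℤ) (U : Space d → ℂ) : Prop where
  memLp : MemLp U (ENNReal.ofReal p) volume
  loc : cv (𝓕⁻ (dil (fat χ) j)) U = U

/-- `z = e^{-aΛ₁} ∑_j U_j` with frequency localized functions `U_j` whose `L^p` norms are bounded by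
`c_j`. -/
structure IsDecomp (χ : Space d → ℝ) (p a : ℝ) (c : ℤ → ℝ≥0∞) (U : ℤ → Space d → ℂ)
    (z : Space d → ℂ) : Prop where
  localized : ∀ j, IsLocalized χ p j (U j)
  bound : ∀ j, eLpNorm (U j) (ENNReal.ofReal p) volume ≤ c j
  hasSum : ∀ x, HasSum (fun j => cv (kernel a) (U j) x) (z x)

variable {χ : Space d → ℝ} {p a : ℝ}

theorem memLp_kernel_conj (ha : 0 < a) (hp : 1 < p) :
    MemLp (kernel a : Space d → ℂ) (ENNReal.ofReal p.conjExponent) volume :=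
  memLp_kernel ha (by simpa using (Real.HolderConjugate.conjExponent hp).symm.lt.le)

theorem IsLocalized.cv_kernel {j : ℤ} {U : Space d → ℂ} (h : IsLocalized χ p j U)
    (hχ : IsCutoff χ) (hp : 1 < p) (ha : 0 < a) :
    cv (kernel a) U = cv (𝓕⁻ (decaySym χ a j)) U := by
  conv_lhs => rw [← h.loc]
  rw [(isSym_dil hχ.isBump_fat j).cv_cv (integrable_kernel ha)
    (fun q hq => memLp_kernel ha (by simpa using hq.le)) hp h.memLp, fourier_kernel ha]
  rfl

theorem IsLocalized.sub {j : ℤ} {U V : Space d → ℂ} (hU : IsLocalized χ p j U)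
    (hV : IsLocalized χ p j V) (hχ : IsCutoff χ) (hp : 1 < p) : IsLocalized χ p j (U - V) := by
  have hpq := Real.HolderConjugate.conjExponent hp
  have := hpq.symm.ennrealOfReal
  refine ⟨hU.memLp.sub hV.memLp, ?_⟩
  funext x
  rw [cv_sub_right (memLp_fourierInv_dil hχ.isBump_fat j (ENNReal.ofReal p.conjExponent))
    hU.memLp hV.memLp, hU.loc, hV.loc, Pi.sub_apply]

theorem IsLocalized.const_mul {j : ℤ} {U : Space d → ℂ} (hU : IsLocalized χ p j U) (b : ℂ) :
    IsLocalized χ p j (fun x => b * U x) := by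
  refine ⟨hU.memLp.const_mul b, ?_⟩
  funext x
  have := congrFun hU.loc x
  unfold cv at this ⊢
  conv_rhs => rw [← this, ← integral_const_mul]
  congr 1; funext y; ring

theorem exists_localized_bounds (hχ : IsCutoff χ) (hp : 1 < p) :
    ∃ K : ℝ≥0∞, K ≠ ⊤ ∧ ∀ (a : ℝ), 0 < a → ∀ (j : ℤ) (U : Space d → ℂ), IsLocalized χ p j U →
      ∀ x, ‖U x‖ₑ ≤ K * ((2 : ℝ≥0∞) ^ ((j : ℝ) * (d / p)) *
          eLpNorm U (ENNReal.ofReal p) volume) ∧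
        ‖cv (kernel a) U x‖ₑ ≤ K * ((2 : ℝ≥0∞) ^ ((j : ℝ) * (d / p)) *
          eLpNorm U (ENNReal.ofReal p) volume) := by
  obtain ⟨K, hK, h⟩ := exists_dil_bounds hχ.isBump_fat hp
  obtain ⟨K', hK', h'⟩ := exists_decay_bounds hχ hp
  refine ⟨K + K', by finiteness, fun a ha j U hU x => ⟨?_, ?_⟩⟩
  · have := (h j U hU.memLp).2 x
    rw [hU.loc] at this
    exact this.trans (mul_le_mul_left le_self_add _)
  · rw [hU.cv_kernel hχ hp ha]
    exact ((h' a ha j U hU.memLp).2 x).trans (mul_le_mul_left le_add_self _)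

theorem IsDecomp.mono {c c' : ℤ → ℝ≥0∞} {U : ℤ → Space d → ℂ} {z : Space d → ℂ}
    (h : IsDecomp χ p a c U z) (hc : ∀ j, c j ≤ c' j) : IsDecomp χ p a c' U z :=
  ⟨h.localized, fun j => (h.bound j).trans (hc j), h.hasSum⟩

theorem IsDecomp.const_mul {c : ℤ → ℝ≥0∞} {U : ℤ → Space d → ℂ} {z : Space d → ℂ}
    (h : IsDecomp χ p a c U z) (b : ℂ) :
    IsDecomp χ p a (fun j => ‖b‖ₑ * c j) (fun j x => b * U j x) (fun x => b * z x) := by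
  refine ⟨fun j => (h.localized j).const_mul b, fun j => ?_, fun x => ?_⟩
  · have : (fun x => b * U j x) = b • U j := rfl
    rw [this, eLpNorm_const_smul]
    exact mul_le_mul_right (h.bound j) _
  · have e : ∀ j, cv (kernel a) (fun x => b * U j x) x = b * cv (kernel a) (U j) x := fun j => by
      unfold cv
      rw [← integral_const_mul]
      congr 1; funext y; ring
    simp_rw [e]
    exact (h.hasSum x).mul_left b

theorem IsDecomp.sub {c c' e : ℤ → ℝ≥0∞} {U V : ℤ → Space d → ℂ} {z w : Space d → ℂ}
    (hU : IsDecomp χ p a c U z) (hV : IsDecomp χ p a c' V w) (hχ : IsCutoff χ) (hp : 1 < p)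
    (ha : 0 < a) (he : ∀ j, eLpNorm (U j - V j) (ENNReal.ofReal p) volume ≤ e j) :
    IsDecomp χ p a e (fun j => U j - V j) (z - w) := by
  have hpq := Real.HolderConjugate.conjExponent hp
  have := hpq.symm.ennrealOfReal
  refine ⟨fun j => (hU.localized j).sub (hV.localized j) hχ hp, he, fun x => ?_⟩
  have e : ∀ j, cv (kernel a) (U j - V j) x = cv (kernel a) (U j) x - cv (kernel a) (V j) x :=
    fun j => cv_sub_right (memLp_kernel_conj ha hp) (hU.localized j).memLp (hV.localized j).memLp x
  simp_rw [e]
  exact (hU.hasSum x).sub (hV.hasSum x)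

theorem tsum_enorm_le_besovSum {K : ℝ≥0∞} {c : ℤ → ℝ≥0∞} {f : ℤ → ℂ} {α : ℝ}
    (h : ∀ j, ‖f j‖ₑ ≤ K * ((2 : ℝ≥0∞) ^ ((j : ℝ) * α) * c j)) :
    ∑' j, ‖f j‖ₑ ≤ K * besovSum α c := by
  rw [besovSum, ← ENNReal.tsum_mul_left]
  exact ENNReal.tsum_le_tsum h

theorem le_besovSum {α : ℝ} {c : ℤ → ℝ≥0∞} (j : ℤ) :
    (2 : ℝ≥0∞) ^ ((j : ℝ) * α) * c j ≤ besovSum α c :=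
  ENNReal.le_tsum (f := fun j : ℤ => (2 : ℝ≥0∞) ^ ((j : ℝ) * α) * c j) j

theorem ne_top_of_besovSum {α : ℝ} {c : ℤ → ℝ≥0∞} (h : besovSum α c ≠ ⊤) (j : ℤ) : c j ≠ ⊤ := by
  intro hc
  have := ne_top_of_le_ne_top h (le_besovSum (α := α) (c := c) j)
  rw [hc, ENNReal.mul_top] at this
  · exact this rfl
  · exact (ENNReal.rpow_pos two_pos ENNReal.ofNat_ne_top).ne'

/-- The sum of countably many decompositions. -/
theorem IsDecomp.tsum {ι : Type*} [Countable ι] (hχ : IsCutoff χ) (hp : 1 < p) (ha : 0 < a)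
    {c : ι → ℤ → ℝ≥0∞} {U : ι → ℤ → Space d → ℂ} {z : ι → Space d → ℂ}
    (h : ∀ n, IsDecomp χ p a (c n) (U n) (z n)) (hc : ∑' n, besovSum (d / p) (c n) ≠ ⊤) :
    IsDecomp χ p a (fun j => ∑' n, c n j) (fun j x => ∑' n, U n j x) (fun x => ∑' n, z n x) ∧
      ∀ j x, ∑' n, ‖U n j x‖ₑ ≠ ⊤ := by
  have hpq := Real.HolderConjugate.conjExponent hp
  have := hpq.symm.ennrealOfReal
  have hp1 : 1 ≤ ENNReal.ofReal p := by simpa using hp.le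
  obtain ⟨K, hK, hb⟩ := exists_localized_bounds hχ hp
  have hc' : besovSum (d / p) (fun j => ∑' n, c n j) ≠ ⊤ := by rwa [besovSum_tsum]
  have hcj : ∀ j, ∑' n, c n j ≠ ⊤ := ne_top_of_besovSum hc'
  have hbU : ∀ n j x, ‖U n j x‖ₑ ≤ K * ((2 : ℝ≥0∞) ^ ((j : ℝ) * (d / p)) * c n j) :=
    fun n j x => ((hb a ha j _ ((h n).localized j) x).1).trans
      (mul_le_mul_right (mul_le_mul_right ((h n).bound j) _) _)
  have hbz : ∀ n j x, ‖cv (kernel a) (U n j) x‖ₑ ≤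
      K * ((2 : ℝ≥0∞) ^ ((j : ℝ) * (d / p)) * c n j) :=
    fun n j x => ((hb a ha j _ ((h n).localized j) x).2).trans
      (mul_le_mul_right (mul_le_mul_right ((h n).bound j) _) _)
  have hUs : ∀ j x, ∑' n, ‖U n j x‖ₑ ≠ ⊤ := by
    intro j x
    refine ne_top_of_le_ne_top ?_ (ENNReal.tsum_le_tsum fun n => hbU n j x)
    simp_rw [ENNReal.tsum_mul_left]
    exact ENNReal.mul_ne_top hK (ENNReal.mul_ne_top (two_rpow_ne_top _) (hcj j))
  have hNs : ∀ j, ∑' n, eLpNorm (U n j) (ENNReal.ofReal p) volume ≤ ∑' n, c n j :=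
    fun j => ENNReal.tsum_le_tsum fun n => (h n).bound j
  have hN : ∀ j, eLpNorm (fun x => ∑' n, U n j x) (ENNReal.ofReal p) volume ≤ ∑' n, c n j :=
    fun j => (eLpNorm_tsum_le hp1 (fun n => ((h n).localized j).memLp.1) (hUs j)).trans (hNs j)
  refine ⟨⟨fun j => ⟨⟨aestronglyMeasurable_tsum (fun n => ((h n).localized j).memLp.1) (hUs j),
    (hN j).trans_lt (hcj j).lt_top⟩, ?_⟩, hN, fun x => ?_⟩, hUs⟩
  · funext x
    have h1 := hasSum_cv (memLp_fourierInv_dil hχ.isBump_fat j (ENNReal.ofReal p.conjExponent))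
      (fun n => ((h n).localized j).memLp) (ne_top_of_le_ne_top (hcj j) (hNs j)) x
    simp_rw [fun n => ((h n).localized j).loc] at h1
    exact h1.unique (hasSum_of_tsum_enorm_ne_top (hUs j x))
  -- Absolute summability over both indices allows the sums in j and in n to be interchanged.
  · have hs : Summable fun nj : ℤ × ι => cv (kernel a) (U nj.2 nj.1) x := by
      refine (tsum_enorm_ne_top_iff_summable_norm.1 ?_).of_norm
      refine ne_top_of_le_ne_top (ENNReal.mul_ne_top hK hc')
        ((ENNReal.tsum_le_tsum fun nj : ℤ × ι => hbz nj.2 nj.1 x).trans (le_of_eq ?_))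
      rw [ENNReal.tsum_prod' (f := fun nj : ℤ × ι =>
        K * ((2 : ℝ≥0∞) ^ ((nj.1 : ℝ) * (d / p)) * c nj.2 nj.1))]
      simp_rw [ENNReal.tsum_mul_left]
      rfl
    have h1 := hs.hasSum.prod_fiberwise fun j => hasSum_cv (memLp_kernel_conj ha hp)
      (fun n => ((h n).localized j).memLp) (ne_top_of_le_ne_top (hcj j) (hNs j)) x
    convert h1 using 1
    have h2 := ((Equiv.prodComm ι ℤ).hasSum_iff.2 hs.hasSum).prod_fiberwise
      fun n => (h n).hasSum x
    exact h2.tsum_eq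

/-- The decomposition of the product of two frequency localized functions. -/
theorem exists_isDecomp_piece (hd : 1 ≤ d) (hχ : IsCutoff χ) {r : ℝ} (hp : 1 < p)
    (hpr : p ≤ r) (hpr' : p.conjExponent ≤ r) :
    ∃ K : ℝ≥0∞, K ≠ ⊤ ∧ ∀ (a : ℝ), 0 < a → ∀ (j k : ℤ) (U V : Space d → ℂ),
      IsLocalized χ p j U → IsLocalized χ p k V →
      IsDecomp χ p a (fun i => K * weight (d / p) (d / r) i j k *
          (eLpNorm U (ENNReal.ofReal p) volume * eLpNorm V (ENNReal.ofReal p) volume))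
        (fun i => piece χ a i j k U V) (fun x => cv (kernel a) U x * cv (kernel a) V x) := by
  obtain ⟨K, hK, h⟩ := exists_eLpNorm_piece_le hχ hp hpr hpr'
  refine ⟨K, hK, fun a ha j k U V hU hV => ?_⟩
  have hloc : ∀ i, IsLocalized χ p i (piece χ a i j k U V) := fun i =>
    ⟨memLp_piece hχ ha i j k hp hU.memLp hV.memLp, cv_fat_piece hχ ha i j k hp hU.memLp hV.memLp⟩
  refine ⟨hloc, fun i => h a ha i j k U V hU.memLp hV.memLp, fun x => ?_⟩
  obtain ⟨B, hB, hb⟩ := exists_localized_bounds hχ hp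
  simp_rw [cv_kernel_piece hχ ha _ j k hp hU.memLp hV.memLp]
  rw [hU.cv_kernel hχ hp ha, hV.cv_kernel hχ hp ha]
  refine hasSum_cv_annulus_mul hd hχ hp ha j k hU.memLp hV.memLp x ?_
  simp_rw [← cv_kernel_piece hχ ha _ j k hp hU.memLp hV.memLp]
  refine (tsum_enorm_ne_top_iff_summable_norm.1 ?_).of_norm
  have hr0 : 0 < r := by linarith
  have hd0 : (0 : ℝ) < d := by exact_mod_cast hd
  have hβ : (0 : ℝ) < d / r := by positivity
  have hα : (0 : ℝ) < d / p := by positivity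
  -- The critical regularity d/p is itself admissible, and the critical norm dominates the supremum
  -- of each piece; hence the output pieces are absolutely summable.
  obtain ⟨C, hC, hw⟩ := exists_tsum_weight_le hβ.le (by linarith : -(d / r : ℝ) < d / p) le_rfl
  refine ne_top_of_le_ne_top ?_ (tsum_enorm_le_besovSum fun i => ((hb a ha i _ (hloc i) x).2).trans
    (mul_le_mul_right (mul_le_mul_right (h a ha i j k U V hU.memLp hV.memLp) _) _))
  refine ENNReal.mul_ne_top hB ?_
  have e : besovSum (d / p) (fun i => K * weight (d / p) (d / r) i j k *
      (eLpNorm U (ENNReal.ofReal p) volume * eLpNorm V (ENNReal.ofReal p) volume)) =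
      K * (eLpNorm U (ENNReal.ofReal p) volume * eLpNorm V (ENNReal.ofReal p) volume) *
      ∑' i : ℤ, (2 : ℝ≥0∞) ^ ((i : ℝ) * (d / p)) * weight (d / p) (d / r) i j k := by
    unfold besovSum
    rw [← ENNReal.tsum_mul_left]
    congr 1; funext i; ring
  rw [e]
  refine ENNReal.mul_ne_top (ENNReal.mul_ne_top hK (ENNReal.mul_ne_top hU.memLp.2.ne
    hV.memLp.2.ne)) (ne_top_of_le_ne_top ?_ (hw j k))
  exact ENNReal.mul_ne_top hC (ENNReal.mul_ne_top (two_rpow_ne_top _) (two_rpow_ne_top _))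

/-- The decomposition of a product. -/
def prodDecomp (χ : Space d → ℝ) (a : ℝ) (U V : ℤ → Space d → ℂ) (i : ℤ) (x : Space d) : ℂ :=
  ∑' jk : ℤ × ℤ, piece χ a i jk.1 jk.2 (U jk.1) (V jk.2) x

theorem IsDecomp.summable_norm {c : ℤ → ℝ≥0∞} {U : ℤ → Space d → ℂ} {z : Space d → ℂ}
    (h : IsDecomp χ p a c U z) (hχ : IsCutoff χ) (hp : 1 < p) (ha : 0 < a)
    (hc : besovSum (d / p) c ≠ ⊤) (x : Space d) : Summable fun j => ‖cv (kernel a) (U j) x‖ := by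
  obtain ⟨B, hB, hb⟩ := exists_localized_bounds hχ hp
  refine tsum_enorm_ne_top_iff_summable_norm.1 ?_
  refine ne_top_of_le_ne_top (ENNReal.mul_ne_top hB hc) (tsum_enorm_le_besovSum fun i =>
    ((hb a ha i _ (h.localized i) x).2).trans (mul_le_mul_right (mul_le_mul_right (h.bound i) _) _))

theorem exists_isDecomp_mul (hd : 1 ≤ d) (hχ : IsCutoff χ) {r : ℝ} (hp : 1 < p)
    (hpr : p ≤ r) (hpr' : p.conjExponent ≤ r) :
    ∃ K : ℝ≥0∞, K ≠ ⊤ ∧ ∀ (a : ℝ), 0 < a → ∀ (c e : ℤ → ℝ≥0∞) (U V : ℤ → Space d → ℂ)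
      (z w : Space d → ℂ), IsDecomp χ p a c U z → IsDecomp χ p a e V w →
      besovSum (d / p) c ≠ ⊤ → besovSum (d / p) e ≠ ⊤ →
      IsDecomp χ p a (fun i => K * paraprod (d / p) (d / r) c e i) (prodDecomp χ a U V)
        (fun x => z x * w x) ∧
      ∀ i x, ∑' jk : ℤ × ℤ, ‖piece χ a i jk.1 jk.2 (U jk.1) (V jk.2) x‖ₑ ≠ ⊤ := by
  obtain ⟨K, hK, h⟩ := exists_isDecomp_piece hd hχ hp hpr hpr'
  refine ⟨K, hK, fun a ha c e U V z w hU hV hc he => ?_⟩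
  have h' : ∀ jk : ℤ × ℤ, IsDecomp χ p a
      (fun i => K * (weight (d / p) (d / r) i jk.1 jk.2 * (c jk.1 * e jk.2)))
      (fun i => piece χ a i jk.1 jk.2 (U jk.1) (V jk.2))
      (fun x => cv (kernel a) (U jk.1) x * cv (kernel a) (V jk.2) x) := fun jk =>
    (h a ha jk.1 jk.2 _ _ (hU.localized _) (hV.localized _)).mono fun i => by
      rw [mul_assoc]
      exact mul_le_mul_right (mul_le_mul_right (mul_le_mul' (hU.bound _) (hV.bound _)) _) _
  have hr0 : 0 < r := by linarith
  have hd0 : (0 : ℝ) < d := by exact_mod_cast hd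
  have hβ : (0 : ℝ) < d / r := by positivity
  have hα : (0 : ℝ) < d / p := by positivity
  obtain ⟨C, hC, hw⟩ := exists_besovSum_paraprod_le hβ.le (by linarith : -(d / r : ℝ) < d / p) le_rfl
  have hfin : ∑' jk : ℤ × ℤ, besovSum (d / p)
      (fun i => K * (weight (d / p) (d / r) i jk.1 jk.2 * (c jk.1 * e jk.2))) ≠ ⊤ := by
    rw [← besovSum_tsum]
    simp_rw [ENNReal.tsum_mul_left]
    rw [besovSum_const_mul]
    exact ENNReal.mul_ne_top hK (ne_top_of_le_ne_top (by finiteness) (hw c e))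
  obtain ⟨h1, h2⟩ := IsDecomp.tsum hχ hp ha h' hfin
  refine ⟨?_, h2⟩
  simp_rw [ENNReal.tsum_mul_left] at h1
  have ez : (fun x => z x * w x) = fun x => ∑' jk : ℤ × ℤ,
      cv (kernel a) (U jk.1) x * cv (kernel a) (V jk.2) x := by
    funext x
    rw [← (hU.hasSum x).tsum_eq, ← (hV.hasSum x).tsum_eq]
    exact tsum_mul_tsum_of_summable_norm (hU.summable_norm hχ hp ha hc x)
      (hV.summable_norm hχ hp ha he x)
  rw [ez]
  exact h1

end Decompositions

/-! ### Measurable dependence on time. -/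

section Time

variable {d : ℕ}

theorem stronglyMeasurable_cv {k f : ℝ → Space d → ℂ}
    (hk : StronglyMeasurable fun q : ℝ × Space d => k q.1 q.2)
    (hf : StronglyMeasurable fun q : ℝ × Space d => f q.1 q.2) :
    StronglyMeasurable fun q : ℝ × Space d => cv (k q.1) (f q.1) q.2 := by
  refine StronglyMeasurable.integral_prod_right'
    (f := fun r : (ℝ × Space d) × Space d => k r.1.1 (r.1.2 - r.2) * f r.1.1 r.2) ?_
  exact (hk.comp_measurable (by fun_prop :
    Measurable fun r : (ℝ × Space d) × Space d => (r.1.1, r.1.2 - r.2))).mul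
    (hf.comp_measurable (by fun_prop :
    Measurable fun r : (ℝ × Space d) × Space d => (r.1.1, r.2)))

theorem stronglyMeasurable_fourierInv {m : ℝ → Space d → ℂ}
    (hm : StronglyMeasurable fun q : ℝ × Space d => m q.1 q.2) :
    StronglyMeasurable fun q : ℝ × Space d => 𝓕⁻ (m q.1) q.2 := by
  simp_rw [Real.fourierInv_eq']
  refine StronglyMeasurable.integral_prod_right' (f := fun r : (ℝ × Space d) × Space d =>
    Complex.exp (↑(2 * Real.pi * inner ℝ r.2 r.1.2) * Complex.I) • m r.1.1 r.2) ?_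
  have hc : Continuous fun r : (ℝ × Space d) × Space d =>
      Complex.exp (↑(2 * Real.pi * inner ℝ r.2 r.1.2) * Complex.I) := by fun_prop
  refine hc.stronglyMeasurable.smul ?_
  exact hm.comp_measurable (by fun_prop :
    Measurable fun r : (ℝ × Space d) × Space d => (r.1.1, r.2))

theorem stronglyMeasurable_comp_fst {a : ℝ → ℝ} (ha : Measurable a) {f : ℝ × Space d → ℂ}
    (hf : Continuous f) : StronglyMeasurable fun q : ℝ × Space d => f (a q.1, q.2) := by
  have h2 : Measurable fun q : ℝ × Space d => (a q.1, q.2) :=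
    (ha.comp measurable_fst).prodMk measurable_snd
  exact hf.stronglyMeasurable.comp_measurable h2

/-- The kernel varies with time through a(t). Its symbol is jointly continuous in (a, ξ), and
measurability survives the parameter integrals that define the inverse transform and the
convolution. -/
theorem stronglyMeasurable_cv_shiftSym {χ : Space d → ℝ} (hχ : IsCutoff χ) {a : ℝ → ℝ}
    (ha : Measurable a) (ε : Fin d → Bool) (j : ℤ) {U : ℝ → Space d → ℂ}
    (hU : StronglyMeasurable fun q : ℝ × Space d => U q.1 q.2) :
    StronglyMeasurable fun q : ℝ × Space d =>
      cv (𝓕⁻ (shiftSym χ (a q.1) ε j)) (U q.1) q.2 := by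
  have h1 : Continuous fun z : ℝ × Space d => shiftSym χ z.1 ε j z.2 :=
    (continuous_shift_uncurry ε).mul ((continuous_dil hχ.isBump_fat j).comp continuous_snd)
  have h3 := stronglyMeasurable_comp_fst ha h1
  have h4 := stronglyMeasurable_fourierInv (m := fun t => shiftSym χ (a t) ε j) h3
  exact stronglyMeasurable_cv (k := fun t => 𝓕⁻ (shiftSym χ (a t) ε j)) (f := U) h4 hU

theorem stronglyMeasurable_piece {χ : Space d → ℝ} (hχ : IsCutoff χ) {a : ℝ → ℝ}
    (ha : Measurable a) (i j k : ℤ) {U V : ℝ → Space d → ℂ}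
    (hU : StronglyMeasurable fun q : ℝ × Space d => U q.1 q.2)
    (hV : StronglyMeasurable fun q : ℝ × Space d => V q.1 q.2) :
    StronglyMeasurable fun q : ℝ × Space d => piece χ (a q.1) i j k (U q.1) (V q.1) q.2 := by
  unfold piece
  refine Finset.stronglyMeasurable_fun_sum _ fun ε _ => ?_
  refine stronglyMeasurable_cv (k := fun _ => 𝓕⁻ (projSym χ ε i))
    (f := fun t y => cv (𝓕⁻ (shiftSym χ (a t) ε j)) (U t) y *
      cv (𝓕⁻ (shiftSym χ (a t) ε k)) (V t) y) ?_ ?_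
  · have h : StronglyMeasurable (𝓕⁻ (projSym χ ε i)) :=
      (continuous_fourierInv (isSym_projSym hχ ε i).integrable).stronglyMeasurable
    exact h.comp_measurable measurable_snd
  · exact (stronglyMeasurable_cv_shiftSym hχ ha ε j hU).mul
      (stronglyMeasurable_cv_shiftSym hχ ha ε k hV)

/-- A decomposition at each time, measurable in time. -/
structure IsTimeDecomp (χ : Space d → ℝ) (p : ℝ) (a : ℝ → ℝ) (c : ℤ → ℝ≥0∞)
    (z : ℝ → Space d → ℂ) (U : ℝ → ℤ → Space d → ℂ) : Prop where
  meas : ∀ j, StronglyMeasurable fun q : ℝ × Space d => U q.1 j q.2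
  decomp : ∀ t, IsDecomp χ p (a t) c (U t) (z t)

variable {χ : Space d → ℝ} {p : ℝ} {a : ℝ → ℝ}

theorem IsTimeDecomp.mono {c c' : ℤ → ℝ≥0∞} {U : ℝ → ℤ → Space d → ℂ} {z : ℝ → Space d → ℂ}
    (h : IsTimeDecomp χ p a c z U) (hc : ∀ j, c j ≤ c' j) : IsTimeDecomp χ p a c' z U :=
  ⟨h.meas, fun t => (h.decomp t).mono hc⟩

theorem IsTimeDecomp.const_mul {c : ℤ → ℝ≥0∞} {U : ℝ → ℤ → Space d → ℂ} {z : ℝ → Space d → ℂ}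
    (h : IsTimeDecomp χ p a c z U) (b : ℂ) :
    IsTimeDecomp χ p a (fun j => ‖b‖ₑ * c j) (fun t x => b * z t x)
      (fun t j x => b * U t j x) :=
  ⟨fun j => (h.meas j).const_mul b, fun t => (h.decomp t).const_mul b⟩

theorem IsTimeDecomp.tsum {ι : Type*} [Countable ι] (hχ : IsCutoff χ) (hp : 1 < p)
    (ha : ∀ t, 0 < a t) {c : ι → ℤ → ℝ≥0∞} {U : ι → ℝ → ℤ → Space d → ℂ}
    {z : ι → ℝ → Space d → ℂ} (h : ∀ n, IsTimeDecomp χ p a (c n) (z n) (U n))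
    (hc : ∑' n, besovSum (d / p) (c n) ≠ ⊤) :
    IsTimeDecomp χ p a (fun j => ∑' n, c n j) (fun t x => ∑' n, z n t x)
      (fun t j x => ∑' n, U n t j x) :=
  ⟨fun j => stronglyMeasurable_tsum (fun n => (h n).meas j) fun q =>
    (IsDecomp.tsum hχ hp (ha q.1) (fun n => (h n).decomp q.1) hc).2 j q.2,
    fun t => (IsDecomp.tsum hχ hp (ha t) (fun n => (h n).decomp t) hc).1⟩

theorem exists_isTimeDecomp_mul (hd : 1 ≤ d) (hχ : IsCutoff χ) {r : ℝ} (hp : 1 < p)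
    (hpr : p ≤ r) (hpr' : p.conjExponent ≤ r) :
    ∃ K : ℝ≥0∞, K ≠ ⊤ ∧ ∀ (a : ℝ → ℝ), Measurable a → (∀ t, 0 < a t) → ∀ (c e : ℤ → ℝ≥0∞)
      (z w : ℝ → Space d → ℂ) (U V : ℝ → ℤ → Space d → ℂ),
      IsTimeDecomp χ p a c z U → IsTimeDecomp χ p a e w V →
      besovSum (d / p) c ≠ ⊤ → besovSum (d / p) e ≠ ⊤ →
      IsTimeDecomp χ p a (fun i => K * paraprod (d / p) (d / r) c e i) (fun t x => z t x * w t x)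
        (fun t => prodDecomp χ (a t) (U t) (V t)) := by
  obtain ⟨K, hK, h⟩ := exists_isDecomp_mul hd hχ hp hpr hpr'
  refine ⟨K, hK, fun a ham ha c e z w U V hU hV hc he => ⟨fun i => ?_, fun t =>
    (h (a t) (ha t) c e _ _ _ _ (hU.decomp t) (hV.decomp t) hc he).1⟩⟩
  unfold prodDecomp
  exact stronglyMeasurable_tsum (f := fun (jk : ℤ × ℤ) (q : ℝ × Space d) =>
    piece χ (a q.1) i jk.1 jk.2 (U q.1 jk.1) (V q.1 jk.2) q.2)
    (fun jk => stronglyMeasurable_piece hχ ham i jk.1 jk.2 (U := fun t => U t jk.1)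
      (V := fun t => V t jk.2) (hU.meas jk.1) (hV.meas jk.2))
    fun q => (h (a q.1) (ha q.1) c e _ _ _ _ (hU.decomp q.1) (hV.decomp q.1) hc he).2 i q.2

end Time

/-! ### Power series and divided differences. -/

section PowerSeries

theorem exists_power_series {F : ℝ → ℝ} (hF : AnalyticAt ℝ F 0) : ∃ (b : ℕ → ℝ) (ρ C : ℝ), 0 < ρ ∧
    (∀ x : ℝ, |x| < ρ → HasSum (fun n => b n * x ^ n) (F x)) ∧ ∀ n, |b n| * ρ ^ n ≤ C := by
  obtain ⟨P, r, hP⟩ := hF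
  obtain ⟨ρ, hρ0, hρ⟩ := ENNReal.lt_iff_exists_nnreal_btwn.1 hP.r_pos
  obtain ⟨C, -, hC⟩ := P.norm_mul_pow_le_of_lt_radius (hρ.trans_le hP.r_le)
  refine ⟨P.coeff, ρ, C, by exact_mod_cast hρ0, fun x hx => ?_, fun n => ?_⟩
  · have hx' : x ∈ Metric.eball (0 : ℝ) r := by
      rw [Metric.mem_eball, edist_zero_right]
      refine lt_trans ?_ hρ
      rw [← ofReal_norm, Real.norm_eq_abs]
      exact (ENNReal.ofReal_lt_ofReal_iff_of_nonneg (abs_nonneg x)).2 hx |>.trans_le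
        (by rw [ENNReal.ofReal_coe_nnreal])
    have := hP.hasSum hx'
    rw [zero_add] at this
    simpa only [FormalMultilinearSeries.apply_eq_pow_smul_coeff, smul_eq_mul, mul_comm] using this
  · have := hC n
    rwa [FormalMultilinearSeries.norm_apply_eq_norm_coef, Real.norm_eq_abs] at this

/-- The factor m + 2 counts the monomials of degree m + 1 in a divided difference. Bernoulli's
inequality m + 2 ≤ 2(3/2)^m against (1/3)^m leaves a geometric series of ratio 1/2; this is why a
third of the radius is used. -/
theorem tsum_coeff_ne_top {b : ℕ → ℝ} {ρ C : ℝ} (hρ : 0 < ρ) (h : ∀ n, |b n| * ρ ^ n ≤ C) :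
    ∑' m : ℕ, (m + 2 : ℝ≥0∞) * (‖b (m + 2)‖ₑ * ENNReal.ofReal (ρ / 3) ^ m) ≠ ⊤ := by
  have hs : Summable fun m : ℕ => 2 * C / ρ ^ 2 * (1 / 2 : ℝ) ^ m :=
    (summable_geometric_of_lt_one (by norm_num) (by norm_num)).mul_left _
  refine ne_top_of_le_ne_top hs.tsum_ofReal_ne_top (ENNReal.tsum_le_tsum fun m => ?_)
  have e : (m + 2 : ℝ≥0∞) = ENNReal.ofReal (m + 2) := by
    rw [ENNReal.ofReal_add (by positivity) (by norm_num)]; simp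
  rw [e, ← ofReal_norm, ← ENNReal.ofReal_pow (by positivity), ← ENNReal.ofReal_mul (by positivity),
    ← ENNReal.ofReal_mul (by positivity)]
  refine ENNReal.ofReal_le_ofReal ?_
  have h1 : (m + 2 : ℝ) ≤ 2 * (3 / 2) ^ m := by
    have := one_add_mul_le_pow (a := (1 / 2 : ℝ)) (by norm_num) m
    norm_num at this ⊢
    linarith
  have h2 : |b (m + 2)| * ρ ^ m ≤ C / ρ ^ 2 := by
    rw [le_div_iff₀ (by positivity), mul_assoc, ← pow_add]; exact h (m + 2)
  calc (m + 2 : ℝ) * (‖b (m + 2)‖ * (ρ / 3) ^ m)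
      = (m + 2) * (1 / 3) ^ m * (|b (m + 2)| * ρ ^ m) := by
        rw [Real.norm_eq_abs, div_eq_mul_one_div ρ, mul_pow]; ring
    _ ≤ 2 * (3 / 2) ^ m * (1 / 3) ^ m * (C / ρ ^ 2) := by
        refine mul_le_mul (mul_le_mul_of_nonneg_right h1 (by positivity)) h2 (by positivity)
          (by positivity)
    _ = 2 * C / ρ ^ 2 * (1 / 2) ^ m := by
        rw [mul_assoc 2, ← mul_pow]; norm_num; ring

theorem tsum_sigma_fin (f : ℕ → ℝ≥0∞) :
    ∑' σ : Σ m : ℕ, Fin (m + 2), f σ.1 = ∑' m : ℕ, (m + 2 : ℝ≥0∞) * f m := by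
  rw [ENNReal.tsum_sigma']
  congr 1
  funext m
  simp

theorem tsum_enorm_ne_top_sigma {b : ℕ → ℝ} {ρ C : ℝ} (hρ : 0 < ρ)
    (h : ∀ n, |b n| * ρ ^ n ≤ C) {x y : ℝ} (hx : |x| ≤ ρ / 3) (hy : |y| ≤ ρ / 3) :
    ∑' σ : Σ m : ℕ, Fin (m + 2),
      ‖b (σ.1 + 2) * (y ^ (σ.2 : ℕ) * x ^ (σ.1 + 1 - (σ.2 : ℕ)))‖ₑ ≠ ⊤ := by
  have h1 : ∀ σ : Σ m : ℕ, Fin (m + 2),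
      ‖b (σ.1 + 2) * (y ^ (σ.2 : ℕ) * x ^ (σ.1 + 1 - (σ.2 : ℕ)))‖ₑ ≤
      ENNReal.ofReal (ρ / 3) * (‖b (σ.1 + 2)‖ₑ * ENNReal.ofReal (ρ / 3) ^ σ.1) := by
    rintro ⟨m, l⟩
    simp only
    rw [enorm_mul, enorm_mul, enorm_pow, enorm_pow]
    have hx' : ‖x‖ₑ ≤ ENNReal.ofReal (ρ / 3) := by
      rw [← ofReal_norm]; exact ENNReal.ofReal_le_ofReal hx
    have hy' : ‖y‖ₑ ≤ ENNReal.ofReal (ρ / 3) := by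
      rw [← ofReal_norm]; exact ENNReal.ofReal_le_ofReal hy
    calc ‖b (m + 2)‖ₑ * (‖y‖ₑ ^ (l : ℕ) * ‖x‖ₑ ^ (m + 1 - (l : ℕ)))
        ≤ ‖b (m + 2)‖ₑ * (ENNReal.ofReal (ρ / 3) ^ (l : ℕ) *
          ENNReal.ofReal (ρ / 3) ^ (m + 1 - (l : ℕ))) := by gcongr
      _ = _ := by
        rw [← pow_add, Nat.add_sub_cancel' (by omega), pow_succ]; ring
  refine ne_top_of_le_ne_top ?_ (ENNReal.tsum_le_tsum h1)
  rw [ENNReal.tsum_mul_left,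
    tsum_sigma_fin fun m => ‖b (m + 2)‖ₑ * ENNReal.ofReal (ρ / 3) ^ m]
  exact ENNReal.mul_ne_top ENNReal.ofReal_ne_top (tsum_coeff_ne_top hρ h)

/-- Factor y − x out of each y^n − x^n. The linear coefficient is kept apart because the divided
difference starts with the constant b₁, and nonzero constants do not belong to 𝓢'_h and have no
decomposition. -/
theorem sub_eq_tsum {F : ℝ → ℝ} {b : ℕ → ℝ} {ρ C : ℝ} (hρ : 0 < ρ)
    (hF : ∀ x : ℝ, |x| < ρ → HasSum (fun n => b n * x ^ n) (F x))
    (h : ∀ n, |b n| * ρ ^ n ≤ C) {x y : ℝ} (hx : |x| ≤ ρ / 3) (hy : |y| ≤ ρ / 3) :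
    F y - F x = b 1 * (y - x) + (y - x) * ∑' σ : Σ m : ℕ, Fin (m + 2),
      b (σ.1 + 2) * (y ^ (σ.2 : ℕ) * x ^ (σ.1 + 1 - (σ.2 : ℕ))) := by
  have hs := (tsum_enorm_ne_top_iff_summable_norm.1 (tsum_enorm_ne_top_sigma hρ h hx hy)).of_norm
  have h1 := (hF y (by linarith)).sub (hF x (by linarith))
  rw [← hasSum_nat_add_iff' 2] at h1
  rw [hs.tsum_sigma, ← tsum_mul_left]
  have h2 : ∀ m : ℕ, (y - x) * ∑' l : Fin (m + 2),
      b (m + 2) * (y ^ (l : ℕ) * x ^ (m + 1 - (l : ℕ))) =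
      b (m + 2) * y ^ (m + 2) - b (m + 2) * x ^ (m + 2) := by
    intro m
    rw [tsum_fintype, ← Finset.mul_sum,
      Fin.sum_univ_eq_sum_range (fun l => y ^ l * x ^ (m + 1 - l)) (m + 2)]
    have := geom_sum₂_mul y x (m + 2)
    rw [show m + 2 - 1 = m + 1 by omega] at this
    linear_combination b (m + 2) * this
  simp_rw [h2]
  rw [h1.tsum_eq, Finset.sum_range_succ, Finset.sum_range_one]
  ring

end PowerSeries

/-! ### Composition with an analytic function. -/

section Composition

variable {d : ℕ} {χ : Space d → ℝ} {p : ℝ}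

/-- The critical norm dominates the supremum norm by Bernstein's inequality. This brings the values
of z inside the disc where the power series represents F. -/
theorem exists_enorm_le_besovSum (hχ : IsCutoff χ) (hp : 1 < p) :
    ∃ B : ℝ≥0∞, B ≠ ⊤ ∧ ∀ (a : ℝ), 0 < a → ∀ (c : ℤ → ℝ≥0∞) (U : ℤ → Space d → ℂ)
      (z : Space d → ℂ), IsDecomp χ p a c U z → ∀ x, ‖z x‖ₑ ≤ B * besovSum (d / p) c := by
  obtain ⟨B, hB, hb⟩ := exists_localized_bounds hχ hp
  refine ⟨B, hB, fun a ha c U z h x => ?_⟩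
  rw [← (h.hasSum x).tsum_eq]
  refine enorm_tsum_le_tsum_enorm.trans (tsum_enorm_le_besovSum fun i =>
    ((hb a ha i _ (h.localized i) x).2).trans (mul_le_mul_right (mul_le_mul_right (h.bound i) _) _))

/-- Iterated products with a fixed sequence. -/
def iterProd (K : ℝ≥0∞) (α β : ℝ) (e : ℤ → ℝ≥0∞) : ℕ → ℤ → ℝ≥0∞
  | 0 => e
  | m + 1 => fun i => K * paraprod α β (iterProd K α β e m) e i

/-- `iterProd` at m majorizes monomials with m + 1 factors. Every additional factor costs K · C
times the critical norm of e, to be compared with the radius of convergence. -/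
theorem besovSum_iterProd_le {K C : ℝ≥0∞} {α β : ℝ} {e : ℤ → ℝ≥0∞}
    (hC : ∀ c e : ℤ → ℝ≥0∞, besovSum α (paraprod α β c e) ≤ C * (besovSum α c * besovSum α e))
    (m : ℕ) : besovSum α (iterProd K α β e m) ≤
      (K * C * besovSum α e) ^ m * besovSum α e := by
  induction m with
  | zero => simp [iterProd]
  | succ m ih =>
    rw [iterProd, besovSum_const_mul]
    calc K * besovSum α (paraprod α β (iterProd K α β e m) e)
        ≤ K * (C * (((K * C * besovSum α e) ^ m * besovSum α e) * besovSum α e)) :=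
          mul_le_mul_right ((hC _ _).trans (mul_le_mul_right (mul_le_mul_left ih _) _)) _
      _ = _ := by ring

theorem IsTimeDecomp.add {a : ℝ → ℝ} {c e : ℤ → ℝ≥0∞} {z w : ℝ → Space d → ℂ}
    {U V : ℝ → ℤ → Space d → ℂ} (hU : IsTimeDecomp χ p a c z U) (hV : IsTimeDecomp χ p a e w V)
    (hχ : IsCutoff χ) (hp : 1 < p) (ha : ∀ t, 0 < a t)
    (h : besovSum (d / p) (fun j => c j + e j) ≠ ⊤) :
    IsTimeDecomp χ p a (fun j => c j + e j) (fun t x => z t x + w t x)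
      (fun t j x => U t j x + V t j x) := by
  have hall : ∀ i : Bool, IsTimeDecomp χ p a (if i then c else e) (if i then z else w)
      (if i then U else V) := by
    intro i
    cases i
    exacts [hV, hU]
  have := IsTimeDecomp.tsum hχ hp ha hall (by
    rw [tsum_bool]
    simp only [if_true, Bool.false_eq_true, if_false]
    rwa [← besovSum_add, funext fun j => add_comm (e j) (c j)])
  simp only [tsum_bool, if_true, Bool.false_eq_true, if_false] at this
  simpa only [add_comm] using this

/-- One majorant e shared by both functions makes the bound depend on the degree alone and not on
how the factors are divided between z₁ and z₂. The decomposition is built by multiplying by one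
factor at a time. -/
theorem exists_isTimeDecomp_pow {K C : ℝ≥0∞} (hK : K ≠ ⊤) (hCt : C ≠ ⊤) {α β : ℝ} {a : ℝ → ℝ}
    (hα : α = d / p)
    (hC : ∀ c e : ℤ → ℝ≥0∞, besovSum α (paraprod α β c e) ≤ C * (besovSum α c * besovSum α e))
    (hmul : ∀ (c e : ℤ → ℝ≥0∞)
      (z w : ℝ → Space d → ℂ) (U V : ℝ → ℤ → Space d → ℂ),
      IsTimeDecomp χ p a c z U → IsTimeDecomp χ p a e w V →
      besovSum (d / p) c ≠ ⊤ → besovSum (d / p) e ≠ ⊤ →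
      IsTimeDecomp χ p a (fun i => K * paraprod α β c e i) (fun t x => z t x * w t x)
        (fun t => prodDecomp χ (a t) (U t) (V t)))
    {e : ℤ → ℝ≥0∞} (he : besovSum α e ≠ ⊤) {z₁ z₂ : ℝ → Space d → ℂ} {U₁ U₂ : ℝ → ℤ → Space d → ℂ}
    (h₁ : IsTimeDecomp χ p a e z₁ U₁) (h₂ : IsTimeDecomp χ p a e z₂ U₂) (m : ℕ) :
    ∀ l ≤ m + 1, ∃ V, IsTimeDecomp χ p a (iterProd K α β e m)
      (fun t x => z₂ t x ^ l * z₁ t x ^ (m + 1 - l)) V := by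
  subst hα
  have hfin : ∀ m, besovSum (d / p) (iterProd K (d / p) β e m) ≠ ⊤ := fun m =>
    ne_top_of_le_ne_top (by finiteness) (besovSum_iterProd_le hC m)
  induction m with
  | zero =>
    intro l hl
    interval_cases l
    · exact ⟨U₁, by simpa [iterProd] using h₁⟩
    · exact ⟨U₂, by simpa [iterProd] using h₂⟩
  | succ m ih =>
    intro l hl
    rcases Nat.lt_or_ge l (m + 2) with h | h
    · obtain ⟨V, hV⟩ := ih l (by omega)
      have := hmul _ e _ z₁ _ U₁ hV h₁ (hfin m) he
      have e1 : (fun (t : ℝ) x => z₂ t x ^ l * z₁ t x ^ (m + 1 + 1 - l)) =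
          fun t x => z₂ t x ^ l * z₁ t x ^ (m + 1 - l) * z₁ t x := by
        funext t x
        rw [show m + 1 + 1 - l = m + 1 - l + 1 by omega, pow_succ]; ring
      rw [e1]
      exact ⟨_, this⟩
    · obtain ⟨V, hV⟩ := ih (m + 1) le_rfl
      have := hmul _ e _ z₂ _ U₂ hV h₂ (hfin m) he
      have e1 : (fun (t : ℝ) x => z₂ t x ^ l * z₁ t x ^ (m + 1 + 1 - l)) =
          fun t x => z₂ t x ^ (m + 1) * z₁ t x ^ (m + 1 - (m + 1)) * z₂ t x := by
        funext t x
        rw [show l = m + 1 + 1 by omega, Nat.sub_self, Nat.sub_self, pow_succ]; ring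
      rw [e1]
      exact ⟨_, this⟩

/-- With y = z₂ − z₁ the output is b₁ y + y G. The divided difference G is estimated in the critical
norm only, so the smallness condition is fixed before s is chosen; then y is multiplied by G with y
in the s-norm. -/
theorem exists_isTimeDecomp_comp (hd : 1 ≤ d) (hχ : IsCutoff χ) {r : ℝ} (hp : 1 < p)
    (hpr : p ≤ r) (hpr' : p.conjExponent ≤ r) {F : ℝ → ℝ} (hF : AnalyticAt ℝ F 0) :
    ∃ R : ℝ, 0 < R ∧ ∀ s : ℝ, -(d / r : ℝ) < s → s ≤ d / p → ∃ D : ℝ≥0∞, D ≠ ⊤ ∧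
      ∀ (a : ℝ → ℝ), Measurable a → (∀ t, 0 < a t) → ∀ (c₁ c₂ cy : ℤ → ℝ≥0∞)
      (z₁ z₂ : ℝ → Space d → ℂ) (U₁ U₂ : ℝ → ℤ → Space d → ℂ),
      IsTimeDecomp χ p a c₁ z₁ U₁ → IsTimeDecomp χ p a c₂ z₂ U₂ →
      besovSum (d / p) c₁ ≤ ENNReal.ofReal R → besovSum (d / p) c₂ ≤ ENNReal.ofReal R →
      (∀ t j, eLpNorm (U₂ t j - U₁ t j) (ENNReal.ofReal p) volume ≤ cy j) →
      besovSum (d / p) cy ≠ ⊤ →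
      ∃ (c : ℤ → ℝ≥0∞) (w : ℝ → Space d → ℂ) (W : ℝ → ℤ → Space d → ℂ),
        IsTimeDecomp χ p a c w W ∧ besovSum (d / p) c ≠ ⊤ ∧ besovSum s c ≤ D * besovSum s cy ∧
        ∀ t x (ζ₁ ζ₂ : ℝ), z₁ t x = ζ₁ → z₂ t x = ζ₂ → w t x = ((F ζ₂ - F ζ₁ : ℝ) : ℂ) := by
  obtain ⟨b, ρ, M, hρ, hbF, hbM⟩ := exists_power_series hF
  obtain ⟨B, hB, hBz⟩ := exists_enorm_le_besovSum hχ hp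
  obtain ⟨K, hK, hmul⟩ := exists_isTimeDecomp_mul hd hχ hp hpr hpr'
  have hr0 : 0 < r := by linarith
  have hd0 : (0 : ℝ) < d := by exact_mod_cast hd
  have hβ : (0 : ℝ) < d / r := by positivity
  have hα : (0 : ℝ) < d / p := by positivity
  obtain ⟨C, hC, hpara⟩ :=
    exists_besovSum_paraprod_le hβ.le (by linarith : -(d / r : ℝ) < d / p) le_rfl
  set S := ∑' m : ℕ, (m + 2 : ℝ≥0∞) * (‖b (m + 2)‖ₑ * ENNReal.ofReal (ρ / 3) ^ m) with hS
  have hSt : S ≠ ⊤ := tsum_coeff_ne_top hρ hbM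
  -- The common majorant c₁ + c₂ has norm at most 2R: the first condition makes the series of
  -- majorants converge, the second keeps the values of z₁ and z₂ within ρ/3.
  obtain ⟨R, hR, hR1, hR2⟩ : ∃ R : ℝ, 0 < R ∧ K * C * (ENNReal.ofReal R + ENNReal.ofReal R) ≤
      ENNReal.ofReal (ρ / 3) ∧ B * ENNReal.ofReal R ≤ ENNReal.ofReal (ρ / 3) := by
    set Q : ℝ := 2 * (K * C).toReal + B.toReal + 1 with hQ
    have hQ0 : 0 < Q := by positivity
    refine ⟨ρ / 3 / Q, by positivity, ?_, ?_⟩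
    · have hKC : K * C ≠ ⊤ := ENNReal.mul_ne_top hK hC
      rw [← ENNReal.ofReal_toReal hKC, ← ENNReal.ofReal_add (by positivity) (by positivity),
        ← ENNReal.ofReal_mul (by positivity)]
      refine ENNReal.ofReal_le_ofReal ?_
      have : (K * C).toReal * (ρ / 3 / Q + ρ / 3 / Q) = ρ / 3 * (2 * (K * C).toReal / Q) := by ring
      rw [this]
      refine mul_le_of_le_one_right (by positivity) ?_
      rw [div_le_one hQ0, hQ]
      have : 0 ≤ B.toReal := ENNReal.toReal_nonneg
      linarith
    · rw [← ENNReal.ofReal_toReal hB, ← ENNReal.ofReal_mul (by positivity)]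
      refine ENNReal.ofReal_le_ofReal ?_
      have : B.toReal * (ρ / 3 / Q) = ρ / 3 * (B.toReal / Q) := by ring
      rw [this]
      refine mul_le_of_le_one_right (by positivity) ?_
      rw [div_le_one hQ0, hQ]
      have : 0 ≤ (K * C).toReal := ENNReal.toReal_nonneg
      linarith
  refine ⟨R, hR, fun s hs hs' => ?_⟩
  have hparaS := fun s hs hs' => exists_besovSum_paraprod_le (α := d / p) (s := s) hβ.le hs hs'
  set Rt := ENNReal.ofReal R + ENNReal.ofReal R with hRt
  have hRtt : Rt ≠ ⊤ := by finiteness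
  have hbound : ∀ s, -(d / r : ℝ) < s → s ≤ d / p → ∃ D : ℝ≥0∞, D ≠ ⊤ ∧
      ∀ cy eG : ℤ → ℝ≥0∞, besovSum (d / p) eG ≤ S * Rt →
      besovSum s (fun j => ‖((b 1 : ℝ) : ℂ)‖ₑ * cy j + K * paraprod (d / p) (d / r) cy eG j) ≤
        D * besovSum s cy := by
    intro s hs hs'
    obtain ⟨Cs, hCs, hCp⟩ := hparaS s hs hs'
    refine ⟨‖((b 1 : ℝ) : ℂ)‖ₑ + K * (Cs * (S * Rt)), ?_, fun cy eG he => ?_⟩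
    · exact ENNReal.add_ne_top.2 ⟨enorm_ne_top, by finiteness⟩
    · rw [besovSum_add, besovSum_const_mul, besovSum_const_mul, add_mul]
      refine add_le_add le_rfl ?_
      calc K * besovSum s (paraprod (d / p) (d / r) cy eG)
          ≤ K * (Cs * (besovSum s cy * (S * Rt))) :=
            mul_le_mul_right ((hCp _ _).trans (mul_le_mul_right (mul_le_mul_right he _) _)) _
        _ = _ := by ring
  obtain ⟨D, hD, hDb⟩ := hbound s hs hs'
  -- The critical case is needed besides s: it guarantees that the output has a finite critical norm
  -- even if the s-norm of the difference is infinite.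
  obtain ⟨D', hD', hDb'⟩ := hbound (d / p) (by linarith) le_rfl
  refine ⟨D, hD, fun a ham ha c₁ c₂ cy z₁ z₂ U₁ U₂ h₁ h₂ hc₁ hc₂ hcy hcyt => ?_⟩
  set e : ℤ → ℝ≥0∞ := fun j => c₁ j + c₂ j with he
  have heR : besovSum (d / p) e ≤ Rt := by
    rw [he, besovSum_add]; exact add_le_add hc₁ hc₂
  have het : besovSum (d / p) e ≠ ⊤ := ne_top_of_le_ne_top hRtt heR
  have h₁' : IsTimeDecomp χ p a e z₁ U₁ := h₁.mono fun j => le_self_add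
  have h₂' : IsTimeDecomp χ p a e z₂ U₂ := h₂.mono fun j => le_add_self
  have hy : IsTimeDecomp χ p a cy (fun t => z₂ t - z₁ t) (fun t j => U₂ t j - U₁ t j) :=
    ⟨fun j => (h₂.meas j).sub (h₁.meas j), fun t =>
      (h₂.decomp t).sub (h₁.decomp t) hχ hp (ha t) (hcy t)⟩
  have hpow := exists_isTimeDecomp_pow hK hC rfl hpara (hmul a ham ha) het h₁' h₂'
  choose V hV using hpow
  have hG : ∀ σ : Σ m : ℕ, Fin (m + 2), IsTimeDecomp χ p a
      (fun j => ‖((b (σ.1 + 2) : ℝ) : ℂ)‖ₑ * iterProd K (d / p) (d / r) e σ.1 j)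
      (fun t x => ((b (σ.1 + 2) : ℝ) : ℂ) * (z₂ t x ^ (σ.2 : ℕ) * z₁ t x ^ (σ.1 + 1 - (σ.2 : ℕ))))
      (fun t j x => ((b (σ.1 + 2) : ℝ) : ℂ) * V σ.1 σ.2 (by omega) t j x) := fun σ =>
    (hV σ.1 σ.2 (by omega)).const_mul _
  set eG : ℤ → ℝ≥0∞ := fun j => ∑' σ : Σ m : ℕ, Fin (m + 2),
    ‖((b (σ.1 + 2) : ℝ) : ℂ)‖ₑ * iterProd K (d / p) (d / r) e σ.1 j with heG
  have hGS : ∑' σ : Σ m : ℕ, Fin (m + 2), besovSum (d / p)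
      (fun j => ‖((b (σ.1 + 2) : ℝ) : ℂ)‖ₑ * iterProd K (d / p) (d / r) e σ.1 j) ≤ S * Rt := by
    simp_rw [besovSum_const_mul]
    rw [tsum_sigma_fin fun m => ‖((b (m + 2) : ℝ) : ℂ)‖ₑ *
      besovSum (d / p) (iterProd K (d / p) (d / r) e m), hS, ← ENNReal.tsum_mul_right]
    refine ENNReal.tsum_le_tsum fun m => ?_
    rw [mul_assoc, mul_assoc]
    refine mul_le_mul_right ?_ _
    have e1 : ‖((b (m + 2) : ℝ) : ℂ)‖ₑ = ‖b (m + 2)‖ₑ := by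
      rw [← ofReal_norm, ← ofReal_norm, Complex.norm_real]
    rw [e1]
    refine mul_le_mul_right ((besovSum_iterProd_le hpara m).trans ?_) _
    refine mul_le_mul' (pow_le_pow_left' ?_ m) heR
    exact (mul_le_mul_right heR _).trans hR1
  have heGS : besovSum (d / p) eG ≤ S * Rt := by rw [heG, besovSum_tsum]; exact hGS
  have hGt := IsTimeDecomp.tsum hχ hp ha hG (ne_top_of_le_ne_top (by finiteness) hGS)
  have hyG := hmul a ham ha _ _ _ _ _ _ hy hGt hcyt (ne_top_of_le_ne_top (by finiteness) heGS)
  have hby := hy.const_mul ((b 1 : ℝ) : ℂ)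
  have hfinal := hDb' cy eG heGS
  have hct : besovSum (d / p) (fun j => ‖((b 1 : ℝ) : ℂ)‖ₑ * cy j +
      K * paraprod (d / p) (d / r) cy eG j) ≠ ⊤ :=
    ne_top_of_le_ne_top (ENNReal.mul_ne_top hD' hcyt) hfinal
  have hadd := hby.add hyG hχ hp ha hct
  refine ⟨_, _, _, hadd, hct, hDb cy eG heGS, fun t x ζ₁ ζ₂ hζ₁ hζ₂ => ?_⟩
  have habs : ∀ (ζ : ℝ) (c : ℤ → ℝ≥0∞) (U : ℤ → Space d → ℂ) (z : Space d → ℂ),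
      IsDecomp χ p (a t) c U z → z x = ζ → besovSum (d / p) c ≤ ENNReal.ofReal R →
      |ζ| ≤ ρ / 3 := by
    intro ζ c U z h hz hc
    have := (hBz (a t) (ha t) c U z h x).trans ((mul_le_mul_right hc B).trans hR2)
    rw [hz, ← ofReal_norm, Complex.norm_real, Real.norm_eq_abs,
      ENNReal.ofReal_le_ofReal_iff (by positivity)] at this
    exact this
  rw [sub_eq_tsum hρ hbF hbM (habs ζ₁ _ _ _ (h₁.decomp t) hζ₁ hc₁)
    (habs ζ₂ _ _ _ (h₂.decomp t) hζ₂ hc₂)]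
  simp only [Pi.sub_apply, hζ₁, hζ₂]
  push_cast
  rfl

end Composition

/-! ### Functions as tempered distributions. -/

section Distributions

variable {d : ℕ} {f g : Space d → ℂ} {u v : 𝓢'(Space d, ℂ)}

/-- A smooth compactly supported real function as a complex Schwartz function. -/
def bumpS {θ : Space d → ℝ} (hθ : IsBump θ) : 𝓢(Space d, ℂ) :=
  (hθ.compact.comp_left (g := fun x : ℝ => (x : ℂ)) Complex.ofReal_zero).toSchwartzMap
    (Complex.ofRealCLM.contDiff.comp hθ.smooth)

theorem bumpS_apply {θ : Space d → ℝ} (hθ : IsBump θ) (x : Space d) :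
    bumpS hθ x = (θ x : ℂ) := rfl

theorem Represents.locallyIntegrable (h : Represents f u) : LocallyIntegrable f volume := by
  rw [locallyIntegrable_iff]
  intro K hK
  obtain ⟨R, hR⟩ := hK.isBounded.subset_closedBall (0 : Space d)
  let b : ContDiffBump (0 : Space d) := ⟨max R 1, max R 1 + 1, by positivity, by linarith⟩
  have hb : IsBump (b : Space d → ℝ) := ⟨b.contDiff, b.hasCompactSupport⟩
  refine ((h (bumpS hb)).1.integrableOn (s := K)).congr_fun (fun x hx => ?_) hK.measurableSet
  have : b x = 1 := b.one_of_mem_closedBall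
    (Metric.closedBall_subset_closedBall (le_max_left R 1) (hR hx))
  simp only [bumpS_apply, this, Complex.ofReal_one, one_mul]

theorem Represents.ae_eq (hf : Represents f u) (hg : Represents g u) : f =ᵐ[volume] g := by
  refine ae_eq_of_integral_contDiff_smul_eq hf.locallyIntegrable hg.locallyIntegrable
    fun θ h1 h2 => ?_
  have e := (hf (bumpS ⟨h1, h2⟩)).2.symm.trans (hg (bumpS ⟨h1, h2⟩)).2
  simpa only [bumpS_apply, Complex.real_smul] using e

theorem Represents.congr_ae (hf : Represents f u) (h : f =ᵐ[volume] g) : Represents g u := by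
  intro ψ
  have e : (fun x => ψ x * f x) =ᵐ[volume] fun x => ψ x * g x := by
    filter_upwards [h] with x hx
    rw [hx]
  exact ⟨(hf ψ).1.congr e, (hf ψ).2.trans (integral_congr_ae e)⟩

theorem Represents.sub (hf : Represents f u) (hg : Represents g v) :
    Represents (f - g) (u - v) := by
  intro ψ
  have e : (fun x => ψ x * (f - g) x) = fun x => ψ x * f x - ψ x * g x := by
    funext x; rw [Pi.sub_apply, mul_sub]
  rw [e]
  refine ⟨(hf ψ).1.sub (hg ψ).1, ?_⟩
  rw [integral_sub (hf ψ).1 (hg ψ).1, ← (hf ψ).2, ← (hg ψ).2]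
  rfl

theorem Represents.lpNorm_eq (hf : Represents f u) (p : ℝ≥0∞) :
    lpNorm p u = eLpNorm f p volume :=
  le_antisymm (iInf₂_le f hf) (le_iInf₂ fun _ hg => (eLpNorm_congr_ae (hf.ae_eq hg)).le)

theorem exists_represents {q : ℝ≥0∞} (hq : 1 ≤ q) (hf : MemLp f q volume) :
    ∃ u : 𝓢'(Space d, ℂ), Represents f u := by
  have : Fact (1 ≤ q) := ⟨hq⟩
  have := ENNReal.HolderConjugate.conjExponent hq
  refine ⟨Lp.toTemperedDistribution (hf.toLp f), fun ψ =>
    ⟨MemLp.integrable_mul (p := q.conjExponent) (q := q) (ψ.memLp _ volume) hf, ?_⟩⟩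
  rw [Lp.toTemperedDistribution_apply]
  refine integral_congr_ae ?_
  filter_upwards [hf.coeFn_toLp] with x hx
  rw [hx, smul_eq_mul]

theorem memLp_top_cv {k : Space d → ℂ} {p q : ℝ≥0∞} [ENNReal.HolderConjugate q p]
    (hk : MemLp k q volume) (hf : MemLp f p volume) : MemLp (cv k f) ⊤ volume := by
  refine ⟨aestronglyMeasurable_cv hk.1 hf.1, ?_⟩
  refine lt_of_le_of_lt ?_ (ENNReal.mul_lt_top hk.2 hf.2)
  rw [eLpNorm_exponent_top]
  exact eLpNormEssSup_le_of_ae_enorm_bound (.of_forall fun x => enorm_cv_le hk.1 hf.1 p q x)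

/-- On distributions the multiplier is defined by transposition. Its action on test functions is
convolution with the reflected kernel, which Fubini moves onto the function representing the
distribution. -/
theorem fourier_smulLeft_dil {θ : Space d → ℝ} (hθ : IsBump θ) (j : ℤ) (ψ : 𝓢(Space d, ℂ))
    (x : Space d) : (𝓕 (SchwartzMap.smulLeftCLM ℂ (dil θ j) (𝓕⁻ ψ)) : 𝓢(Space d, ℂ)) x =
      cv (fun s => 𝓕⁻ (dil θ j) (-s)) ψ x := by
  have hT : (dil θ j).HasTemperateGrowth := by
    rw [← dilS_apply hθ]; exact (dilS hθ j).hasTemperateGrowth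
  have e1 : ⇑(SchwartzMap.smulLeftCLM ℂ (dil θ j) (𝓕⁻ ψ)) =
      fun ξ => dil θ j ξ * 𝓕⁻ (ψ : Space d → ℂ) ξ := by
    funext ξ
    rw [SchwartzMap.smulLeftCLM_apply_apply hT, SchwartzMap.fourierInv_coe, smul_eq_mul]
  have e2 : cv (fun s => 𝓕⁻ (dil θ j) (-s)) ψ x = cv (𝓕⁻ (dil θ j)) (fun y => ψ (-y)) (-x) := by
    unfold cv
    rw [← integral_neg_eq_self]
    refine integral_congr_ae (.of_forall fun y => ?_)
    simp only [sub_neg_eq_add, neg_add]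
    congr 2
  have e3 : 𝓕 (fun y => ψ (-y)) = 𝓕⁻ (ψ : Space d → ℂ) := by
    funext ξ
    rw [Real.fourierInv_eq_fourier_comp_neg]
  rw [SchwartzMap.fourier_coe, e1, e2, cv_fourierInv_left (integrable_dil hθ j) ψ.integrable.comp_neg,
    e3, Real.fourierInv_eq_fourier_neg, neg_neg]

/-- The exponent q = ∞ is included on purpose: superpositions of localized functions are known to be
bounded but not to lie in L^p. -/
theorem Represents.multiplier {θ : Space d → ℝ} (hθ : IsBump θ) (j : ℤ) {q : ℝ≥0∞} (hq : 1 ≤ q)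
    (hf : MemLp f q volume) (h : Represents f u) :
    Represents (cv (𝓕⁻ (dil θ j)) f) (multiplier (fun ξ => θ ((2 : ℝ) ^ (-j) • ξ)) u) := by
  have := (ENNReal.HolderConjugate.conjExponent hq).symm
  have hk := memLp_fourierInv_dil hθ j q.conjExponent
  intro ψ
  refine ⟨MemLp.integrable_mul (p := 1) (q := ⊤) (ψ.memLp _ volume) (memLp_top_cv hk hf), ?_⟩
  rw [integral_mul_cv_of_integrable hk hf ψ.integrable]
  change u (𝓕 (SchwartzMap.smulLeftCLM ℂ (dil θ j) (𝓕⁻ ψ))) = _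
  rw [(h _).2]
  refine integral_congr_ae (.of_forall fun y => ?_)
  simp only
  rw [fourier_smulLeft_dil hθ, mul_comm]

end Distributions

/-! ### From decompositions back to 𝓢'_h. -/

section Superposition

variable {d : ℕ} {χ θ : Space d → ℝ} {p a : ℝ}

theorem IsLocalized.cv_dil (hχ : IsCutoff χ) (hθ : IsBump θ) (hp : 1 < p) {j k : ℤ}
    {U : Space d → ℂ} (h : IsLocalized χ p k U) : cv (𝓕⁻ (dil θ j)) U =
      cv (𝓕⁻ fun ξ => dil θ j ξ * dil (fat χ) k ξ) U := by
  conv_lhs => rw [← h.loc]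
  rw [(isSym_dil hχ.isBump_fat k).cv_cv (memLp_one_iff_integrable.1 (memLp_fourierInv_dil hθ j 1))
    (fun q _ => memLp_fourierInv_dil hθ j _) hp h.memLp, fourier_fourierInv_dil hθ]

theorem IsLocalized.cv_dil_cv_kernel (hχ : IsCutoff χ) (hθ : IsBump θ) (hp : 1 < p) (ha : 0 < a)
    {j k : ℤ} {U : Space d → ℂ} (h : IsLocalized χ p k U) :
    cv (𝓕⁻ (dil θ j)) (cv (kernel a) U) = cv (kernel a) (cv (𝓕⁻ (dil θ j)) U) := by
  have hs : IsSym fun ξ => dil θ j ξ * dil (fat χ) k ξ := IsMult.isSym_mul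
    (fun p hp => (isSym_dil hθ j).isMult p hp) (isSym_dil hχ.isBump_fat k)
  rw [h.cv_dil hχ hθ hp, hs.cv_cv (integrable_kernel ha)
    (fun q hq => memLp_kernel ha (by simpa using hq.le)) hp h.memLp, fourier_kernel ha,
    h.cv_kernel hχ hp ha, (isSym_decaySym hχ ha k).cv_cv
    (memLp_one_iff_integrable.1 (memLp_fourierInv_dil hθ j 1))
    (fun q _ => memLp_fourierInv_dil hθ j _) hp h.memLp, fourier_fourierInv_dil hθ]
  congr 2
  funext ξ
  rw [decaySym]
  ring

theorem cv_fourierInv_zero {m : Space d → ℂ} (hm : ∀ ξ, m ξ = 0) (f : Space d → ℂ) :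
    cv (𝓕⁻ m) f = 0 := by
  have : m = fun _ => 0 := funext hm
  funext x
  simp [this, cv, Real.fourierInv_eq']

theorem IsCutoff.dil_ne_zero (hχ : IsCutoff χ) {j : ℤ} {ξ : Space d} (h : dil χ j ξ ≠ 0) :
    ‖(2 * Real.pi) • ξ‖ ≤ 4 / 3 * 2 ^ j := by
  have h1 : χ ((2 : ℝ) ^ (-j) • ((2 * Real.pi) • ξ)) ≠ 0 := fun h0 => h (by
    rw [dil, h0, Complex.ofReal_zero])
  have h2 := hχ.support_subset (subset_tsupport _ h1)
  rwa [mem_closedBall_zero_iff, norm_dil_arg, div_le_iff₀ (by positivity)] at h2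

theorem IsCutoff.dil_mul_fat_eq_zero (hχ : IsCutoff χ) {j k : ℤ} (h : j + 2 ≤ k) (ξ : Space d) :
    dil χ j ξ * dil (fat χ) k ξ = 0 := by
  by_contra h0
  have h1 := hχ.dil_ne_zero (left_ne_zero_of_mul h0)
  have h2 := (hχ.dil_fat_ne_zero (right_ne_zero_of_mul h0)).1
  have h3 : (2 : ℝ) ^ k < 2 ^ (j + 2) := by
    rw [zpow_add₀ two_ne_zero]
    have : (0 : ℝ) < 2 ^ j := by positivity
    norm_num
    linarith
  exact absurd (zpow_two_lt h3) (by omega)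

theorem IsCutoff.dil_annulus_mul_fat_eq_zero (hχ : IsCutoff χ) {j k : ℤ}
    (h : k ∉ Finset.Icc (j - 2) (j + 2)) (ξ : Space d) :
    dil (annulus χ) j ξ * dil (fat χ) k ξ = 0 := by
  by_contra h0
  obtain ⟨h1, h1'⟩ := hχ.dil_annulus_ne_zero (left_ne_zero_of_mul h0)
  obtain ⟨h2, h2'⟩ := hχ.dil_fat_ne_zero (right_ne_zero_of_mul h0)
  have hj : (0 : ℝ) < 2 ^ j := by positivity
  have hk : (0 : ℝ) < 2 ^ k := by positivity
  have h3 : (2 : ℝ) ^ k < 2 ^ (j + 3) := by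
    rw [zpow_add₀ two_ne_zero]; norm_num; linarith
  have h4 : (2 : ℝ) ^ j < 2 ^ (k + 3) := by
    rw [zpow_add₀ two_ne_zero]; norm_num; linarith
  have h3' := zpow_two_lt h3
  have h4' := zpow_two_lt h4
  rw [Finset.mem_Icc] at h
  omega

theorem tendsto_tsum_lt_atBot {b : ℤ → ℝ≥0∞} (hb : ∑' k, b k ≠ ⊤) (m : ℤ) :
    Tendsto (fun j : ℤ => ∑' k : ℤ, if k < j + m then b k else 0) atBot (𝓝 0) := by
  rw [ENNReal.tendsto_nhds_zero]
  intro ε hε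
  obtain ⟨s, hs⟩ := ((ENNReal.tendsto_nhds_zero.1 (ENNReal.tendsto_tsum_compl_atTop_zero hb)) ε
    hε).exists
  obtain ⟨B, hB⟩ := s.bddBelow
  filter_upwards [eventually_le_atBot (B - m)] with j hj
  refine le_trans ?_ ((tsum_subtype {k | k ∉ s} b).symm.le.trans hs)
  refine ENNReal.tsum_le_tsum fun k => ?_
  split_ifs with h
  · rw [Set.indicator_of_mem]
    intro hk
    have := hB hk
    omega
  · exact zero_le

variable {g : ℤ → Space d → ℂ} {b : ℤ → ℝ≥0∞}

theorem memLp_top_of_enorm_le (hm : ∀ k, AEStronglyMeasurable (g k) volume)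
    (hb : ∀ k x, ‖g k x‖ₑ ≤ b k) (hbt : ∑' k, b k ≠ ⊤) (k : ℤ) :
    eLpNorm (g k) ⊤ volume ≤ b k ∧ MemLp (g k) ⊤ volume := by
  have h : eLpNorm (g k) ⊤ volume ≤ b k := by
    rw [eLpNorm_exponent_top]
    exact eLpNormEssSup_le_of_ae_enorm_bound (.of_forall (hb k))
  exact ⟨h, hm k, h.trans_lt (ENNReal.ne_top_of_tsum_ne_top hbt k).lt_top⟩

theorem memLp_top_tsum (hm : ∀ k, AEStronglyMeasurable (g k) volume)
    (hb : ∀ k x, ‖g k x‖ₑ ≤ b k) (hbt : ∑' k, b k ≠ ⊤) :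
    MemLp (fun x => ∑' k, g k x) ⊤ volume := by
  have h : ∀ x, ∑' k, ‖g k x‖ₑ ≠ ⊤ := fun x =>
    ne_top_of_le_ne_top hbt (ENNReal.tsum_le_tsum fun k => hb k x)
  refine ⟨aestronglyMeasurable_tsum hm h, (eLpNorm_tsum_le le_top hm h).trans_lt ?_⟩
  exact (ENNReal.tsum_le_tsum fun k =>
    (memLp_top_of_enorm_le hm hb hbt k).1).trans_lt hbt.lt_top

theorem cv_tsum (hm : ∀ k, AEStronglyMeasurable (g k) volume)
    (hb : ∀ k x, ‖g k x‖ₑ ≤ b k) (hbt : ∑' k, b k ≠ ⊤) {κ : Space d → ℂ} (hκ : MemLp κ 1 volume)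
    (x : Space d) : cv κ (fun y => ∑' k, g k y) x = ∑' k, cv κ (g k) x :=
  (hasSum_cv (q := 1) (p := ⊤) hκ (fun k => (memLp_top_of_enorm_le hm hb hbt k).2)
    (ne_top_of_le_ne_top hbt (ENNReal.tsum_le_tsum fun k =>
      (memLp_top_of_enorm_le hm hb hbt k).1)) x).tsum_eq.symm

/-- The cut-off Ṡ_j sees only the terms with k < j + 2. Its supremum norm is therefore at most a
fixed multiple of the tail of the convergent series of the b_k, which vanishes as j → −∞. -/
theorem homogeneousDist_of_tsum (hχ : IsCutoff χ) (hm : ∀ k, AEStronglyMeasurable (g k) volume)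
    (hb : ∀ k x, ‖g k x‖ₑ ≤ b k) (hbt : ∑' k, b k ≠ ⊤)
    (h0 : ∀ j k : ℤ, j + 2 ≤ k → cv (𝓕⁻ (dil χ j)) (g k) = 0) {u : 𝓢'(Space d, ℂ)}
    (hu : Represents (fun x => ∑' k, g k x) u) : HomogeneousDist χ u := by
  have hC : eLpNorm (𝓕⁻ (dil χ 0)) 1 volume ≠ ⊤ := (memLp_fourierInv_dil hχ.isBump 0 1).2.ne
  have ht := ENNReal.Tendsto.const_mul (a := eLpNorm (𝓕⁻ (dil χ 0)) 1 volume)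
    (tendsto_tsum_lt_atBot hbt 2) (Or.inr hC)
  rw [mul_zero] at ht
  refine tendsto_of_tendsto_of_tendsto_of_le_of_le tendsto_const_nhds ht (fun _ => zero_le)
    fun j => ?_
  have hr : Represents _ (lowFreq χ j u) :=
    hu.multiplier hχ.isBump j le_top (memLp_top_tsum hm hb hbt)
  have hk := memLp_fourierInv_dil hχ.isBump j 1
  simp only
  rw [hr.lpNorm_eq, eLpNorm_exponent_top]
  refine eLpNormEssSup_le_of_ae_enorm_bound (.of_forall fun x => ?_)
  rw [cv_tsum hm hb hbt hk, ← ENNReal.tsum_mul_left]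
  refine enorm_tsum_le_tsum_enorm.trans (ENNReal.tsum_le_tsum fun k => ?_)
  split_ifs with h
  · refine (enorm_cv_le hk.1 (hm k) ⊤ 1 x).trans ?_
    have := eLpNorm_fourierInv_dil hχ.isBump j (le_refl 1)
    have e : eLpNorm (𝓕⁻ (dil χ j)) 1 volume = eLpNorm (𝓕⁻ (dil χ 0)) 1 volume := by
      simpa using this
    rw [e]
    exact mul_le_mul_right (memLp_top_of_enorm_le hm hb hbt k).1 _
  · rw [h0 j k (by omega)]
    simp

theorem represents_block_tsum (hχ : IsCutoff χ) (hm : ∀ k, AEStronglyMeasurable (g k) volume)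
    (hb : ∀ k x, ‖g k x‖ₑ ≤ b k) (hbt : ∑' k, b k ≠ ⊤) {u : 𝓢'(Space d, ℂ)}
    (hu : Represents (fun x => ∑' k, g k x) u) (j : ℤ) :
    Represents (fun x => ∑' k, cv (𝓕⁻ (dil (annulus χ) j)) (g k) x) (block χ j u) := by
  have hr : Represents _ (block χ j u) :=
    hu.multiplier hχ.isBump_annulus j le_top (memLp_top_tsum hm hb hbt)
  refine hr.congr_ae (.of_forall fun x => ?_)
  exact cv_tsum hm hb hbt (memLp_fourierInv_dil hχ.isBump_annulus j 1) x

/-- Superpositions of frequency localized functions are elements of `𝓢'_h`. -/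
theorem exists_isExp_of_isDecomp (hχ : IsCutoff χ) (hp : 1 < p) :
    ∃ K : ℝ≥0∞, K ≠ ⊤ ∧ ∀ (a : ℝ), 0 < a → ∀ (c : ℤ → ℝ≥0∞) (U : ℤ → Space d → ℂ)
      (z : Space d → ℂ), IsDecomp χ p a c U z → besovSum (d / p) c ≠ ⊤ →
      ∃ u V : 𝓢'(Space d, ℂ), Represents z u ∧ Represents (fun x => ∑' k, U k x) V ∧
        IsExp χ a u V ∧ ∀ j, lpNorm (ENNReal.ofReal p) (block χ j V) ≤
          K * ∑ k ∈ Finset.Icc (j - 2) (j + 2), c k := by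
  obtain ⟨B, hB, hBd⟩ := exists_localized_bounds hχ hp
  obtain ⟨K, hK, hKd⟩ := exists_dil_bounds hχ.isBump_annulus hp
  have hp1 : 1 ≤ ENNReal.ofReal p := by simpa using hp.le
  refine ⟨K, hK, fun a ha c U z h hc => ?_⟩
  set b : ℤ → ℝ≥0∞ := fun k => B * ((2 : ℝ≥0∞) ^ ((k : ℝ) * (d / p)) * c k) with hbdef
  have hbt : ∑' k, b k ≠ ⊤ := by
    rw [hbdef, ENNReal.tsum_mul_left]
    exact ENNReal.mul_ne_top hB hc
  have hUb : ∀ k x, ‖U k x‖ₑ ≤ b k := fun k x => ((hBd a ha k _ (h.localized k) x).1).trans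
    (mul_le_mul_right (mul_le_mul_right (h.bound k) _) _)
  have hzb : ∀ k x, ‖cv (kernel a) (U k) x‖ₑ ≤ b k := fun k x =>
    ((hBd a ha k _ (h.localized k) x).2).trans
      (mul_le_mul_right (mul_le_mul_right (h.bound k) _) _)
  have hUm : ∀ k, AEStronglyMeasurable (U k) volume := fun k => (h.localized k).memLp.1
  have hk1 := memLp_kernel (d := d) ha (le_refl 1)
  have hzm : ∀ k, AEStronglyMeasurable (cv (kernel a) (U k)) volume := fun k =>
    aestronglyMeasurable_cv hk1.1 (hUm k)
  have hz : (fun x => ∑' k, cv (kernel a) (U k) x) = z := funext fun x => (h.hasSum x).tsum_eq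
  obtain ⟨V, hV⟩ := exists_represents le_top (memLp_top_tsum hUm hUb hbt)
  obtain ⟨u, hu⟩ := exists_represents le_top (memLp_top_tsum hzm hzb hbt)
  have hκ := memLp_fourierInv_dil hχ.isBump_annulus (d := d)
  have hcb : ∀ j k x, ‖cv (𝓕⁻ (dil (annulus χ) j)) (U k) x‖ₑ ≤
      eLpNorm (𝓕⁻ (dil (annulus χ) j)) 1 volume * b k := fun j k x =>
    (enorm_cv_le (hκ j 1).1 (hUm k) ⊤ 1 x).trans
      (mul_le_mul_right (memLp_top_of_enorm_le hUm hUb hbt k).1 _)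
  have hct : ∀ j, ∑' k, eLpNorm (𝓕⁻ (dil (annulus χ) j)) 1 volume * b k ≠ ⊤ := fun j => by
    rw [ENNReal.tsum_mul_left]; exact ENNReal.mul_ne_top (hκ j 1).2.ne hbt
  have hcm : ∀ j k, AEStronglyMeasurable (cv (𝓕⁻ (dil (annulus χ) j)) (U k)) volume := fun j k =>
    aestronglyMeasurable_cv (hκ j 1).1 (hUm k)
  have hbV := represents_block_tsum hχ hUm hUb hbt hV
  have hbu := represents_block_tsum hχ hzm hzb hbt hu
  have hnorm : ∀ j, eLpNorm (fun x => ∑' k, cv (𝓕⁻ (dil (annulus χ) j)) (U k) x)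
      (ENNReal.ofReal p) volume ≤ K * ∑ k ∈ Finset.Icc (j - 2) (j + 2), c k := by
    intro j
    refine (eLpNorm_tsum_le hp1 (hcm j) fun x => ne_top_of_le_ne_top (hct j)
      (ENNReal.tsum_le_tsum fun k => hcb j k x)).trans ?_
    rw [tsum_eq_sum (s := Finset.Icc (j - 2) (j + 2)) fun k hk => ?_, Finset.mul_sum]
    · exact Finset.sum_le_sum fun k _ => ((hKd j _ (h.localized k).memLp).1).trans
        (mul_le_mul_right (h.bound k) _)
    · rw [(h.localized k).cv_dil hχ hχ.isBump_annulus hp,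
        cv_fourierInv_zero (hχ.dil_annulus_mul_fat_eq_zero hk)]
      simp
  refine ⟨u, V, hz ▸ hu, hV, ⟨?_, ?_, fun j => ?_⟩, fun j => ?_⟩
  · refine homogeneousDist_of_tsum hχ hzm hzb hbt (fun j k hjk => ?_) hu
    rw [(h.localized k).cv_dil_cv_kernel hχ hχ.isBump hp ha, (h.localized k).cv_dil hχ hχ.isBump hp,
      cv_fourierInv_zero (hχ.dil_mul_fat_eq_zero hjk)]
    funext x
    simp [cv]
  · refine homogeneousDist_of_tsum hχ hUm hUb hbt (fun j k hjk => ?_) hV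
    rw [(h.localized k).cv_dil hχ hχ.isBump hp, cv_fourierInv_zero (hχ.dil_mul_fat_eq_zero hjk)]
  -- Any Lebesgue exponent is allowed for the blocks; L^∞ is the one directly provided by the
  -- summability of the sup norms.
  · refine ⟨_, ⊤, le_top, memLp_top_tsum (hcm j) (hcb j) (hct j), hbV j, ?_⟩
    refine (hbu j).congr_ae (.of_forall fun x => ?_)
    change _ = cv (kernel a) _ x
    rw [cv_tsum (hcm j) (hcb j) (hct j) hk1]
    exact tsum_congr fun k => by
      rw [(h.localized k).cv_dil_cv_kernel hχ hχ.isBump_annulus hp ha]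
  · rw [(hbV j).lpNorm_eq]
    exact hnorm j

end Superposition

/-! ### Dilated cut-offs on Schwartz functions. -/

section LowFrequencies

variable {E : Type*} [NormedAddCommGroup E] [NormedSpace ℝ E]

/-- Dilated cut-offs converge to the identity on Schwartz functions. -/
theorem tendsto_smulLeftCLM_dilation (φ g : 𝓢(E, ℂ)) {c : ℝ} (hc : 0 < c)
    (h : ∀ ξ, ‖ξ‖ ≤ c → φ ξ = 1) {r : ℕ → ℝ} (hr : Tendsto r atTop (𝓝 0)) (hr0 : ∀ n, 0 < r n)
    (hr1 : ∀ n, r n ≤ 1) (hT : ∀ n, (fun ξ => φ (r n • ξ)).HasTemperateGrowth) :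
    Tendsto (fun n => SchwartzMap.smulLeftCLM ℂ (fun ξ => φ (r n • ξ)) g) atTop (𝓝 g) := by
  rw [(schwartz_withSeminorms ℝ E ℂ).tendsto_nhds]
  rintro ⟨k, n⟩ ε hε
  set S : ℝ := ∑ i ∈ Finset.range (n + 1), (n.choose i : ℝ) *
    ((SchwartzMap.seminorm ℝ 0 i φ + 1) * SchwartzMap.seminorm ℝ (k + 1) (n - i) g / c) with hS
  have hS0 : 0 ≤ S := Finset.sum_nonneg fun i _ => by
    have := apply_nonneg (SchwartzMap.seminorm ℝ 0 i) φ
    have := apply_nonneg (SchwartzMap.seminorm ℝ (k + 1) (n - i)) g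
    positivity
  have hlim : Tendsto (fun N => S * r N) atTop (𝓝 0) := by
    simpa using hr.const_mul S
  filter_upwards [hlim.eventually (gt_mem_nhds hε)] with N hN
  refine lt_of_le_of_lt (SchwartzMap.seminorm_le_bound ℝ k n _
    (mul_nonneg hS0 (hr0 N).le) fun x => ?_) hN
  have hsm : ContDiff ℝ ∞ (fun ξ => φ (r N • ξ)) :=
    (φ.smooth ⊤).comp (contDiff_id.const_smul (r N))
  set F : E → ℂ := fun ξ => φ (r N • ξ) - 1 with hF
  have hFs : ContDiff ℝ ∞ F := hsm.sub contDiff_const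
  have e : ⇑(SchwartzMap.smulLeftCLM ℂ (fun ξ => φ (r N • ξ)) g - g) = fun ξ => F ξ * g ξ := by
    funext ξ
    rw [sub_apply, SchwartzMap.smulLeftCLM_apply_apply (hT N), hF, smul_eq_mul]
    ring
  have hFi : ∀ i : ℕ, ‖iteratedFDeriv ℝ i F x‖ ≤ SchwartzMap.seminorm ℝ 0 i φ + 1 := by
    intro i
    have h1 : ‖iteratedFDeriv ℝ i (fun ξ => φ (r N • ξ)) x‖ ≤ SchwartzMap.seminorm ℝ 0 i φ := by
      rw [iteratedFDeriv_comp_const_smul (r N) (φ.smooth i)]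
      simp only
      rw [norm_smul, norm_pow, Real.norm_of_nonneg (hr0 N).le]
      refine (mul_le_of_le_one_left (norm_nonneg _) (pow_le_one₀ (hr0 N).le (hr1 N))).trans ?_
      exact φ.norm_iteratedFDeriv_le_seminorm ℝ i _
    have h2 : ‖iteratedFDeriv ℝ i (fun _ : E => (1 : ℂ)) x‖ ≤ 1 := by
      rcases eq_or_ne i 0 with rfl | hi
      · rw [norm_iteratedFDeriv_zero]; simp
      · rw [iteratedFDeriv_const_of_ne hi]; simp
    have h3 : iteratedFDeriv ℝ i F x = iteratedFDeriv ℝ i (fun ξ => φ (r N • ξ)) x -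
        iteratedFDeriv ℝ i (fun _ : E => (1 : ℂ)) x :=
      iteratedFDeriv_sub_apply (hsm.of_le (by exact_mod_cast le_top)).contDiffAt
        contDiffAt_const
    rw [h3]
    exact (norm_sub_le _ _).trans (add_le_add h1 h2)
  have hFz : ∀ i : ℕ, r N * ‖x‖ < c → iteratedFDeriv ℝ i F x = 0 := by
    intro i hx
    have : F =ᶠ[𝓝 x] fun _ => 0 := by
      have ho : ∀ᶠ y in 𝓝 x, r N * ‖y‖ < c :=
        (continuous_const.mul continuous_norm).continuousAt.eventually (gt_mem_nhds hx)
      filter_upwards [ho] with y hy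
      rw [hF]
      simp only
      rw [h _ (by rw [norm_smul, Real.norm_of_nonneg (hr0 N).le]; exact hy.le), sub_self]
    rw [Filter.EventuallyEq.eq_of_nhds (Filter.EventuallyEq.iteratedFDeriv ℝ this i)]
    simp
  rw [e]
  have hL := norm_iteratedFDeriv_mul_le hFs (g.smooth ⊤) x (n := n) (by exact_mod_cast le_top)
  calc ‖x‖ ^ k * ‖iteratedFDeriv ℝ n (fun ξ => F ξ * g ξ) x‖
      ≤ ‖x‖ ^ k * ∑ i ∈ Finset.range (n + 1), (n.choose i : ℝ) * ‖iteratedFDeriv ℝ i F x‖ *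
          ‖iteratedFDeriv ℝ (n - i) g x‖ := mul_le_mul_of_nonneg_left hL (by positivity)
    _ ≤ S * r N := by
      rw [hS, Finset.mul_sum, Finset.sum_mul]
      refine Finset.sum_le_sum fun i _ => ?_
      rw [mul_assoc, mul_left_comm, mul_assoc]
      refine mul_le_mul_of_nonneg_left ?_ (by positivity)
      have hs0 := apply_nonneg (SchwartzMap.seminorm ℝ 0 i) φ
      have hs1 := apply_nonneg (SchwartzMap.seminorm ℝ (k + 1) (n - i)) g
      have hrN := hr0 N
      -- Near the origin φ(r·) − 1 and its derivatives vanish. Elsewhere 1 ≤ r‖x‖/c buys a factor r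
      -- at the price of one more power of ‖x‖ in the seminorm of g.
      rcases lt_or_ge (r N * ‖x‖) c with hx | hx
      · rw [hFz i hx, norm_zero, zero_mul, mul_zero]
        positivity
      · calc ‖x‖ ^ k * (‖iteratedFDeriv ℝ i F x‖ * ‖iteratedFDeriv ℝ (n - i) g x‖)
            = ‖iteratedFDeriv ℝ i F x‖ * (‖x‖ ^ k * ‖iteratedFDeriv ℝ (n - i) g x‖ * 1) := by ring
          _ ≤ (SchwartzMap.seminorm ℝ 0 i φ + 1) *
              (‖x‖ ^ k * ‖iteratedFDeriv ℝ (n - i) g x‖ * (r N * ‖x‖ / c)) := by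
            refine mul_le_mul (hFi i) (mul_le_mul_of_nonneg_left ?_ (by positivity))
              (by positivity) (by positivity)
            rwa [le_div_iff₀ hc, one_mul]
          _ = (SchwartzMap.seminorm ℝ 0 i φ + 1) *
              (‖x‖ ^ (k + 1) * ‖iteratedFDeriv ℝ (n - i) g x‖) / c * r N := by ring
          _ ≤ _ := by
            refine mul_le_mul_of_nonneg_right (div_le_div_of_nonneg_right
              (mul_le_mul_of_nonneg_left (g.le_seminorm ℝ (k + 1) (n - i) x) (by positivity))
              hc.le) hrN.le

end LowFrequencies

/-! ### Reconstruction of a distribution from its dyadic blocks. -/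

section Reconstruction

variable {d : ℕ} {χ : Space d → ℝ}

theorem hasTemperateGrowth_dil {θ : Space d → ℝ} (hθ : IsBump θ) (j : ℤ) :
    (dil θ j).HasTemperateGrowth := by
  rw [← dilS_apply hθ]; exact (dilS hθ j).hasTemperateGrowth

theorem dil_comp_smul (θ : Space d → ℝ) (n : ℕ) :
    dil θ n = fun ξ => dil θ 0 ((1 / 2 : ℝ) ^ n • ξ) := by
  funext ξ
  have : (2 : ℝ) ^ (-(n : ℤ)) • (2 * Real.pi) • ξ =
      (2 : ℝ) ^ (-(0 : ℤ)) • (2 * Real.pi) • ((1 / 2 : ℝ) ^ n • ξ) := by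
    simp only [smul_smul]
    congr 1
    rw [zpow_neg, zpow_natCast, one_div, inv_pow, neg_zero, zpow_zero]
    ring
  rw [dil, dil, this]

theorem tendsto_lowFreq (hχ : IsCutoff χ) (u : 𝓢'(Space d, ℂ)) (ψ : 𝓢(Space d, ℂ)) :
    Tendsto (fun n : ℕ => lowFreq χ n u ψ) atTop (𝓝 (u ψ)) := by
  have h1 := tendsto_smulLeftCLM_dilation (dilS hχ.isBump 0) (𝓕⁻ ψ) (c := 3 / 4 / (2 * Real.pi))
    (by positivity) (fun ξ hξ => ?_) (r := fun n => (1 / 2 : ℝ) ^ n)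
    (tendsto_pow_atTop_nhds_zero_of_lt_one (by norm_num) (by norm_num)) (fun n => by positivity)
    (fun n => pow_le_one₀ (by norm_num) (by norm_num)) fun n => ?_
  · have h2 : Continuous fun g : 𝓢(Space d, ℂ) => u (𝓕 g : 𝓢(Space d, ℂ)) :=
      u.continuous.comp (FourierTransform.continuous_fourier (E := 𝓢(Space d, ℂ)))
    have h3 := (h2.tendsto _).comp h1
    rw [FourierTransform.fourier_fourierInv_eq] at h3
    refine h3.congr fun n => ?_
    change u (𝓕 (SchwartzMap.smulLeftCLM ℂ (fun ξ => dil χ 0 ((1 / 2 : ℝ) ^ n • ξ)) (𝓕⁻ ψ))) = _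
    rw [← dil_comp_smul]
    rfl
  · rw [dilS_apply]
    refine hχ.dil_eq_one ?_
    rw [norm_smul, Real.norm_of_nonneg (by positivity), zpow_zero, mul_one]
    rwa [le_div_iff₀ (by positivity), mul_comm] at hξ
  · rw [dilS_apply, ← dil_comp_smul]
    exact hasTemperateGrowth_dil hχ.isBump n

/-- Here membership in 𝓢'_h enters the reconstruction: it excludes a polynomial remainder, which the
dyadic blocks cannot detect. -/
theorem tendsto_lowFreq_neg {u : 𝓢'(Space d, ℂ)} (hu : HomogeneousDist χ u)
    (ψ : 𝓢(Space d, ℂ)) : Tendsto (fun n : ℕ => lowFreq χ (-n) u ψ) atTop (𝓝 0) := by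
  have hψ : eLpNorm ψ 1 volume ≠ ⊤ := (ψ.memLp 1 volume).2.ne
  have hn : Tendsto (fun n : ℕ => (-n : ℤ)) atTop atBot :=
    tendsto_neg_atTop_atBot.comp tendsto_natCast_atTop_atTop
  have h := hu.comp hn
  have h1 := ENNReal.Tendsto.const_mul (a := eLpNorm ψ 1 volume) h (Or.inr hψ)
  rw [mul_zero] at h1
  refine tendsto_zero_iff_enorm_tendsto_zero.2 ?_
  refine tendsto_of_tendsto_of_tendsto_of_le_of_le' tendsto_const_nhds h1
    (.of_forall fun _ => zero_le) ?_
  filter_upwards [h.eventually (gt_mem_nhds zero_lt_one)] with n hn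
  -- The norm is infinite on distributions that are not functions, so a norm below 1 yields a
  -- representing function.
  have hex : ∃ f : Space d → ℂ, Represents f (lowFreq χ (-n) u) := by
    by_contra hc
    have : lpNorm ⊤ (lowFreq χ (-n) u) = ⊤ := by
      simp only [lpNorm, iInf_eq_top]
      exact fun f hf => absurd ⟨f, hf⟩ hc
    simp only [Function.comp_apply] at hn
    rw [this] at hn
    exact absurd hn (by simp)
  obtain ⟨f, hf⟩ := hex
  simp only [Function.comp_apply]
  rw [hf.lpNorm_eq, (hf ψ).2]
  refine (enorm_integral_le_lintegral_enorm _).trans ?_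
  have := eLpNorm_smul_le_mul_eLpNorm (p := 1) (q := ⊤) (r := 1) hf.locallyIntegrable.aestronglyMeasurable
    (ψ.memLp 1 volume).1
  rw [eLpNorm_one_eq_lintegral_enorm] at this
  simpa using this

theorem block_apply_eq_sub (hχ : IsCutoff χ) (i : ℤ) (u : 𝓢'(Space d, ℂ)) (ψ : 𝓢(Space d, ℂ)) :
    block χ i u ψ = lowFreq χ (i + 1) u ψ - lowFreq χ i u ψ := by
  change u (𝓕 (SchwartzMap.smulLeftCLM ℂ (dil (annulus χ) i) (𝓕⁻ ψ))) =
    u (𝓕 (SchwartzMap.smulLeftCLM ℂ (dil χ (i + 1)) (𝓕⁻ ψ))) -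
      u (𝓕 (SchwartzMap.smulLeftCLM ℂ (dil χ i) (𝓕⁻ ψ)))
  have : SchwartzMap.smulLeftCLM ℂ (dil (annulus χ) i) (𝓕⁻ ψ) =
      SchwartzMap.smulLeftCLM ℂ (dil χ (i + 1)) (𝓕⁻ ψ) -
        SchwartzMap.smulLeftCLM ℂ (dil χ i) (𝓕⁻ ψ) := by
    ext ξ
    rw [sub_apply, SchwartzMap.smulLeftCLM_apply_apply (hasTemperateGrowth_dil hχ.isBump_annulus i),
      SchwartzMap.smulLeftCLM_apply_apply (hasTemperateGrowth_dil hχ.isBump _),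
      SchwartzMap.smulLeftCLM_apply_apply (hasTemperateGrowth_dil hχ.isBump _), dil_annulus, sub_smul]
  rw [this, ← map_sub]
  exact congrArg u (map_sub (FourierTransform.fourierCLM ℂ 𝓢(Space d, ℂ)) _ _)

/-- An element of `𝓢'_h` is the sum of its dyadic blocks. -/
theorem ae_eq_tsum_of_blocks (hχ : IsCutoff χ) {u : 𝓢'(Space d, ℂ)} (hu : HomogeneousDist χ u)
    {z : Space d → ℂ} (hz : Represents z u) {g : ℤ → Space d → ℂ} {b : ℤ → ℝ≥0∞}
    (hm : ∀ k, AEStronglyMeasurable (g k) volume) (hb : ∀ k x, ‖g k x‖ₑ ≤ b k)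
    (hbt : ∑' k, b k ≠ ⊤) (hg : ∀ k, Represents (g k) (block χ k u)) :
    z =ᵐ[volume] fun x => ∑' k, g k x := by
  obtain ⟨v, hv⟩ := exists_represents le_top (memLp_top_tsum hm hb hbt)
  have huv : u = v := by
    ext ψ
    -- The symmetric partial sums of the blocks telescope to Ṡ_n u − Ṡ_{-n} u, which tends to u.
    have h1 := ((tendsto_lowFreq hχ u ψ).sub (tendsto_lowFreq_neg hu ψ))
    rw [sub_zero] at h1
    have h2 : (fun n : ℕ => lowFreq χ n u ψ - lowFreq χ (-n) u ψ) =
        fun n : ℕ => ∑ i ∈ Finset.Ico (-(n : ℤ)) n, block χ i u ψ := by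
      funext n
      rw [← sum_Ico_neg_sub fun i => lowFreq χ i u ψ]
      exact Finset.sum_congr rfl fun i _ => (block_apply_eq_sub hχ i u ψ).symm
    rw [h2] at h1
    -- Pairing with ψ is convolution with the reflected ψ evaluated at 0, so the termwise
    -- integration of series applies.
    have h3 := hasSum_cv (q := 1) (p := ⊤) (k := fun s => ψ (-s))
      ((ψ.memLp 1 volume).comp_measurePreserving (Measure.measurePreserving_neg volume))
      (fun k => (memLp_top_of_enorm_le hm hb hbt k).2)
      (ne_top_of_le_ne_top hbt (ENNReal.tsum_le_tsum fun k =>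
        (memLp_top_of_enorm_le hm hb hbt k).1)) 0
    simp only [cv, zero_sub, neg_neg] at h3
    rw [← (hv ψ).2] at h3
    simp_rw [← fun k => (hg k ψ).2] at h3
    exact tendsto_nhds_unique h1 (h3.comp tendsto_Ico_neg_atTop)
  rw [huv] at hz
  exact hz.ae_eq hv

end Reconstruction

/-! ### Dyadic blocks as localized functions. -/

section Blocks

variable {d : ℕ} {χ : Space d → ℝ} {p a : ℝ}

/-- The reflected and translated kernel of the enlarged dyadic block. -/
def fatTest (hχ : IsCutoff χ) (j : ℤ) (x : Space d) : 𝓢(Space d, ℂ) :=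
  SchwartzMap.compCLMOfAntilipschitz ℂ (g := fun y => x - y) (K := 1) (by fun_prop)
    (fun _ _ => by simp [edist_dist, dist_eq_norm, norm_sub_rev]) (𝓕⁻ (dilS hχ.isBump_fat j))

theorem fatTest_apply (hχ : IsCutoff χ) (j : ℤ) (x y : Space d) :
    fatTest hχ j x y = 𝓕⁻ (dil (fat χ) j) (x - y) := by
  rw [← fourierInv_dilS hχ.isBump_fat]
  rfl

/-- Since the enlarged cut-off acts as the identity on a block, evaluating the block on these test
functions gives a canonical representative. It involves no choice, and at each fixed point it is a
pairing with a fixed test function, hence measurable in time. -/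
theorem Represents.apply_fatTest (hχ : IsCutoff χ) {f : Space d → ℂ} {v : 𝓢'(Space d, ℂ)}
    (h : Represents f v) (j : ℤ) (x : Space d) :
    v (fatTest hχ j x) = cv (𝓕⁻ (dil (fat χ) j)) f x := by
  rw [(h _).2]
  exact integral_congr_ae (.of_forall fun y => by simp only [fatTest_apply])

theorem multiplier_fat_block (hχ : IsCutoff χ) (j : ℤ) (v : 𝓢'(Space d, ℂ)) :
    multiplier (fun ξ => fat χ ((2 : ℝ) ^ (-j) • ξ)) (block χ j v) = block χ j v := by
  change TemperedDistribution.fourierMultiplierCLM ℂ (dil (fat χ) j)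
    (TemperedDistribution.fourierMultiplierCLM ℂ (dil (annulus χ) j) v) =
      TemperedDistribution.fourierMultiplierCLM ℂ (dil (annulus χ) j) v
  rw [TemperedDistribution.fourierMultiplierCLM_fourierMultiplierCLM_apply
    (hasTemperateGrowth_dil hχ.isBump_annulus j) (hasTemperateGrowth_dil hχ.isBump_fat j)]
  congr 2
  funext ξ
  rw [Pi.mul_apply, mul_comm, hχ.dil_fat_mul_dil_annulus]

theorem continuous_cv_dil {θ : Space d → ℝ} (hθ : IsBump θ) (j : ℤ) (hp : 1 < p) {f : Space d → ℂ}
    (hf : MemLp f (ENNReal.ofReal p) volume) : Continuous (cv (𝓕⁻ (dil θ j)) f) := by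
  have := (Real.HolderConjugate.conjExponent hp).symm.ennrealOfReal
  have hκ := memLp_fourierInv_dil hθ j (ENNReal.ofReal p.conjExponent)
  obtain ⟨S, hS⟩ := exists_schwartz_tendsto hp.le hf
  have hSm : ∀ n, MemLp (S n) (ENNReal.ofReal p) volume := fun n => (S n).memLp _ _
  have h0 := ENNReal.Tendsto.const_mul
    (a := eLpNorm (𝓕⁻ (dil θ j)) (ENNReal.ofReal p.conjExponent) volume) hS (Or.inr hκ.2.ne)
  rw [mul_zero] at h0
  have hu : TendstoUniformly (fun n => cv (𝓕⁻ (dil θ j)) (S n)) (cv (𝓕⁻ (dil θ j)) f) atTop := by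
    rw [EMetric.tendstoUniformly_iff]
    intro ε hε
    filter_upwards [h0.eventually (gt_mem_nhds hε)] with n hn x
    rw [edist_eq_enorm_sub, ← cv_sub_right hκ hf (hSm n)]
    exact (enorm_cv_le hκ.1 (hf.sub (hSm n)).1 _ _ x).trans_lt hn
  refine hu.continuous (.of_forall fun n => ?_)
  rw [cv_fourierInv_schwartz (integrable_dil hθ j)]
  refine continuous_fourierInv ?_
  exact (((𝓕 (S n) : 𝓢(Space d, ℂ)).integrable).bdd_mul (c := (SchwartzMap.seminorm ℝ 0 0 (dilS hθ j)))
    (continuous_dil hθ j).aestronglyMeasurable (.of_forall fun ξ => by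
      rw [← dilS_apply hθ]; exact (dilS hθ j).norm_le_seminorm ℝ ξ))

/-- The dyadic blocks of an element of a homogeneous Besov space in the domain of `e^{aΛ₁}`. -/
theorem IsExp.isDecomp (hχ : IsCutoff χ) (hp : 1 < p) (ha : 0 < a) {u Z : 𝓢'(Space d, ℂ)}
    (h : IsExp χ a u Z) {c : ℤ → ℝ≥0∞}
    (hc : ∀ j, lpNorm (ENNReal.ofReal p) (block χ j Z) ≤ c j) (hct : besovSum (d / p) c ≠ ⊤)
    {z : Space d → ℂ} (hz : Represents z u) :
    (∀ j, Represents (fun x => block χ j Z (fatTest hχ j x)) (block χ j Z) ∧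
      Continuous fun x => block χ j Z (fatTest hχ j x)) ∧
    IsDecomp χ p a c (fun j x => block χ j Z (fatTest hχ j x))
      (fun x => ∑' j, cv (kernel a) (fun y => block χ j Z (fatTest hχ j y)) x) ∧
    z =ᵐ[volume] fun x => ∑' j, cv (kernel a) (fun y => block χ j Z (fatTest hχ j y)) x := by
  set U : ℤ → Space d → ℂ := fun j x => block χ j Z (fatTest hχ j x) with hU
  have key : ∀ j, Represents (U j) (block χ j Z) ∧ Continuous (U j) ∧ IsLocalized χ p j (U j) ∧
      eLpNorm (U j) (ENNReal.ofReal p) volume ≤ c j ∧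
      Represents (cv (kernel a) (U j)) (block χ j u) := by
    intro j
    obtain ⟨f, q, hq, hfq, hf, hfu⟩ := h.blocks j
    have hUf : U j = cv (𝓕⁻ (dil (fat χ) j)) f := funext fun x => hf.apply_fatTest hχ j x
    -- The exponent q supplied by `IsExp` is unrelated to p; membership in L^p comes from the finite
    -- majorant c_j.
    have hfp : MemLp f (ENNReal.ofReal p) volume := by
      refine ⟨hfq.1, ?_⟩
      rw [← hf.lpNorm_eq]
      exact (hc j).trans_lt (ne_top_of_besovSum hct j).lt_top
    have hUr : Represents (U j) (block χ j Z) := by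
      have := hf.multiplier hχ.isBump_fat j hq hfq
      rw [multiplier_fat_block hχ] at this
      rwa [hUf]
    have hae := hUr.ae_eq hf
    refine ⟨hUr, ?_, ⟨hfp.ae_eq hae.symm, ?_⟩, ?_, ?_⟩
    · rw [hUf]
      exact continuous_cv_dil hχ.isBump_fat j hp hfp
    · conv_rhs => rw [hUf]
      exact cv_congr_ae hae
    · rw [← hUr.lpNorm_eq]
      exact hc j
    · rw [cv_congr_ae hae]
      exact hfu
  obtain ⟨B, hB, hBd⟩ := exists_localized_bounds hχ hp
  have hb : ∀ k x, ‖cv (kernel a) (U k) x‖ₑ ≤ B * ((2 : ℝ≥0∞) ^ ((k : ℝ) * (d / p)) * c k) :=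
    fun k x => ((hBd a ha k _ (key k).2.2.1 x).2).trans
      (mul_le_mul_right (mul_le_mul_right (key k).2.2.2.1 _) _)
  have hbt : ∑' k : ℤ, B * ((2 : ℝ≥0∞) ^ ((k : ℝ) * (d / p)) * c k) ≠ ⊤ := by
    rw [ENNReal.tsum_mul_left]
    exact ENNReal.mul_ne_top hB hct
  refine ⟨fun j => ⟨(key j).1, (key j).2.1⟩, ⟨fun j => (key j).2.2.1, fun j => (key j).2.2.2.1,
    fun x => hasSum_of_tsum_enorm_ne_top (ne_top_of_le_ne_top hbt
      (ENNReal.tsum_le_tsum fun k => hb k x))⟩, ?_⟩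
  exact ae_eq_tsum_of_blocks hχ h.source hz (fun k => aestronglyMeasurable_cv
    (memLp_kernel ha (le_refl 1)).1 (key k).2.2.1.memLp.1) hb hbt fun k => (key k).2.2.2.2

end Blocks

/-! ### Blocks as jointly measurable functions of time and space. -/

section TimeBlocks

variable {d : ℕ} {χ : Space d → ℝ} {p : ℝ}

/-- Continuity in x carries measurability in t from a dense sequence of points to all points, and
then to both variables jointly. -/
theorem stronglyMeasurable_uncurry_of_dense {f : ℝ → Space d → ℂ} (hc : ∀ t, Continuous (f t))
    (hm : ∀ n, StronglyMeasurable fun t => f t (TopologicalSpace.denseSeq (Space d) n)) :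
    StronglyMeasurable fun q : ℝ × Space d => f q.1 q.2 := by
  have h : ∀ x, StronglyMeasurable fun t => f t x := by
    intro x
    obtain ⟨y, hy, hyx⟩ := mem_closure_iff_seq_limit.1
      (TopologicalSpace.denseRange_denseSeq (Space d) x)
    choose n hn using hy
    refine stronglyMeasurable_of_tendsto atTop (fun k => hm (n k)) (tendsto_pi_nhds.2 fun t => ?_)
    simp_rw [hn]
    exact ((hc t).tendsto x).comp hyx
  have := stronglyMeasurable_uncurry_of_continuous_of_stronglyMeasurable (u := fun x t => f t x)
    (fun t => hc t) h
  exact this.comp_measurable measurable_swap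

/-- Every almost everywhere condition involved is indexed by the countable set of pairs (block,
dense point), so all of them hold on one measurable set of full measure in the interval. The blocks
are replaced by zero off that set, so continuity in space holds at every time. -/
theorem IsGevrey.exists_blocks (hχ : IsCutoff χ) (hp : 1 < p) {c₀ : ℝ} (hc₀ : 0 < c₀) {T : ℝ≥0∞}
    {z : ℝ → Space d → ℝ} {Z : ℝ → 𝓢'(Space d, ℂ)} (h : IsGevrey χ c₀ T z Z) {c : ℤ → ℝ≥0∞}
    (hc : ∀ j, essSup (fun t => lpNorm (ENNReal.ofReal p) (block χ j (Z t)))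
      (volume.restrict (timeInterval T)) ≤ c j) (hct : besovSum (d / p) c ≠ ⊤)
    (hT : MeasurableSet (timeInterval T)) :
    ∃ U : ℝ → ℤ → Space d → ℂ, (∀ j, StronglyMeasurable fun q : ℝ × Space d => U q.1 j q.2) ∧
      ∀ᵐ t ∂(volume.restrict (timeInterval T)), (∀ j, Represents (U t j) (block χ j (Z t))) ∧
        IsDecomp χ p (Real.sqrt (c₀ * t)) c (U t)
          (fun x => ∑' j, cv (kernel (Real.sqrt (c₀ * t))) (U t j) x) ∧
        (fun x => (z t x : ℂ)) =ᵐ[volume]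
          fun x => ∑' j, cv (kernel (Real.sqrt (c₀ * t))) (U t j) x := by
  set x : ℕ → Space d := TopologicalSpace.denseSeq (Space d) with hx
  have hm : ∀ j n, AEStronglyMeasurable (fun t => block χ j (Z t) (fatTest hχ j (x n)))
      (volume.restrict (timeInterval T)) := fun j n => h.measurable _
  have hae : ∀ᵐ t ∂(volume.restrict (timeInterval T)), t ∈ timeInterval T ∧
      (∃ u : 𝓢'(Space d, ℂ), Represents (fun x => (z t x : ℂ)) u ∧
        IsExp χ (Real.sqrt (c₀ * t)) u (Z t)) ∧
      (∀ j, lpNorm (ENNReal.ofReal p) (block χ j (Z t)) ≤ c j) ∧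
      ∀ j n, block χ j (Z t) (fatTest hχ j (x n)) = (hm j n).mk _ t := by
    filter_upwards [ae_restrict_mem hT, h.isExp,
      ae_all_iff.2 fun j => ENNReal.ae_le_essSup (μ := volume.restrict (timeInterval T))
        fun t => lpNorm (ENNReal.ofReal p) (block χ j (Z t)),
      ae_all_iff.2 fun j => ae_all_iff.2 fun n => (hm j n).ae_eq_mk] with t h1 h2 h3 h4
    exact ⟨h1, h2, fun j => (h3 j).trans (hc j), h4⟩
  obtain ⟨G, hG, hGm, hGP⟩ := hae.exists_measurable_mem
  classical
  have key := fun t (ht : t ∈ G) => (hGP t ht).2.1.choose_spec.2.isDecomp hχ hp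
    (Real.sqrt_pos.2 (mul_pos hc₀ (hGP t ht).1.1)) (hGP t ht).2.2.1 hct
    (hGP t ht).2.1.choose_spec.1
  refine ⟨fun t j y => if t ∈ G then block χ j (Z t) (fatTest hχ j y) else 0, fun j => ?_, ?_⟩
  · refine stronglyMeasurable_uncurry_of_dense (f := fun t y =>
      if t ∈ G then block χ j (Z t) (fatTest hχ j y) else 0) (fun t => ?_) fun n => ?_
    · by_cases ht : t ∈ G
      · simp only [ht, if_true]
        exact ((key t ht).1 j).2
      · simp only [ht, if_false]
        exact continuous_const
    · have : (fun t => if t ∈ G then block χ j (Z t) (fatTest hχ j (x n)) else 0) =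
          G.indicator ((hm j n).mk _) := by
        funext t
        by_cases ht : t ∈ G
        · rw [if_pos ht, Set.indicator_of_mem ht, (hGP t ht).2.2.2 j n]
        · rw [if_neg ht, Set.indicator_of_notMem ht]
      exact this ▸ (hm j n).stronglyMeasurable_mk.indicator hGm
  · filter_upwards [hG] with t ht
    simp only [ht, if_true]
    exact ⟨fun j => ((key t ht).1 j).1, (key t ht).2⟩

end TimeBlocks

/-! ### Assembly. -/

section Conclusion

variable {d : ℕ} {χ : Space d → ℝ} {p : ℝ}

/-- A shift of the index by m costs 2^{-ms}, and |m| ≤ 2. This pays for passing from a decomposition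
to true dyadic blocks, which mix neighbouring indices. -/
theorem exists_besovSum_window_le (s : ℝ) : ∃ C : ℝ≥0∞, C ≠ ⊤ ∧ ∀ c : ℤ → ℝ≥0∞,
    besovSum s (fun j => ∑ k ∈ Finset.Icc (j - 2) (j + 2), c k) ≤ C * besovSum s c := by
  refine ⟨∑ m ∈ Finset.Icc (-2 : ℤ) 2, (2 : ℝ≥0∞) ^ (-((m : ℝ) * s)),
    ENNReal.sum_ne_top.2 fun m _ => two_rpow_ne_top _, fun c => ?_⟩
  have e : ∀ j : ℤ, ∑ k ∈ Finset.Icc (j - 2) (j + 2), c k =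
      ∑ m ∈ Finset.Icc (-2 : ℤ) 2, c (j + m) := fun j => by
    rw [show j - 2 = j + -2 by ring, ← Finset.image_add_left_Icc, Finset.sum_image (by simp)]
  unfold besovSum
  simp_rw [e, Finset.mul_sum]
  rw [Summable.tsum_finsetSum fun _ _ => ENNReal.summable, Finset.sum_mul]
  refine Finset.sum_le_sum fun m _ => ?_
  rw [← (Equiv.addRight m).tsum_eq (fun j : ℤ => (2 : ℝ≥0∞) ^ ((j : ℝ) * s) * c j),
    ← ENNReal.tsum_mul_left]
  refine ENNReal.tsum_le_tsum fun j => le_of_eq ?_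
  simp only [Equiv.coe_addRight]
  rw [← mul_assoc, ← two_rpow_add]
  congr 2
  push_cast
  ring

theorem measurableSet_timeInterval (T : ℝ≥0∞) : MeasurableSet (timeInterval T) :=
  measurableSet_Ioi.inter (ENNReal.measurable_ofReal measurableSet_Iio)

/-- Restriction of a decomposition to a measurable set of times. -/
theorem isTimeDecomp_indicator {a : ℝ → ℝ} {c : ℤ → ℝ≥0∞} {z : ℝ → Space d → ℂ}
    {U : ℝ → ℤ → Space d → ℂ} {G : Set ℝ} (hG : MeasurableSet G) [DecidablePred (· ∈ G)]
    (hU : ∀ j, StronglyMeasurable fun q : ℝ × Space d => U q.1 j q.2)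
    (h : ∀ t ∈ G, IsDecomp χ p (a t) c (U t) (z t)) :
    IsTimeDecomp χ p a c (fun t => if t ∈ G then z t else 0) (fun t => if t ∈ G then U t else 0) := by
  refine ⟨fun j => ?_, fun t => ?_⟩
  · have : (fun q : ℝ × Space d => (if q.1 ∈ G then U q.1 else 0) j q.2) =
        (Prod.fst ⁻¹' G : Set (ℝ × Space d)).indicator fun q => U q.1 j q.2 := by
      funext q
      by_cases hq : q.1 ∈ G
      · rw [if_pos hq, Set.indicator_of_mem (Set.mem_preimage.2 hq)]
      · rw [if_neg hq, Set.indicator_of_notMem (s := Prod.fst ⁻¹' G) (a := q) (by simpa using hq)]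
        rfl
    rw [this]
    exact (hU j).indicator (measurable_fst hG)
  · by_cases ht : t ∈ G
    · simp only [ht, if_true]
      exact h t ht
    · simp only [ht, if_false]
      refine ⟨fun j => ⟨MemLp.zero', ?_⟩, fun j => ?_, fun x => ?_⟩
      · funext x; simp [cv]
      · simp
      · simp [cv]

/-- The blocks of Z₁ and Z₂ give time dependent decompositions, and by linearity their differences
are the blocks of Z₂ − Z₁, so the majorant of the difference is exactly its Chemin-Lerner sequence.
The composed decomposition is then summed back to a distribution. The choice r = max(p, p') turns
d/r into min(d/p, d/p'). -/
theorem exists_gevrey_comp (hd : 1 ≤ d) (hχ : IsCutoff χ) (hp : 1 < p) {F : ℝ → ℝ}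
    (hF : AnalyticAt ℝ F 0) :
    ∃ R₀ : ℝ, 0 < R₀ ∧ ∀ s : ℝ, -min (d / p) (d * (1 - 1 / p)) < s → s ≤ d / p →
        ∃ D : ℝ, 0 < D ∧ ∀ c₀ : ℝ, 0 < c₀ → ∀ T : ℝ≥0∞, 0 < T →
          ∀ (z₁ z₂ : ℝ → Space d → ℝ) (Z₁ Z₂ : ℝ → 𝓢'(Space d, ℂ)),
            IsGevrey χ c₀ T z₁ Z₁ → IsGevrey χ c₀ T z₂ Z₂ →
            cheminLernerNorm χ T p (d / p) Z₁ ≤ ENNReal.ofReal R₀ →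
            cheminLernerNorm χ T p (d / p) Z₂ ≤ ENNReal.ofReal R₀ →
            ∃ W : ℝ → 𝓢'(Space d, ℂ),
              IsGevrey χ c₀ T (fun t x => F (z₂ t x) - F (z₁ t x)) W ∧
              cheminLernerNorm χ T p s W ≤
                ENNReal.ofReal D * cheminLernerNorm χ T p s (fun t => Z₂ t - Z₁ t) := by
  classical
  set r : ℝ := max p p.conjExponent with hr
  have hpq := Real.HolderConjugate.conjExponent hp
  have hp1 : 1 ≤ ENNReal.ofReal p := by simpa using hp.le
  obtain ⟨R, hR, hcomp⟩ := exists_isTimeDecomp_comp (F := F) hd hχ hp (le_max_left p p.conjExponent)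
    (le_max_right _ _) hF
  obtain ⟨K, hK, hexp⟩ := exists_isExp_of_isDecomp (p := p) hχ hp
  obtain ⟨B, hB, hBd⟩ := exists_localized_bounds hχ hp
  refine ⟨R, hR, fun s hs hs' => ?_⟩
  have hrs : -(d / r : ℝ) < s := by
    refine lt_of_le_of_lt (neg_le_neg ?_) hs
    rcases le_total p p.conjExponent with h | h
    · rw [hr, max_eq_right h]
      refine (min_le_right _ _).trans (le_of_eq ?_)
      rw [div_eq_mul_inv (d : ℝ) p.conjExponent, ← hpq.one_sub_inv, one_div]
    · rw [hr, max_eq_left h]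
      exact min_le_left _ _
  obtain ⟨D, hD, hcompD⟩ := hcomp s hrs hs'
  obtain ⟨C, hC, hwin⟩ := exists_besovSum_window_le s
  have hKCD : K * (C * D) ≠ ⊤ := by finiteness
  -- The added 1 only makes the constant positive.
  refine ⟨(K * (C * D)).toReal + 1, by positivity, ?_⟩
  intro c₀ hc₀ T hT z₁ z₂ Z₁ Z₂ h₁ h₂ hR₁ hR₂
  have hTm := measurableSet_timeInterval T
  set μ := (volume : Measure ℝ).restrict (timeInterval T) with hμ
  set e : (ℝ → 𝓢'(Space d, ℂ)) → ℤ → ℝ≥0∞ := fun Z j =>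
    essSup (fun t => lpNorm (ENNReal.ofReal p) (block χ j (Z t))) μ with he
  have hne : ∀ Z : ℝ → 𝓢'(Space d, ℂ), cheminLernerNorm χ T p (d / p) Z ≤ ENNReal.ofReal R →
      besovSum (d / p) (e Z) ≠ ⊤ := fun Z h => ne_top_of_le_ne_top ENNReal.ofReal_ne_top h
  obtain ⟨U₁, hU₁m, hU₁⟩ := h₁.exists_blocks hχ hp hc₀ (c := e Z₁) (fun _ => le_rfl) (hne Z₁ hR₁) hTm
  obtain ⟨U₂, hU₂m, hU₂⟩ := h₂.exists_blocks hχ hp hc₀ (c := e Z₂) (fun _ => le_rfl) (hne Z₂ hR₂) hTm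
  set cy : ℤ → ℝ≥0∞ := e fun t => Z₂ t - Z₁ t with hcy
  have hgood := (ae_restrict_mem hTm).and (hU₁.and (hU₂.and (ae_all_iff.2 fun j : ℤ =>
    ENNReal.ae_le_essSup (μ := μ) fun t =>
      lpNorm (ENNReal.ofReal p) (block χ j (Z₂ t - Z₁ t)))))
  obtain ⟨G, hG, hGm, hGP⟩ := hgood.exists_measurable_mem
  -- The analyticity radius is extended by 1 to t ≤ 0, so that it is positive at all times; only
  -- times in the interval matter.
  set a : ℝ → ℝ := fun t => if 0 < t then Real.sqrt (c₀ * t) else 1 with ha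
  have ham : Measurable a := Measurable.ite measurableSet_Ioi (by fun_prop) measurable_const
  have ha0 : ∀ t, 0 < a t := by
    intro t
    rw [ha]
    simp only
    split_ifs with h
    · exact Real.sqrt_pos.2 (mul_pos hc₀ h)
    · exact one_pos
  have hat : ∀ t ∈ G, a t = Real.sqrt (c₀ * t) := fun t ht => if_pos (hGP t ht).1.1
  have hdec : ∀ (Z : ℝ → 𝓢'(Space d, ℂ)) (U : ℝ → ℤ → Space d → ℂ),
      (∀ j, StronglyMeasurable fun q : ℝ × Space d => U q.1 j q.2) →
      (∀ t ∈ G, IsDecomp χ p (Real.sqrt (c₀ * t)) (e Z) (U t)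
        (fun x => ∑' j, cv (kernel (Real.sqrt (c₀ * t))) (U t j) x)) →
      IsTimeDecomp χ p a (e Z) (fun t => if t ∈ G then fun x =>
        ∑' j, cv (kernel (Real.sqrt (c₀ * t))) (U t j) x else 0)
        (fun t => if t ∈ G then U t else 0) := fun Z U hUm hU =>
    isTimeDecomp_indicator hGm hUm fun t ht => by rw [hat t ht]; exact hU t ht
  have hd₁ := hdec Z₁ U₁ hU₁m fun t ht => (hGP t ht).2.1.2.1
  have hd₂ := hdec Z₂ U₂ hU₂m fun t ht => (hGP t ht).2.2.1.2.1
  have hrep : ∀ t ∈ G, ∀ j, Represents (U₂ t j - U₁ t j) (block χ j (Z₂ t - Z₁ t)) := by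
    intro t ht j
    rw [map_sub]
    exact ((hGP t ht).2.2.1.1 j).sub ((hGP t ht).2.1.1 j)
  have hcyb : ∀ t j, eLpNorm ((if t ∈ G then U₂ t else 0) j - (if t ∈ G then U₁ t else 0) j)
      (ENNReal.ofReal p) volume ≤ cy j := by
    intro t j
    by_cases ht : t ∈ G
    · rw [if_pos ht, if_pos ht, ← (hrep t ht j).lpNorm_eq]
      exact (hGP t ht).2.2.2 j
    · rw [if_neg ht, if_neg ht, sub_self, eLpNorm_zero]
      exact zero_le
  -- The difference has finite critical norm by the triangle inequality, whether or not its s-norm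
  -- is finite.
  have hcyt : besovSum (d / p) cy ≠ ⊤ := by
    refine ne_top_of_le_ne_top (b := besovSum (d / p) fun j => e Z₂ j + e Z₁ j) ?_
      (besovSum_mono fun j => ?_)
    · rw [besovSum_add]
      exact ENNReal.add_ne_top.2 ⟨hne Z₂ hR₂, hne Z₁ hR₁⟩
    · refine essSup_le_of_ae_le _ ?_
      filter_upwards [hG] with t ht
      have d₁ := (hGP t ht).2.1.2.1
      have d₂ := (hGP t ht).2.2.1.2.1
      rw [(hrep t ht j).lpNorm_eq]
      exact (eLpNorm_sub_le (d₂.localized j).memLp.1 (d₁.localized j).memLp.1 hp1).trans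
        (add_le_add (d₂.bound j) (d₁.bound j))
  obtain ⟨c, w, W, hW, hct, hcs, hw⟩ := hcompD a ham ha0 _ _ cy _ _ _ _ hd₁ hd₂ hR₁ hR₂ hcyb hcyt
  choose u V hu hV hVe hVn using fun t => hexp (a t) (ha0 t) c (W t) (w t) (hW.decomp t) hct
  refine ⟨V, ⟨fun ψ => ?_, ?_⟩, ?_⟩
  -- The distributions are chosen at each time separately, yet their pairings are given by this
  -- integral, which is measurable in t whatever the choice.
  · have e1 : (fun t => V t ψ) = fun t => ∫ x, ψ x * ∑' k, W t k x :=
      funext fun t => (hV t ψ).2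
    rw [e1]
    refine StronglyMeasurable.aestronglyMeasurable ?_
    refine StronglyMeasurable.integral_prod_right'
      (f := fun q : ℝ × Space d => ψ q.2 * ∑' k, W q.1 k q.2) ?_
    refine StronglyMeasurable.mul
      (ψ.continuous.comp continuous_snd).stronglyMeasurable ?_
    refine stronglyMeasurable_tsum (f := fun k (q : ℝ × Space d) => W q.1 k q.2) hW.meas fun q => ?_
    refine ne_top_of_le_ne_top (ENNReal.mul_ne_top hB hct) (tsum_enorm_le_besovSum fun k => ?_)
    exact ((hBd _ (ha0 q.1) k _ ((hW.decomp q.1).localized k) q.2).1).trans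
      (mul_le_mul_right (mul_le_mul_right ((hW.decomp q.1).bound k) _) _)
  · filter_upwards [hG] with t ht
    refine ⟨u t, (hu t).congr_ae ?_, hat t ht ▸ hVe t⟩
    filter_upwards [(hGP t ht).2.1.2.2, (hGP t ht).2.2.1.2.2] with x hx₁ hx₂
    refine hw t x _ _ ?_ ?_
    · rw [if_pos ht, hx₁]
    · rw [if_pos ht, hx₂]
  · calc cheminLernerNorm χ T p s V
        ≤ besovSum s (fun j => K * ∑ k ∈ Finset.Icc (j - 2) (j + 2), c k) :=
          besovSum_mono fun j => essSup_le_of_ae_le _ (.of_forall fun t => hVn t j)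
      _ ≤ K * (C * (D * besovSum s cy)) := by
          rw [besovSum_const_mul]
          exact mul_le_mul_right ((hwin c).trans (mul_le_mul_right hcs _)) _
      _ = K * (C * D) * besovSum s cy := by ring
      _ ≤ _ := by
          refine mul_le_mul_left ?_ _
          conv_lhs => rw [← ENNReal.ofReal_toReal hKCD]
          exact ENNReal.ofReal_le_ofReal (by linarith)

theorem represents_zero : Represents (0 : Space d → ℂ) 0 := fun ψ => by simp

theorem isGevrey_zero (c₀ : ℝ) (T : ℝ≥0∞) :
    IsGevrey χ c₀ T (fun _ _ => 0) (fun _ => 0) := by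
  have h0 : HomogeneousDist χ (0 : 𝓢'(Space d, ℂ)) := by
    have : (fun j : ℤ => lpNorm ⊤ (lowFreq χ j (0 : 𝓢'(Space d, ℂ)))) = fun _ => 0 := by
      funext j
      rw [map_zero, represents_zero.lpNorm_eq, eLpNorm_zero]
    rw [HomogeneousDist, this]
    exact tendsto_const_nhds
  refine ⟨fun ψ => ?_, .of_forall fun t => ⟨0, ?_, h0, h0, fun j => ⟨0, 1, le_rfl, MemLp.zero', ?_, ?_⟩⟩⟩
  · simpa using aestronglyMeasurable_const
  · simp only [Complex.ofReal_zero]; exact represents_zero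
  · simpa using represents_zero
  · have : expNeg (Real.sqrt (c₀ * t)) (0 : Space d → ℂ) = 0 := by
      funext x; simp [expNeg]
    rw [this, map_zero]
    exact represents_zero

theorem cheminLernerNorm_zero (T : ℝ≥0∞) (s : ℝ) :
    cheminLernerNorm χ T p s (fun _ => 0) = 0 := by
  have : lpNorm (ENNReal.ofReal p) (0 : 𝓢'(Space d, ℂ)) = 0 := by
    rw [represents_zero.lpNorm_eq, eLpNorm_zero]
  simp only [cheminLernerNorm, map_zero, this, ENNReal.tsum_eq_zero]
  exact fun j => mul_eq_zero_of_right _ (le_antisymm (essSup_le_of_ae_le _ (ae_eq_refl _).le) zero_le)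

end Conclusion

end GevreyBesov

end

theorem lemma2p4 (d : ℕ) (hd : 1 ≤ d) (χ : GevreyBesov.Space d → ℝ)
    (hχ : GevreyBesov.IsCutoff χ) (p : ℝ) (hp : 1 < p) (F : ℝ → ℝ) (hF : AnalyticAt ℝ F 0) :
    (F 0 = 0 →
      ∃ R₀ : ℝ, 0 < R₀ ∧ ∀ s : ℝ, -min (d / p) (d * (1 - 1 / p)) < s → s ≤ d / p →
        ∃ D : ℝ, 0 < D ∧ ∀ c₀ : ℝ, 0 < c₀ → ∀ T : ℝ≥0∞, 0 < T →
          ∀ (z : ℝ → GevreyBesov.Space d → ℝ) (Z : ℝ → 𝓢'(GevreyBesov.Space d, ℂ)),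
            GevreyBesov.IsGevrey χ c₀ T z Z →
            GevreyBesov.cheminLernerNorm χ T p (d / p) Z ≤ ENNReal.ofReal R₀ →
            ∃ W : ℝ → 𝓢'(GevreyBesov.Space d, ℂ),
              GevreyBesov.IsGevrey χ c₀ T (fun t x => F (z t x)) W ∧
              GevreyBesov.cheminLernerNorm χ T p s W ≤
                ENNReal.ofReal D * GevreyBesov.cheminLernerNorm χ T p s Z) ∧
    (∃ R₀ : ℝ, 0 < R₀ ∧ ∀ s : ℝ, -min (d / p) (d * (1 - 1 / p)) < s → s ≤ d / p →
        ∃ D : ℝ, 0 < D ∧ ∀ c₀ : ℝ, 0 < c₀ → ∀ T : ℝ≥0∞, 0 < T →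
          ∀ (z₁ z₂ : ℝ → GevreyBesov.Space d → ℝ) (Z₁ Z₂ : ℝ → 𝓢'(GevreyBesov.Space d, ℂ)),
            GevreyBesov.IsGevrey χ c₀ T z₁ Z₁ →
            GevreyBesov.IsGevrey χ c₀ T z₂ Z₂ →
            GevreyBesov.cheminLernerNorm χ T p (d / p) Z₁ ≤ ENNReal.ofReal R₀ →
            GevreyBesov.cheminLernerNorm χ T p (d / p) Z₂ ≤ ENNReal.ofReal R₀ →
            ∃ W : ℝ → 𝓢'(GevreyBesov.Space d, ℂ),
              GevreyBesov.IsGevrey χ c₀ T (fun t x => F (z₂ t x) - F (z₁ t x)) W ∧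
              GevreyBesov.cheminLernerNorm χ T p s W ≤
                ENNReal.ofReal D *
                  GevreyBesov.cheminLernerNorm χ T p s (fun t => Z₂ t - Z₁ t)) := by
  obtain ⟨R, hR, h⟩ := GevreyBesov.exists_gevrey_comp hd hχ hp hF
  refine ⟨fun hF0 => ⟨R, hR, fun s hs hs' => ?_⟩, R, hR, h⟩
  obtain ⟨D, hD, hDs⟩ := h s hs hs'
  refine ⟨D, hD, fun c₀ hc₀ T hT z Z hz hZ => ?_⟩
  -- The first part is the second one with z₁ = 0, as F(0) = 0.
  obtain ⟨W, hW, hn⟩ := hDs c₀ hc₀ T hT (fun _ _ => 0) z (fun _ => 0) Z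
    (GevreyBesov.isGevrey_zero c₀ T) hz
    (by rw [GevreyBesov.cheminLernerNorm_zero]; exact zero_le) hZ
  simp only [hF0, sub_zero] at hW hn
  exact ⟨W, hW, hn⟩
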